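/- Let $k$ be a field. A quasi-bialgebra is a $k$-algebra $H$ (associative, with unit) with algebra maps $\Delta:H\to H\otimes H$, $\Delta(h)=h_1\otimes h_2$, and $\varepsilon:H\to k$, and an invertible $\Phi=X^1\otimes X^2\otimes X^3\in H^{\otimes 3}$ (summation understood, further copies $Y^1\otimes Y^2\otimes Y^3$; $\Phi^{-1}=x^1\otimes x^2\otimes x^3=y^1\otimes y^2\otimes y^3$) such that $$(\mathrm{id}\otimes\Delta)(\Delta(h))=\Phi\,(\Delta\otimes \mathrm{id})(\Delta(h))\,\Phi^{-1},\qquad (\mathrm{id}\otimes\varepsilon)\Delta(h)=h=(\varepsilon\otimes\mathrm{id})\Delta(h),$$ $$(1\otimes\Phi)(\mathrm{id}\otimes\Delta\otimes\mathrm{id})(\Phi)(\Phi\otimes1)=(\mathrm{id}\otimes\mathrm{id}\otimes\Delta)(\Phi)(\Delta\otimes\mathrm{id}\otimes\mathrm{id})(\Phi),\qquad (\mathrm{id}\otimes\varepsilon\otimes\mathrm{id})(\Phi)=1\otimes 1 .$$ It is a quasi-Hopf algebra if it comes with a (bijective, $k$-linear) anti-automorphism $S$ of the algebra $H$ and elements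 $\alpha,\beta\in H$ with $S(h_1)\alpha h_2=\varepsilon(h)\alpha$, $h_1\beta S(h_2)=\varepsilon(h)\beta$, $X^1\beta S(X^2)\alpha X^3=1$ and $S(x^1)\alpha x^2\beta S(x^3)=1$. No finite-dimensionality is assumed. Left (right) $H$-modules form a monoidal category with $h\cdot(m\otimes n)=h_1\cdot m\otimes h_2\cdot n$ (resp. $(m\otimes n)\cdot h=m\cdot h_1\otimes n\cdot h_2$), unit object $k$ via $\varepsilon$, the usual unit constraints, and associativity constraint $(m\otimes n)\otimes p\mapsto X^1\cdot m\otimes(X^2\cdot n\otimes X^3\cdot p)$ (resp. $m\cdot x^1\otimes(n\cdot x^2\otimes p\cdot x^3)$). Consider the following four categories; in each, the objects are $H$-modules with a $k$-linear map (the coaction), no further condition being imposed on it than those listed, and the morphisms are the $H$-linear maps that preserve the coactions. 1. Left Yetter-Drinfeld modules ${}_H^H\mathcal{YD}$: left $H$-modules with $\lambda:M\to H\otimes M$, $\lambda(m)=m_{(-1)}\otimes m_{(0)}$, such that $\varepsilon(m_{(-1)})m_{(0)}=m$, $\;h_1m_{(-1)}\otimes h_2\cdot m_{(0)}=(h_1\cdot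 m)_{(-1)}h_2\otimes(h_1\cdot m)_{(0)}$ and $$X^1m_{(-1)}\otimes (X^2\cdot m_{(0)})_{(-1)}X^3\otimes (X^2\cdot m_{(0)})_{(0)}=X^1(Y^1\cdot m)_{(-1)_1}Y^2\otimes X^2(Y^1\cdot m)_{(-1)_2}Y^3\otimes X^3\cdot(Y^1\cdot m)_{(0)} .$$ The coaction on $M\otimes N$ is $\lambda(m\otimes n)=X^1(x^1Y^1\cdot m)_{(-1)}x^2(Y^2\cdot n)_{(-1)}Y^3\otimes X^2\cdot(x^1Y^1\cdot m)_{(0)}\otimes X^3x^3\cdot(Y^2\cdot n)_{(0)}$, the coaction on $k$ is $1\mapsto 1\otimes 1$, and the prebraiding is $m\otimes n\mapsto m_{(-1)}\cdot n\otimes m_{(0)}$. 2. Left-right Yetter-Drinfeld modules ${}_H\mathcal{YD}^H$: left $H$-modules with $\rho:M\to M\otimes H$, $\rho(m)=m_{(0)}\otimes m_{(1)}$, such that $\varepsilon(m_{(1)})m_{(0)}=m$, $\;h_1\cdot m_{(0)}\otimes h_2m_{(1)}=(h_2\cdot m)_{(0)}\otimes(h_2\cdot m)_{(1)}h_1$ and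 $$(x^2\cdot m_{(0)})_{(0)}\otimes (x^2\cdot m_{(0)})_{(1)}x^1\otimes x^3m_{(1)}=x^1\cdot(y^3\cdot m)_{(0)}\otimes x^2(y^3\cdot m)_{(1)_1}y^1\otimes x^3(y^3\cdot m)_{(1)_2}y^2 .$$ The coaction on $M\otimes N$ is $\rho(m\otimes n)=x^1X^1\cdot(y^2\cdot m)_{(0)}\otimes x^2\cdot(X^3y^3\cdot n)_{(0)}\otimes x^3(X^3y^3\cdot n)_{(1)}X^2(y^2\cdot m)_{(1)}y^1$, the coaction on $k$ is $1\mapsto 1\otimes 1$, and the prebraiding is $m\otimes n\mapsto n_{(0)}\otimes n_{(1)}\cdot m$. 3. Right Yetter-Drinfeld modules $\mathcal{YD}_H^H$: right $H$-modules with $\rho:M\to M\otimes H$, such that $\varepsilon(m_{(1)})m_{(0)}=m$, $\;m_{(0)}\cdot h_1\otimes m_{(1)}h_2=(m\cdot h_2)_{(0)}\otimes h_1(m\cdot h_2)_{(1)}$ and $$(m_{(0)}\cdot X^2)_{(0)}\otimes X^1(m_{(0)}\cdot X^2)_{(1)}\otimes m_{(1)}X^3=(m\cdot Y^3)_{(0)}\cdot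 X^1\otimes Y^1(m\cdot Y^3)_{(1)_1}X^2\otimes Y^2(m\cdot Y^3)_{(1)_2}X^3 .$$ The coaction on $M\otimes N$ is $\rho(m\otimes n)=(m\cdot X^2)_{(0)}\cdot x^1Y^1\otimes(n\cdot X^3x^3)_{(0)}\cdot Y^2\otimes X^1(m\cdot X^2)_{(1)}x^2(n\cdot X^3x^3)_{(1)}Y^3$, the coaction on $k$ is $1\mapsto 1\otimes 1$, and the prebraiding is $m\otimes n\mapsto n_{(0)}\otimes m\cdot n_{(1)}$. 4. Right-left Yetter-Drinfeld modules ${}^H\mathcal{YD}_H$: right $H$-modules with $\lambda:M\to H\otimes M$, such that $\varepsilon(m_{(-1)})m_{(0)}=m$, $\;m_{(-1)}h_1\otimes m_{(0)}\cdot h_2=h_2(m\cdot h_1)_{(-1)}\otimes(m\cdot h_1)_{(0)}$ and $$m_{(-1)}x^1\otimes x^3(m_{(0)}\cdot x^2)_{(-1)}\otimes(m_{(0)}\cdot x^2)_{(0)}=y^2(m\cdot y^1)_{(-1)_1}x^1\otimes y^3(m\cdot y^1)_{(-1)_2}x^2\otimes(m\cdot y^1)_{(0)}\cdot x^3 .$$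 The coaction on $M\otimes N$ is $\lambda(m\otimes n)=x^3(n\cdot x^2)_{(-1)}X^2(m\cdot x^1X^1)_{(-1)}y^1\otimes(m\cdot x^1X^1)_{(0)}\cdot y^2\otimes(n\cdot x^2)_{(0)}\cdot X^3y^3$, the coaction on $k$ is $1\mapsto 1\otimes 1$, and the prebraiding is $m\otimes n\mapsto n\cdot m_{(-1)}\otimes m_{(0)}$. With these tensor products, and with the constraints of the underlying modules, the four categories are prebraided monoidal for every quasi-bialgebra $H$ (a prebraiding is a braiding that need not be invertible). For a braided monoidal category $\mathcal C$ with braiding $c$, let $\mathcal C^{\rm in}$ be the same monoidal category with the braiding $\tilde c_{V,W}=c_{W,V}^{-1}$, and let $\overline{\mathcal C}$ be the category $\mathcal C$ with $V\,\overline\otimes\,W=W\otimes V$, associativity constraint $\overline a_{V,W,X}=a_{X,W,V}^{-1}$ and braiding $\overline c_{V,W}=c_{W,V}$. An isomorphism of braided monoidal categories is a functor that has a strict inverse (both composites equal the identity functors) and carries a structure of a strong monoidal functor compatible with the braidings. **Theorem.** Let $H$ be a quasi-Hopf algebra over a field $k$, not necessarily finite dimensional. Then the prebraidings of ${}_H^H\mathcal{YD}$,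 ${}_H\mathcal{YD}^H$, $\mathcal{YD}_H^H$ and ${}^H\mathcal{YD}_H$ are invertible, so that these are braided monoidal categories, and there are isomorphisms of braided monoidal categories $${}_H^H\mathcal{YD}\;\cong\;({}_H\mathcal{YD}^H)^{\rm in}\;\cong\;\overline{\mathcal{YD}_H^H}\;\cong\;\overline{{}^H\mathcal{YD}_H}^{\,\rm in}.$$ -/

import Mathlib

open CategoryTheory

universe v u

noncomputable section

namespace QuasiHopfYD

section Algebra

open scoped TensorProduct
open Algebra.TensorProduct (map assoc includeRight)

/-- A quasi-bialgebra `(H, Δ, ε, Φ)` over a field `k`. Triple (and quadruple) tensor powers of `H`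
are bracketed to the right, and `assoc` is the canonical rebracketing of tensor products of
algebras (it does not involve `Φ`). -/
class QuasiBialgebra (k H : Type u) [Field k] [Ring H] [Algebra k H] where
  /-- the comultiplication `Δ` -/
  comul : H →ₐ[k] H ⊗[k] H
  /-- the counit `ε` -/
  counit : H →ₐ[k] k
  /-- the reassociator `Φ`, an invertible element of `H ⊗ H ⊗ H` -/
  reassociator : (H ⊗[k] (H ⊗[k] H))ˣ
  /-- `(id ⊗ Δ)(Δ h) = Φ (Δ ⊗ id)(Δ h) Φ⁻¹` -/
  quasi_coassoc : ∀ h : H,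
    map (.id k H) comul (comul h) =
      ↑reassociator * assoc k k k H H H (map comul (.id k H) (comul h)) * ↑reassociator⁻¹
  /-- `(id ⊗ ε)(Δ h) = h` -/
  counit_right : ∀ h : H,
    Algebra.TensorProduct.rid k k H (map (.id k H) counit (comul h)) = h
  /-- `(ε ⊗ id)(Δ h) = h` -/
  counit_left : ∀ h : H,
    Algebra.TensorProduct.lid k H (map counit (.id k H) (comul h)) = h
  /-- `(1 ⊗ Φ) (id ⊗ Δ ⊗ id)(Φ) (Φ ⊗ 1) = (id ⊗ id ⊗ Δ)(Φ) (Δ ⊗ id ⊗ id)(Φ)` -/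
  cocycle :
    ((1 : H) ⊗ₜ[k] (reassociator : H ⊗[k] (H ⊗[k] H))) *
        map (.id k H) ((assoc k k k H H H).toAlgHom.comp (map comul (.id k H))) reassociator *
        map (.id k H) (assoc k k k H H H).toAlgHom
          (assoc k k k H (H ⊗[k] H) H ((reassociator : H ⊗[k] (H ⊗[k] H)) ⊗ₜ[k] (1 : H))) =
      map (.id k H) (map (.id k H) comul) reassociator *
        assoc k k k H H (H ⊗[k] H) (map comul (.id k (H ⊗[k] H)) reassociator)
  /-- `(id ⊗ ε ⊗ id)(Φ) = 1 ⊗ 1` -/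
  counit_reassociator :
    map (.id k H) ((Algebra.TensorProduct.lid k H).toAlgHom.comp (map counit (.id k H)))
      reassociator = 1

/-- A quasi-Hopf algebra `(H, Δ, ε, Φ, S, α, β)` over a field `k`: a quasi-bialgebra with an
anti-automorphism `S` of the algebra `H` and two elements `α, β` of `H`. No finiteness is assumed. -/
class QuasiHopfAlgebra (k H : Type u) [Field k] [Ring H] [Algebra k H] extends
    QuasiBialgebra k H where
  /-- the antipode `S`, a bijective linear map -/
  antipode : H ≃ₗ[k] H
  antipode_one : antipode 1 = 1
  antipode_mul : ∀ g h : H, antipode (g * h) = antipode h * antipode g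
  /-- the element `α` -/
  alpha : H
  /-- the element `β` -/
  beta : H
  /-- `S(h₁) α h₂ = ε(h) α` -/
  antipode_alpha : ∀ h : H,
    LinearMap.mul' k H (TensorProduct.map (LinearMap.mulRight k alpha ∘ₗ antipode.toLinearMap)
      LinearMap.id (comul h)) = counit h • alpha
  /-- `h₁ β S(h₂) = ε(h) β` -/
  antipode_beta : ∀ h : H,
    LinearMap.mul' k H (TensorProduct.map (LinearMap.mulRight k beta) antipode.toLinearMap
      (comul h)) = counit h • beta
  /-- `X¹ β S(X²) α X³ = 1`, where `Φ = X¹ ⊗ X² ⊗ X³` -/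
  antipode_reassociator :
    LinearMap.mul' k H (TensorProduct.map (LinearMap.mulRight k beta)
      (LinearMap.mul' k H ∘ₗ TensorProduct.map
        (LinearMap.mulRight k alpha ∘ₗ antipode.toLinearMap) LinearMap.id)
      (reassociator : H ⊗[k] (H ⊗[k] H))) = 1
  /-- `S(x¹) α x² β S(x³) = 1`, where `Φ⁻¹ = x¹ ⊗ x² ⊗ x³` -/
  antipode_reassociator_inv :
    LinearMap.mul' k H (TensorProduct.map (LinearMap.mulRight k alpha ∘ₗ antipode.toLinearMap)
      (LinearMap.mul' k H ∘ₗ TensorProduct.map (LinearMap.mulRight k beta) antipode.toLinearMap)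
      ((reassociator⁻¹ : (H ⊗[k] (H ⊗[k] H))ˣ) : H ⊗[k] (H ⊗[k] H))) = 1

section Opposite

section TensorLemmas

variable {k : Type u} [Field k] {A B C A' B' C' A₁ B₁ A₁' B₁' : Type u}
  [Ring A] [Algebra k A] [Ring B] [Algebra k B] [Ring C] [Algebra k C]
  [Ring A'] [Algebra k A'] [Ring B'] [Algebra k B'] [Ring C'] [Algebra k C']
  [Ring A₁] [Algebra k A₁] [Ring B₁] [Algebra k B₁] [Ring A₁'] [Algebra k A₁']
  [Ring B₁'] [Algebra k B₁']

theorem map_antimul {f : A →ₗ[k] A'} {g : B →ₗ[k] B'}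
    (hf : ∀ x y, f (x * y) = f y * f x) (hg : ∀ x y, g (x * y) = g y * g x)
    (x y : A ⊗[k] B) :
    TensorProduct.map f g (x * y) = TensorProduct.map f g y * TensorProduct.map f g x := by
  induction x using TensorProduct.induction_on with
  | zero => simp
  | add x x' hx hx' => simp only [add_mul, mul_add, map_add, hx, hx']
  | tmul a b =>
    induction y using TensorProduct.induction_on with
    | zero => simp
    | add x x' hx hx' => simp only [add_mul, mul_add, map_add, hx, hx']
    | tmul c d => simp [hf, hg]

theorem assoc_map (f : A →ₗ[k] A') (g : B →ₗ[k] B') (h : C →ₗ[k] C') (x : (A ⊗[k] B) ⊗[k] C) :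
    assoc k k k A' B' C' (TensorProduct.map (TensorProduct.map f g) h x) =
      TensorProduct.map f (TensorProduct.map g h) (assoc k k k A B C x) :=
  (TensorProduct.map_map_assoc f g h x).symm

theorem map_comm {f : A →ₗ[k] A'} {g : B →ₗ[k] B'} {f₁ : A₁ →ₗ[k] A₁'} {g₁ : B₁ →ₗ[k] B₁'}
    {p : A →ₐ[k] A₁} {q : B →ₐ[k] B₁} {p' : A' →ₐ[k] A₁'} {q' : B' →ₐ[k] B₁'}
    (hf : ∀ x, p' (f x) = f₁ (p x)) (hg : ∀ x, q' (g x) = g₁ (q x)) (x : A ⊗[k] B) :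
    map p' q' (TensorProduct.map f g x) = TensorProduct.map f₁ g₁ (map p q x) := by
  induction x using TensorProduct.induction_on with
  | zero => simp
  | add x y hx hy => simp only [map_add, hx, hy]
  | tmul a b => simp [hf, hg]

end TensorLemmas

variable {k H : Type u} [Field k] [Ring H] [Algebra k H]

theorem inv_eq_aux {R : Type u} [Monoid R] {a₁ a₂ a₃ a₄ a₅ b₁ b₂ b₃ b₄ b₅ : R}
    (hc : a₁ * a₂ * a₃ = a₄ * a₅) (h1 : b₁ * a₁ = 1) (h2 : b₂ * a₂ = 1) (h3 : b₃ * a₃ = 1)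
    (h4 : a₄ * b₄ = 1) (h5 : a₅ * b₅ = 1) : b₃ * (b₂ * b₁) = b₅ * b₄ := by
  refine left_inv_eq_right_inv (a := a₁ * a₂ * a₃) ?_ ?_
  · calc b₃ * (b₂ * b₁) * (a₁ * a₂ * a₃) = b₃ * (b₂ * (b₁ * a₁) * a₂) * a₃ := by
          simp only [mul_assoc]
      _ = 1 := by rw [h1, mul_one, h2, mul_one, h3]
  · rw [hc]
    calc a₄ * a₅ * (b₅ * b₄) = a₄ * (a₅ * b₅) * b₄ := by simp only [mul_assoc]
      _ = 1 := by rw [h5, mul_one, h4]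

theorem cocycle_inv [Q : QuasiBialgebra k H] :
    map (.id k H) (assoc k k k H H H).toAlgHom
        (assoc k k k H (H ⊗[k] H) H ((↑Q.reassociator⁻¹ : H ⊗[k] (H ⊗[k] H)) ⊗ₜ[k] (1 : H))) *
      (map (.id k H) ((assoc k k k H H H).toAlgHom.comp (map Q.comul (.id k H)))
        ↑Q.reassociator⁻¹ *
      ((1 : H) ⊗ₜ[k] (↑Q.reassociator⁻¹ : H ⊗[k] (H ⊗[k] H)))) =
    assoc k k k H H (H ⊗[k] H) (map Q.comul (.id k (H ⊗[k] H)) ↑Q.reassociator⁻¹) *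
      map (.id k H) (map (.id k H) Q.comul) ↑Q.reassociator⁻¹ := by
  have hpq := Q.reassociator.mul_inv
  have hqp := Q.reassociator.inv_mul
  refine inv_eq_aux Q.cocycle ?_ ?_ ?_ ?_ ?_
  · rw [Algebra.TensorProduct.tmul_mul_tmul, hqp, mul_one]; rfl
  · rw [← map_mul, hqp, map_one]
  · rw [← map_mul, ← map_mul, Algebra.TensorProduct.tmul_mul_tmul, hqp, mul_one]
    exact (congrArg _ (map_one _)).trans (map_one _)
  · rw [← map_mul, hpq, map_one]
  · rw [← map_mul, ← map_mul, hpq, map_one, map_one]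

theorem counit_reassociator_inv [Q : QuasiBialgebra k H] :
    map (.id k H) ((Algebra.TensorProduct.lid k H).toAlgHom.comp (map Q.counit (.id k H)))
      (↑Q.reassociator⁻¹ : H ⊗[k] (H ⊗[k] H)) = 1 := by
  have h := Units.mul_inv Q.reassociator
  have := congrArg (map (.id k H)
    ((Algebra.TensorProduct.lid k H).toAlgHom.comp (map Q.counit (.id k H)))) h
  rwa [map_mul, Q.counit_reassociator, one_mul, map_one] at this

section Transport

variable {H' : Type u} [Ring H'] [Algebra k H'] (o : H ≃ₗ[k] H')

/-- `o ⊗ o`, for a linear map `o`. -/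
abbrev o₂ (o : H ≃ₗ[k] H') : H ⊗[k] H →ₗ[k] H' ⊗[k] H' :=
  TensorProduct.map o.toLinearMap o.toLinearMap

/-- `o ⊗ o ⊗ o`, for a linear map `o`. -/
abbrev o₃ (o : H ≃ₗ[k] H') : H ⊗[k] (H ⊗[k] H) →ₗ[k] H' ⊗[k] (H' ⊗[k] H') :=
  TensorProduct.map o.toLinearMap (o₂ o)

/-- `o ⊗ o ⊗ o ⊗ o`, for a linear map `o`. -/
abbrev o₄ (o : H ≃ₗ[k] H') :
    H ⊗[k] (H ⊗[k] (H ⊗[k] H)) →ₗ[k] H' ⊗[k] (H' ⊗[k] (H' ⊗[k] H')) :=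
  TensorProduct.map o.toLinearMap (o₃ o)

theorem o₂_mul (hm : ∀ x y, o (x * y) = o y * o x) (x y : H ⊗[k] H) : o₂ o (x * y) = o₂ o y * o₂ o x :=
  map_antimul hm hm x y

theorem o₃_mul (hm : ∀ x y, o (x * y) = o y * o x) (x y : H ⊗[k] (H ⊗[k] H)) : o₃ o (x * y) = o₃ o y * o₃ o x :=
  map_antimul hm (o₂_mul o hm) x y

theorem o₄_mul (hm : ∀ x y, o (x * y) = o y * o x) (x y : H ⊗[k] (H ⊗[k] (H ⊗[k] H))) : o₄ o (x * y) = o₄ o y * o₄ o x :=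
  map_antimul hm (o₃_mul o hm) x y

theorem o₂_one (h1 : o 1 = 1) : o₂ o 1 = 1 := by
  simp [Algebra.TensorProduct.one_def, h1]

theorem o₃_one (h1 : o 1 = 1) : o₃ o 1 = 1 := by
  simp [Algebra.TensorProduct.one_def, h1]

variable [Q : QuasiBialgebra k H] (h1 : o 1 = 1) (hm : ∀ x y, o (x * y) = o y * o x) (E : H' →ₐ[k] k) (D : H' →ₐ[k] H' ⊗[k] H') (hE : ∀ h, E (o h) = Q.counit h)
  (hD : ∀ h, D (o h) = o₂ o (Q.comul h))

/-- If `o : H → H'` is an anti-isomorphism of algebras, then `H'` is a quasi-bialgebra with the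
comultiplication and the counit transported along `o` and with the reassociator
`(o ⊗ o ⊗ o)(Φ⁻¹)`. -/
abbrev antiTransport : QuasiBialgebra k H' where
  comul := D
  counit := E
  reassociator :=
    { val := o₃ o (↑Q.reassociator⁻¹ : H ⊗[k] (H ⊗[k] H))
      inv := o₃ o (Q.reassociator : H ⊗[k] (H ⊗[k] H))
      val_inv := by rw [← o₃_mul o hm, Units.mul_inv, o₃_one o h1]
      inv_val := by rw [← o₃_mul o hm, Units.inv_mul, o₃_one o h1] }
  quasi_coassoc h' := by
    obtain ⟨h, rfl⟩ := o.surjective h'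
    have a := map_comm (f := o.toLinearMap) (g := o.toLinearMap) (f₁ := o.toLinearMap) (g₁ := o₂ o)
      (p := .id k H) (q := Q.comul) (p' := .id k H') (q' := D) (fun _ => rfl) hD (Q.comul h)
    have b := map_comm (f := o.toLinearMap) (g := o.toLinearMap) (g₁ := o.toLinearMap) (f₁ := o₂ o)
      (q := .id k H) (p := Q.comul) (q' := .id k H') (p' := D) hD (fun _ => rfl) (Q.comul h)
    rw [hD, a, b, assoc_map, Q.quasi_coassoc]
    change o₃ o _ = o₃ o _ * o₃ o _ * o₃ o _
    rw [o₃_mul o hm, o₃_mul o hm, mul_assoc]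
  counit_right h' := by
    obtain ⟨h, rfl⟩ := o.surjective h'
    have e1 : ∀ x : H ⊗[k] H, Algebra.TensorProduct.rid k k H'
        (map (.id k H') E (o₂ o x)) =
        o (Algebra.TensorProduct.rid k k H (map (.id k H) Q.counit x)) := fun x => by
      induction x using TensorProduct.induction_on with
      | zero => simp
      | add x y hx hy => simp only [map_add, hx, hy]
      | tmul a b => simp [hE]
    rw [hD, e1, Q.counit_right]
  counit_left h' := by
    obtain ⟨h, rfl⟩ := o.surjective h'
    have e1 : ∀ x : H ⊗[k] H, Algebra.TensorProduct.lid k H'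
        (map E (.id k H') (o₂ o x)) =
        o (Algebra.TensorProduct.lid k H (map Q.counit (.id k H) x)) := fun x => by
      induction x using TensorProduct.induction_on with
      | zero => simp
      | add x y hx hy => simp only [map_add, hx, hy]
      | tmul a b => simp [hE]
    rw [hD, e1, Q.counit_left]
  cocycle := by
    have e0 : ∀ x : H ⊗[k] (H ⊗[k] H), (1 : H') ⊗ₜ[k] o₃ o x = o₄ o (1 ⊗ₜ x) :=
      fun x => by simp [h1]
    have e1 : ∀ x : H ⊗[k] (H ⊗[k] H), map (.id k H') ((assoc k k k H' H' H').toAlgHom.comp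
        (map D (.id k H'))) (o₃ o x) = o₄ o
          (map (.id k H) ((assoc k k k H H H).toAlgHom.comp (map Q.comul (.id k H))) x) :=
      map_comm (fun _ => rfl) fun y => by
        have := map_comm (f := o.toLinearMap) (g := o.toLinearMap) (f₁ := o₂ o)
          (g₁ := o.toLinearMap) (p := Q.comul) (q := .id k H) (p' := D) (q' := .id k H')
          hD (fun _ => rfl) y
        exact (congrArg _ this).trans (assoc_map _ _ _ _)
    have e2 : ∀ x : H ⊗[k] (H ⊗[k] H), map (.id k H') (assoc k k k H' H' H').toAlgHom
        (assoc k k k H' (H' ⊗[k] H') H' (o₃ o x ⊗ₜ[k] (1 : H'))) =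
        o₄ o (map (.id k H) (assoc k k k H H H).toAlgHom
          (assoc k k k H (H ⊗[k] H) H (x ⊗ₜ[k] (1 : H)))) := fun x => by
      have a := assoc_map o.toLinearMap (o₂ o) o.toLinearMap (x ⊗ₜ[k] (1 : H))
      rw [TensorProduct.map_tmul] at a
      have a' : o.toLinearMap 1 = 1 := h1
      rw [a'] at a
      refine (congrArg _ a).trans ?_
      exact map_comm (fun _ => rfl) (fun y => assoc_map _ _ _ _) _
    have e3 : ∀ x : H ⊗[k] (H ⊗[k] H), map (.id k H') (map (.id k H') D)
        (o₃ o x) = o₄ o (map (.id k H) (map (.id k H) Q.comul) x) :=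
      map_comm (fun _ => rfl) (map_comm (fun _ => rfl) hD)
    have e4 : ∀ x : H ⊗[k] (H ⊗[k] H), assoc k k k H' H' (H' ⊗[k] H')
        (map D (.id k (H' ⊗[k] H')) (o₃ o x)) =
        o₄ o (assoc k k k H H (H ⊗[k] H) (map Q.comul (.id k (H ⊗[k] H)) x)) := fun x => by
      have a := map_comm (f := o.toLinearMap) (g := o₂ o) (f₁ := o₂ o) (g₁ := o₂ o)
          (p := Q.comul) (q := .id k _) (p' := D) (q' := .id k _) hD (fun _ => rfl) x
      exact (congrArg _ a).trans (assoc_map _ _ _ _)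
    have hc := cocycle_inv (k := k) (H := H)
    rw [e0, e1, e2, e3, e4, ← o₄_mul o hm, ← o₄_mul o hm, ← o₄_mul o hm, hc]
  counit_reassociator := by
    have e1 : ∀ x : H ⊗[k] (H ⊗[k] H), map (.id k H')
        ((Algebra.TensorProduct.lid k H').toAlgHom.comp (map E (.id k H'))) (o₃ o x) =
          o₂ o (map (.id k H)
            ((Algebra.TensorProduct.lid k H).toAlgHom.comp (map Q.counit (.id k H))) x) :=
      map_comm (fun _ => rfl) fun y => by
        induction y using TensorProduct.induction_on with
        | zero => simp
        | add x y hx hy => simp only [map_add, hx, hy]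
        | tmul a b => simp [hE]
    rw [e1, counit_reassociator_inv, o₂_one o h1]

end Transport

variable (k H) in
/-- The opposite quasi-bialgebra `H^op`: the opposite multiplication, the same comultiplication and
the same counit as `H`, and the reassociator `Φ⁻¹`. -/
instance opQuasiBialgebra [Q : QuasiBialgebra k H] : QuasiBialgebra k Hᵐᵒᵖ :=
  antiTransport (MulOpposite.opLinearEquiv k : H ≃ₗ[k] Hᵐᵒᵖ) rfl (fun _ _ => rfl)
    (.ofLinearMap (Q.counit.toLinearMap ∘ₗ (MulOpposite.opLinearEquiv k).symm.toLinearMap)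
      (by simp) (by intro x y; simp [mul_comm]))
    (.ofLinearMap (o₂ (MulOpposite.opLinearEquiv k) ∘ₗ Q.comul.toLinearMap ∘ₗ
        (MulOpposite.opLinearEquiv k).symm.toLinearMap)
      (by simp [Algebra.TensorProduct.one_def])
      (by intro x y; simpa using o₂_mul (MulOpposite.opLinearEquiv k : H ≃ₗ[k] Hᵐᵒᵖ) (fun _ _ => rfl) _ _))
    (fun _ => rfl) (fun _ => rfl)

end Opposite

end Algebra

section Modules

open MonoidalCategory
open scoped TensorProduct

/-- If the algebra `A` acts on `V` and the algebra `B` acts on `W`, then `A ⊗ B` acts on `V ⊗ W`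
by `(a ⊗ b) (v ⊗ w) = a v ⊗ b w`. -/
def tensorAct {k A B V W : Type u} [Field k] [Ring A] [Algebra k A] [Ring B] [Algebra k B]
    [AddCommGroup V] [Module k V] [AddCommGroup W] [Module k W]
    (ρ : A →ₐ[k] Module.End k V) (σ : B →ₐ[k] Module.End k W) :
    A ⊗[k] B →ₐ[k] Module.End k (V ⊗[k] W) :=
  Module.endTensorEndAlgHom.comp (Algebra.TensorProduct.map ρ σ)

section

variable {k A B C A' B' V W X V' W' : Type u} [Field k] [Ring A] [Algebra k A] [Ring B]
  [Algebra k B] [Ring C] [Algebra k C] [Ring A'] [Algebra k A'] [Ring B'] [Algebra k B']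
  [AddCommGroup V] [Module k V] [AddCommGroup W] [Module k W] [AddCommGroup X] [Module k X]
  [AddCommGroup V'] [Module k V'] [AddCommGroup W'] [Module k W']
  {ρ : A →ₐ[k] Module.End k V} {σ : B →ₐ[k] Module.End k W} {τ : C →ₐ[k] Module.End k X}

@[simp]
theorem tensorAct_tmul (a : A) (b : B) (v : V) (w : W) :
    tensorAct ρ σ (a ⊗ₜ b) (v ⊗ₜ w) = ρ a v ⊗ₜ[k] σ b w := rfl

theorem tensorAct_comp (f : A' →ₐ[k] A) (g : B' →ₐ[k] B) (x : A' ⊗[k] B') :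
    tensorAct (ρ.comp f) (σ.comp g) x = tensorAct ρ σ (Algebra.TensorProduct.map f g x) := by
  induction x using TensorProduct.induction_on with
  | zero => simp
  | add x y hx hy => simp only [map_add, hx, hy]
  | tmul a b => rfl

theorem tensorAct_assoc (x : (A ⊗[k] B) ⊗[k] C) (v : (V ⊗[k] W) ⊗[k] X) :
    TensorProduct.assoc k V W X (tensorAct (tensorAct ρ σ) τ x v) =
      tensorAct ρ (tensorAct σ τ) (Algebra.TensorProduct.assoc k k k A B C x)
        (TensorProduct.assoc k V W X v) := by
  induction x using TensorProduct.induction_on with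
  | zero => simp
  | add x y hx hy => simp only [map_add, LinearMap.add_apply, hx, hy]
  | tmul x c =>
    induction x using TensorProduct.induction_on with
    | zero => simp
    | add x y hx hy => simp only [map_add, TensorProduct.add_tmul, LinearMap.add_apply, hx, hy]
    | tmul a b =>
      induction v using TensorProduct.induction_on with
      | zero => simp
      | add x y hx hy => simp only [map_add, hx, hy]
      | tmul v x =>
        induction v using TensorProduct.induction_on with
        | zero => simp
        | add x y hx hy => simp only [map_add, TensorProduct.add_tmul, hx, hy]
        | tmul v w => rfl

theorem tensorAct_natural {ρ' : A' →ₐ[k] Module.End k V'} {σ' : B' →ₐ[k] Module.End k W'}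
    {f : V →ₗ[k] V'} {g : W →ₗ[k] W'} {p : A →ₐ[k] A'} {q : B →ₐ[k] B'}
    (hf : ∀ a v, f (ρ a v) = ρ' (p a) (f v)) (hg : ∀ b w, g (σ b w) = σ' (q b) (g w))
    (x : A ⊗[k] B) (v : V ⊗[k] W) :
    TensorProduct.map f g (tensorAct ρ σ x v) =
      tensorAct ρ' σ' (Algebra.TensorProduct.map p q x) (TensorProduct.map f g v) := by
  induction x using TensorProduct.induction_on with
  | zero => simp
  | add x y hx hy => simp only [map_add, LinearMap.add_apply, hx, hy]
  | tmul a b =>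
    induction v using TensorProduct.induction_on with
    | zero => simp
    | add x y hx hy => simp only [map_add, hx, hy]
    | tmul v w => simp [hf, hg]

theorem tensorAct_map {ρ' : A →ₐ[k] Module.End k V'} {σ' : B →ₐ[k] Module.End k W'}
    {f : V →ₗ[k] V'} {g : W →ₗ[k] W'} (hf : ∀ a v, f (ρ a v) = ρ' a (f v))
    (hg : ∀ b w, g (σ b w) = σ' b (g w)) (x : A ⊗[k] B) (v : V ⊗[k] W) :
    TensorProduct.map f g (tensorAct ρ σ x v) = tensorAct ρ' σ' x (TensorProduct.map f g v) := by
  simpa using tensorAct_natural (p := .id k A) (q := .id k B) hf hg x v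

variable [Q : QuasiBialgebra k A] {σ₁ : A →ₐ[k] Module.End k W} {τ₁ : A →ₐ[k] Module.End k X}

/-- The action of the reassociator `Φ` on a triple tensor product of modules. -/
def reassocEquiv (ρ : A →ₐ[k] Module.End k V) (σ : A →ₐ[k] Module.End k W)
    (τ : A →ₐ[k] Module.End k X) : V ⊗[k] (W ⊗[k] X) ≃ₗ[k] V ⊗[k] (W ⊗[k] X) where
  toLinearMap := tensorAct ρ (tensorAct σ τ) ↑Q.reassociator
  invFun := tensorAct ρ (tensorAct σ τ) ↑Q.reassociator⁻¹
  left_inv x := by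
    change (tensorAct ρ (tensorAct σ τ) ↑Q.reassociator⁻¹ *
      tensorAct ρ (tensorAct σ τ) ↑Q.reassociator) x = x
    rw [← map_mul, Units.inv_mul, map_one]; rfl
  right_inv x := by
    change (tensorAct ρ (tensorAct σ τ) ↑Q.reassociator *
      tensorAct ρ (tensorAct σ τ) ↑Q.reassociator⁻¹) x = x
    rw [← map_mul, Units.mul_inv, map_one]; rfl

theorem reassoc_act (h : A) (x : (V ⊗[k] W) ⊗[k] X) :
    tensorAct ρ (tensorAct σ₁ τ₁) ↑Q.reassociator (TensorProduct.assoc k V W X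
      (tensorAct ((tensorAct ρ σ₁).comp Q.comul) τ₁ (Q.comul h) x)) =
      tensorAct ρ ((tensorAct σ₁ τ₁).comp Q.comul) (Q.comul h)
        (tensorAct ρ (tensorAct σ₁ τ₁) ↑Q.reassociator (TensorProduct.assoc k V W X x)) := by
  have e1 := tensorAct_comp (ρ := tensorAct ρ σ₁) (σ := τ₁) Q.comul (.id k A) (Q.comul h)
  have e2 := tensorAct_comp (ρ := ρ) (σ := tensorAct σ₁ τ₁) (.id k A) Q.comul (Q.comul h)
  rw [AlgHom.comp_id] at e1 e2
  rw [e1, e2, tensorAct_assoc, ← Module.End.mul_apply, ← Module.End.mul_apply, ← map_mul, ← map_mul,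
    Q.quasi_coassoc, Units.inv_mul_cancel_right]

theorem lid_tensorAct (h : A) (x : k ⊗[k] V) :
    TensorProduct.lid k V (tensorAct ((Algebra.lmul k k).comp Q.counit) ρ (Q.comul h) x) =
      ρ h (TensorProduct.lid k V x) := by
  have : ∀ y : A ⊗[k] A, TensorProduct.lid k V
      (tensorAct ((Algebra.lmul k k).comp Q.counit) ρ y x) =
      ρ (Algebra.TensorProduct.lid k A (Algebra.TensorProduct.map Q.counit (.id k A) y))
        (TensorProduct.lid k V x) := fun y => by
    induction y using TensorProduct.induction_on with
    | zero => simp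
    | add x y hx hy => simp only [map_add, LinearMap.add_apply, hx, hy]
    | tmul a b =>
      induction x using TensorProduct.induction_on with
      | zero => simp
      | add x y hx hy => simp only [map_add, hx, hy]
      | tmul c m => simp [mul_smul, smul_comm c]
  have e := this (Q.comul h)
  rwa [Q.counit_left] at e

theorem rid_tensorAct (h : A) (x : V ⊗[k] k) :
    TensorProduct.rid k V (tensorAct ρ ((Algebra.lmul k k).comp Q.counit) (Q.comul h) x) =
      ρ h (TensorProduct.rid k V x) := by
  have : ∀ y : A ⊗[k] A, TensorProduct.rid k V
      (tensorAct ρ ((Algebra.lmul k k).comp Q.counit) y x) =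
      ρ (Algebra.TensorProduct.rid k k A (Algebra.TensorProduct.map (.id k A) Q.counit y))
        (TensorProduct.rid k V x) := fun y => by
    induction y using TensorProduct.induction_on with
    | zero => simp
    | add x y hx hy => simp only [map_add, LinearMap.add_apply, hx, hy]
    | tmul a b =>
      induction x using TensorProduct.induction_on with
      | zero => simp
      | add x y hx hy => simp only [map_add, hx, hy]
      | tmul c m => simp [mul_smul, smul_comm m]
  have e := this (Q.comul h)
  rwa [Q.counit_right] at e

theorem triangle_tensorAct (x : (V ⊗[k] k) ⊗[k] W) :
    TensorProduct.map LinearMap.id (TensorProduct.lid k W).toLinearMap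
      (tensorAct ρ (tensorAct ((Algebra.lmul k k).comp Q.counit) σ₁) ↑Q.reassociator
        (TensorProduct.assoc k V k W x)) =
      TensorProduct.map (TensorProduct.rid k V).toLinearMap LinearMap.id x := by
  have : ∀ y : A ⊗[k] (A ⊗[k] A), TensorProduct.map LinearMap.id (TensorProduct.lid k W).toLinearMap
      (tensorAct ρ (tensorAct ((Algebra.lmul k k).comp Q.counit) σ₁) y
        (TensorProduct.assoc k V k W x)) =
      tensorAct ρ σ₁ (Algebra.TensorProduct.map (.id k A)
        ((Algebra.TensorProduct.lid k A).toAlgHom.comp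
          (Algebra.TensorProduct.map Q.counit (.id k A))) y)
      (TensorProduct.map (TensorProduct.rid k V).toLinearMap LinearMap.id x) := fun y => by
    induction y using TensorProduct.induction_on with
    | zero => simp
    | add x y hx hy => simp only [map_add, LinearMap.add_apply, hx, hy]
    | tmul a y =>
      induction y using TensorProduct.induction_on with
      | zero => simp
      | add x y hx hy => simp only [map_add, TensorProduct.tmul_add, LinearMap.add_apply, hx, hy]
      | tmul b c =>
        induction x using TensorProduct.induction_on with
        | zero => simp
        | add x y hx hy => simp only [map_add, hx, hy]
        | tmul x w =>
          induction x using TensorProduct.induction_on with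
          | zero => simp
          | add x y hx hy => simp only [map_add, TensorProduct.add_tmul, hx, hy]
          | tmul v r =>
            change ρ a v ⊗ₜ[k] ((Q.counit b * r) • σ₁ c w) =
              ρ a (r • v) ⊗ₜ[k] (σ₁ (Q.counit b • c) w)
            rw [map_smul, map_smul, LinearMap.smul_apply, TensorProduct.smul_tmul, mul_comm,
              mul_smul]
  have e := this Q.reassociator
  rwa [Q.counit_reassociator, map_one] at e

theorem lid_natural (f : V →ₗ[k] W) :
    (TensorProduct.lid k W).toLinearMap ∘ₗ TensorProduct.map LinearMap.id f =
      f ∘ₗ (TensorProduct.lid k V).toLinearMap :=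
  TensorProduct.ext' fun r m => by simp

theorem rid_natural (f : V →ₗ[k] W) :
    (TensorProduct.rid k W).toLinearMap ∘ₗ TensorProduct.map f LinearMap.id =
      f ∘ₗ (TensorProduct.rid k V).toLinearMap :=
  TensorProduct.ext' fun r m => by simp

theorem pentagon_tensorAct {Y : Type u} [AddCommGroup Y] [Module k Y]
    {υ : A →ₐ[k] Module.End k Y} (v : V) (w : W) (x : X) (y : Y) :
    TensorProduct.map LinearMap.id
      (tensorAct σ₁ (tensorAct τ₁ υ) ↑Q.reassociator ∘ₗ (TensorProduct.assoc k W X Y).toLinearMap)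
      (tensorAct ρ (tensorAct ((tensorAct σ₁ τ₁).comp Q.comul) υ) ↑Q.reassociator
        (TensorProduct.assoc k V (W ⊗[k] X) Y
          (tensorAct ρ (tensorAct σ₁ τ₁) ↑Q.reassociator (v ⊗ₜ (w ⊗ₜ x)) ⊗ₜ y))) =
      tensorAct ρ (tensorAct σ₁ ((tensorAct τ₁ υ).comp Q.comul)) ↑Q.reassociator
        (TensorProduct.assoc k V W (X ⊗[k] Y)
          (tensorAct ((tensorAct ρ σ₁).comp Q.comul) (tensorAct τ₁ υ) ↑Q.reassociator
            ((v ⊗ₜ w) ⊗ₜ (x ⊗ₜ y)))) := by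
  have l1 : ∀ z : A ⊗[k] (A ⊗[k] A), ∀ t : V ⊗[k] (W ⊗[k] X),
      tensorAct ρ (tensorAct σ₁ τ₁) z t ⊗ₜ[k] y =
      tensorAct (tensorAct ρ (tensorAct σ₁ τ₁)) υ (z ⊗ₜ[k] (1 : A)) (t ⊗ₜ[k] y) := fun z t => by
    rw [tensorAct_tmul, map_one]; rfl
  have l3 := tensorAct_comp (ρ := ρ) (σ := tensorAct (tensorAct σ₁ τ₁) υ) (.id k A)
    (Algebra.TensorProduct.map Q.comul (.id k A)) Q.reassociator
  have l3' : tensorAct ((tensorAct σ₁ τ₁).comp Q.comul) υ =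
      (tensorAct (tensorAct σ₁ τ₁) υ).comp (Algebra.TensorProduct.map Q.comul (.id k A)) :=
    AlgHom.ext fun t => by
      have := tensorAct_comp (ρ := tensorAct σ₁ τ₁) (σ := υ) Q.comul (.id k A) t
      rwa [AlgHom.comp_id] at this
  have l4 := fun z u => tensorAct_natural (ρ := ρ) (σ := tensorAct (tensorAct σ₁ τ₁) υ)
    (ρ' := ρ) (σ' := tensorAct σ₁ (tensorAct τ₁ υ)) (f := LinearMap.id)
    (g := (TensorProduct.assoc k W X Y).toLinearMap) (p := .id k A)
    (q := (Algebra.TensorProduct.assoc k k k A A A).toAlgHom) (fun _ _ => rfl)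
    (fun b w => tensorAct_assoc b w) z u
  have l5 : ∀ (z : A ⊗[k] (A ⊗[k] A)) (u : V ⊗[k] (W ⊗[k] (X ⊗[k] Y))),
      TensorProduct.map LinearMap.id (tensorAct σ₁ (tensorAct τ₁ υ) z) u =
      tensorAct ρ (tensorAct σ₁ (tensorAct τ₁ υ)) ((1 : A) ⊗ₜ[k] z) u := fun z u => by
    induction u using TensorProduct.induction_on with
    | zero => simp
    | add x y hx hy => simp only [map_add, hx, hy]
    | tmul v t => rw [tensorAct_tmul, map_one]; rfl
  have r1 := tensorAct_comp (ρ := tensorAct ρ σ₁) (σ := tensorAct τ₁ υ) Q.comul (.id k (A ⊗[k] A))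
    Q.reassociator
  rw [AlgHom.comp_id] at r1
  have r2 := tensorAct_comp (ρ := ρ) (σ := tensorAct σ₁ (tensorAct τ₁ υ)) (.id k A)
    (Algebra.TensorProduct.map (.id k A) Q.comul) Q.reassociator
  have r2' : tensorAct σ₁ ((tensorAct τ₁ υ).comp Q.comul) =
      (tensorAct σ₁ (tensorAct τ₁ υ)).comp (Algebra.TensorProduct.map (.id k A) Q.comul) :=
    AlgHom.ext fun t => by
      have := tensorAct_comp (ρ := σ₁) (σ := tensorAct τ₁ υ) (.id k A) Q.comul t
      rwa [AlgHom.comp_id] at this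
  rw [AlgHom.comp_id] at l3 r2
  have split : ∀ (f : W ⊗[k] (X ⊗[k] Y) →ₗ[k] W ⊗[k] (X ⊗[k] Y))
      (g : (W ⊗[k] X) ⊗[k] Y →ₗ[k] W ⊗[k] (X ⊗[k] Y)) (u : V ⊗[k] ((W ⊗[k] X) ⊗[k] Y)),
      TensorProduct.map LinearMap.id (f ∘ₗ g) u =
        TensorProduct.map LinearMap.id f (TensorProduct.map LinearMap.id g u) := fun f g u => by
    rw [← LinearMap.comp_apply, ← TensorProduct.map_comp, LinearMap.id_comp]
  rw [r1, r2', r2, tensorAct_assoc, l1, tensorAct_assoc, l3', l3, split, l4, l4, l5]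
  have hc := congrArg (tensorAct ρ (tensorAct σ₁ (tensorAct τ₁ υ))) Q.cocycle
  rw [map_mul, map_mul, map_mul] at hc
  have hm : ∀ z, Algebra.TensorProduct.map (.id k A) (Algebra.TensorProduct.assoc k k k A A A).toAlgHom
      (Algebra.TensorProduct.map (.id k A) (Algebra.TensorProduct.map Q.comul (.id k A)) z) =
      Algebra.TensorProduct.map (.id k A) ((Algebra.TensorProduct.assoc k k k A A A).toAlgHom.comp
        (Algebra.TensorProduct.map Q.comul (.id k A))) z := fun z => by
    induction z using TensorProduct.induction_on with
    | zero => simp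
    | add x y hx hy => simp only [map_add, hx, hy]
    | tmul v t => rfl
  rw [hm]
  exact congrArg (fun f : Module.End k (V ⊗[k] (W ⊗[k] (X ⊗[k] Y))) => f (v ⊗ₜ (w ⊗ₜ (x ⊗ₜ y)))) hc

end

/-- A left module over a `k`-algebra `H`, that is, a `k`-vector space `V` together with a
homomorphism of `k`-algebras `act : H → End_k(V)`; the action is `h • v = act h v`. -/
structure HMod (k H : Type u) [Field k] [Ring H] [Algebra k H] where
  /-- the underlying vector space -/
  carrier : Type u
  [addCommGroup : AddCommGroup carrier]
  [module : Module k carrier]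
  /-- the action of `H` -/
  act : H →ₐ[k] Module.End k carrier

namespace HMod

attribute [instance] HMod.addCommGroup HMod.module

section Category

variable {k H : Type u} [Field k] [Ring H] [Algebra k H]

instance : CoeSort (HMod k H) (Type u) := ⟨carrier⟩

/-- A homomorphism of left `H`-modules. -/
@[ext]
structure Hom (M N : HMod k H) where
  /-- the underlying `k`-linear map -/
  lin : M →ₗ[k] N
  map_act : ∀ h m, lin (M.act h m) = N.act h (lin m)

instance : Category (HMod k H) where
  Hom := Hom
  id M := ⟨LinearMap.id, fun _ _ => rfl⟩
  comp f g := ⟨g.lin ∘ₗ f.lin, fun h m => by simp [f.map_act, g.map_act]⟩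

@[ext]
theorem hom_ext {M N : HMod k H} {f g : M ⟶ N} (h : ∀ m, f.lin m = g.lin m) : f = g :=
  Hom.ext (LinearMap.ext h)

@[simp]
theorem id_lin (M : HMod k H) : Hom.lin (𝟙 M) = LinearMap.id := rfl

@[simp]
theorem comp_lin {M N P : HMod k H} (f : M ⟶ N) (g : N ⟶ P) :
    (f ≫ g).lin = g.lin ∘ₗ f.lin := rfl

/-- An isomorphism of modules from an equivariant linear equivalence. -/
def mkIso {M N : HMod k H} (e : M ≃ₗ[k] N) (he : ∀ h m, e (M.act h m) = N.act h (e m)) : M ≅ N where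
  hom := ⟨e.toLinearMap, he⟩
  inv := ⟨e.symm.toLinearMap, fun h m => by
    apply e.injective
    change e (e.symm _) = e _
    rw [he]
    simp⟩
  hom_inv_id := by ext m; exact e.symm_apply_apply m
  inv_hom_id := by ext m; exact e.apply_symm_apply m

variable (k H) in
/-- `H` as a left module over itself. -/
def regular : HMod k H where
  carrier := H
  act := Algebra.lmul k H

/-- For an element `x` of a module `X`, the module homomorphism `H → X`, `h ↦ h • x`. -/
def orbit {X : HMod k H} (x : X) : regular k H ⟶ X where
  lin := X.act.toLinearMap.flip x
  map_act h m := by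
    exact congrArg (fun f : Module.End k X => f x) (map_mul X.act h m)

end Category

section Monoidal

variable {k H : Type u} [Field k] [Ring H] [Algebra k H] [Q : QuasiBialgebra k H]

/-- The tensor product of two modules: `h • (m ⊗ n) = h₁ • m ⊗ h₂ • n`. -/
def tensor (M N : HMod k H) : HMod k H where
  carrier := M ⊗[k] N
  act := (tensorAct M.act N.act).comp Q.comul

variable (k H) in
/-- The ground field with the action of `H` through the counit. -/
def unit : HMod k H where
  carrier := k
  act := (Algebra.lmul k k).comp Q.counit

/-- The associativity constraint: `(m ⊗ n) ⊗ p ↦ X¹ • m ⊗ (X² • n ⊗ X³ • p)`, where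
`Φ = X¹ ⊗ X² ⊗ X³`. -/
def assocEquiv (M N P : HMod k H) : (M ⊗[k] N) ⊗[k] P ≃ₗ[k] M ⊗[k] (N ⊗[k] P) :=
  (TensorProduct.assoc k M N P).trans (reassocEquiv M.act N.act P.act)

/-- The tensor product of two module homomorphisms. -/
def tensorMap {M N M' N' : HMod k H} (f : M ⟶ M') (g : N ⟶ N') : tensor M N ⟶ tensor M' N' where
  lin := TensorProduct.map f.lin g.lin
  map_act _ x := tensorAct_map f.map_act g.map_act _ x

/-- The canonical map `r ⊗ m ↦ r m`. -/
abbrev lidEquiv (M : HMod k H) : k ⊗[k] M ≃ₗ[k] M := TensorProduct.lid k M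

/-- The canonical map `m ⊗ r ↦ r m`. -/
abbrev ridEquiv (M : HMod k H) : M ⊗[k] k ≃ₗ[k] M := TensorProduct.rid k M

instance : MonoidalCategoryStruct (HMod k H) where
  tensorObj := tensor
  whiskerLeft M _ _ f := tensorMap (𝟙 M) f
  whiskerRight f M := tensorMap f (𝟙 M)
  tensorHom f g := tensorMap f g
  tensorUnit := unit k H
  associator M N P := mkIso (assocEquiv M N P) fun _ _ => reassoc_act _ _
  leftUnitor M := mkIso (M := tensor (unit k H) M) (lidEquiv M) fun _ _ => lid_tensorAct _ _
  rightUnitor M := mkIso (M := tensor M (unit k H)) (ridEquiv M) fun _ _ => rid_tensorAct _ _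

/-- Two linear maps on `M ⊗ N` agree if they agree on pure tensors. -/
theorem tensor_ext {M N P : HMod k H} {f g : M ⊗ N ⟶ P}
    (h : ∀ (m : M) (n : N), f.lin (m ⊗ₜ[k] n : M ⊗[k] N) = g.lin (m ⊗ₜ[k] n : M ⊗[k] N)) : f = g :=
  Hom.ext (TensorProduct.ext' h)

instance : MonoidalCategory (HMod k H) where
  tensorHom_def f g := tensor_ext fun m n => rfl
  id_tensorHom_id M N := tensor_ext fun m n => rfl
  tensorHom_comp_tensorHom _ _ _ _ := tensor_ext fun m n => rfl
  whiskerLeft_id _ _ := tensor_ext fun m n => rfl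
  id_whiskerRight _ _ := tensor_ext fun m n => rfl
  associator_naturality {M₁ M₂ M₃ N₁ N₂ N₃} f g h := by
    refine HMod.hom_ext fun (x : (M₁ ⊗[k] M₂) ⊗[k] M₃) => ?_
    change tensorAct _ (tensorAct _ _) _ (TensorProduct.assoc k N₁ N₂ N₃
      (TensorProduct.map (TensorProduct.map f.lin g.lin) h.lin x)) = TensorProduct.map f.lin
      (TensorProduct.map g.lin h.lin) (tensorAct _ (tensorAct _ _) _ (TensorProduct.assoc k _ _ _ x))
    rw [tensorAct_map f.map_act (tensorAct_map g.map_act h.map_act), TensorProduct.map_map_assoc]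
  leftUnitor_naturality f := Hom.ext (lid_natural f.lin)
  rightUnitor_naturality f := Hom.ext (rid_natural f.lin)
  pentagon M N P R := by
    refine Hom.ext (TensorProduct.ext_fourfold (M := M) (N := N) (P := P) (Q := R) fun m n p r => ?_)
    exact pentagon_tensorAct m n p r
  triangle M N := HMod.hom_ext fun (x : (M ⊗[k] k) ⊗[k] N) =>
    triangle_tensorAct (ρ := M.act) (σ₁ := N.act) x

end Monoidal

end HMod

end Modules

section HalfBraidings

open MonoidalCategory

/-- A prebraiding on a monoidal category: a natural transformation `X ⊗ Y ⟶ Y ⊗ X`, not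
necessarily invertible, that satisfies the two hexagon axioms. -/
class PrebraidedCategory (C : Type u) [Category.{v} C] [MonoidalCategory C] where
  /-- the prebraiding -/
  braid : ∀ X Y : C, X ⊗ Y ⟶ Y ⊗ X
  naturality_right : ∀ (X : C) {Y Z : C} (f : Y ⟶ Z), X ◁ f ≫ braid X Z = braid X Y ≫ f ▷ X
  naturality_left : ∀ {X Y : C} (f : X ⟶ Y) (Z : C), f ▷ Z ≫ braid Y Z = braid X Z ≫ Z ◁ f
  hexagon_forward : ∀ X Y Z : C,
    (α_ X Y Z).hom ≫ braid X (Y ⊗ Z) ≫ (α_ Y Z X).hom =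
      braid X Y ▷ Z ≫ (α_ Y X Z).hom ≫ Y ◁ braid X Z
  hexagon_reverse : ∀ X Y Z : C,
    (α_ X Y Z).inv ≫ braid (X ⊗ Y) Z ≫ (α_ Z X Y).inv =
      X ◁ braid Y Z ≫ (α_ X Z Y).inv ≫ braid X Z ▷ Y

/-- A prebraided monoidal category is braided if its prebraiding is an isomorphism. -/
class IsBraided (C : Type u) [Category.{v} C] [MonoidalCategory C] [PrebraidedCategory C] :
    Prop where
  isIso_braid : ∀ X Y : C, IsIso (PrebraidedCategory.braid X Y)

attribute [instance] IsBraided.isIso_braid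

/-- The braided monoidal category given by an invertible prebraiding. -/
instance (priority := 100) IsBraided.toBraidedCategory (C : Type u) [Category.{v} C]
    [MonoidalCategory C] [PrebraidedCategory C] [IsBraided C] : BraidedCategory C where
  braiding X Y := asIso (PrebraidedCategory.braid X Y)
  braiding_naturality_right := PrebraidedCategory.naturality_right
  braiding_naturality_left := PrebraidedCategory.naturality_left
  hexagon_forward := PrebraidedCategory.hexagon_forward
  hexagon_reverse := PrebraidedCategory.hexagon_reverse

variable {C : Type u} [Category.{v} C] [MonoidalCategory C]

/-- A left half-braiding on `X`, that is, an object of the weak left center over `X`: a natural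
transformation `s_U : X ⊗ U ⟶ U ⊗ X`, not necessarily invertible, compatible with tensor products
and with the unit object. -/
structure LeftHalfBraiding (X : C) where
  /-- the natural transformation `s` -/
  s : ∀ U : C, X ⊗ U ⟶ U ⊗ X
  natural : ∀ {U V : C} (f : U ⟶ V), X ◁ f ≫ s V = s U ≫ f ▷ X
  hexagon : ∀ U V : C, (α_ X U V).hom ≫ s (U ⊗ V) ≫ (α_ U V X).hom =
    s U ▷ V ≫ (α_ U X V).hom ≫ U ◁ s V
  unit : s (𝟙_ C) = (ρ_ X).hom ≫ (λ_ X).inv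

namespace LeftHalfBraiding

theorem ext' {X : C} {σ τ : LeftHalfBraiding X} (h : ∀ U, σ.s U = τ.s U) : σ = τ := by
  cases σ; cases τ; congr; exact funext h

/-- `f` is a morphism of the weak left center. -/
def IsHom {X Y : C} (σ : LeftHalfBraiding X) (τ : LeftHalfBraiding Y) (f : X ⟶ Y) : Prop :=
  ∀ U : C, f ▷ U ≫ τ.s U = σ.s U ≫ U ◁ f

theorem hexagon' {X : C} (σ : LeftHalfBraiding X) (U V : C) : σ.s (U ⊗ V) =
    (α_ X U V).inv ≫ σ.s U ▷ V ≫ (α_ U X V).hom ≫ U ◁ σ.s V ≫ (α_ U V X).inv := by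
  have := σ.hexagon U V
  rw [Iso.eq_inv_comp]
  rw [← cancel_mono (α_ U V X).hom]
  simpa using this

/-- The tensor product of two half-braidings, the one of the weak left center. -/
def tensor {X Y : C} (σ : LeftHalfBraiding X) (τ : LeftHalfBraiding Y) :
    LeftHalfBraiding (X ⊗ Y) where
  s U := (α_ X Y U).hom ≫ X ◁ τ.s U ≫ (α_ X U Y).inv ≫ σ.s U ▷ Y ≫ (α_ U X Y).hom
  natural {U V} f := by
    calc
      _ = 𝟙 _ ⊗≫ (X ◁ (Y ◁ f ≫ τ.s V)) ⊗≫ σ.s V ▷ Y ⊗≫ 𝟙 _ := by monoidal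
      _ = 𝟙 _ ⊗≫ X ◁ τ.s U ⊗≫ (X ◁ f ≫ σ.s V) ▷ Y ⊗≫ 𝟙 _ := by rw [τ.natural]; monoidal
      _ = _ := by rw [σ.natural]; monoidal
  hexagon U V := by
    rw [hexagon', hexagon']
    calc
      _ = 𝟙 _ ⊗≫ X ◁ τ.s U ▷ V ⊗≫ (_ ◁ τ.s V ≫ σ.s U ▷ _) ⊗≫ U ◁ σ.s V ▷ Y ⊗≫ 𝟙 _ := by monoidal
      _ = _ := by rw [whisker_exchange]; monoidal
  unit := by
    rw [σ.unit, τ.unit]; monoidal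

variable (C) in
/-- The half-braiding of the unit object. -/
def tensorUnit : LeftHalfBraiding (𝟙_ C) where
  s U := (λ_ U).hom ≫ (ρ_ U).inv
  natural f := by simp
  hexagon U V := by monoidal
  unit := by monoidal

variable {X Y Z X' Y' : C} {σ : LeftHalfBraiding X} {τ : LeftHalfBraiding Y}
  {υ : LeftHalfBraiding Z} {σ' : LeftHalfBraiding X'} {τ' : LeftHalfBraiding Y'}

theorem isHom_tensorHom {f : X ⟶ X'} {g : Y ⟶ Y'} (hf : IsHom σ σ' f) (hg : IsHom τ τ' g) :
    IsHom (σ.tensor τ) (σ'.tensor τ') (f ⊗ₘ g) := fun U => by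
  rw [MonoidalCategory.tensorHom_def]
  change _ ≫ (α_ X' Y' U).hom ≫ X' ◁ τ'.s U ≫ (α_ X' U Y').inv ≫ σ'.s U ▷ Y' ≫ (α_ U X' Y').hom =
    ((α_ X Y U).hom ≫ X ◁ τ.s U ≫ (α_ X U Y).inv ≫ σ.s U ▷ Y ≫ (α_ U X Y).hom) ≫ _
  calc
    _ = 𝟙 _ ⊗≫ f ▷ Y ▷ U ⊗≫ X' ◁ (g ▷ U ≫ τ'.s U) ⊗≫ σ'.s U ▷ Y' ⊗≫ 𝟙 _ := by monoidal
    _ = 𝟙 _ ⊗≫ (f ▷ (Y ⊗ U) ≫ X' ◁ τ.s U) ⊗≫ ((X' ⊗ U) ◁ g ≫ σ'.s U ▷ Y') ⊗≫ 𝟙 _ := by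
      rw [hg U]; monoidal
    _ = 𝟙 _ ⊗≫ (X ◁ τ.s U ≫ f ▷ (U ⊗ Y)) ⊗≫ ((X' ⊗ U) ◁ g ≫ σ'.s U ▷ Y') ⊗≫ 𝟙 _ := by
      rw [← whisker_exchange]
    _ = 𝟙 _ ⊗≫ X ◁ τ.s U ⊗≫ (f ▷ U ≫ σ'.s U) ▷ Y ⊗≫ U ◁ X' ◁ g ⊗≫ 𝟙 _ := by
      rw [whisker_exchange (σ'.s U) g]; monoidal
    _ = _ := by rw [hf U]; monoidal

theorem isHom_associator_hom :
    IsHom ((σ.tensor τ).tensor υ) (σ.tensor (τ.tensor υ)) (α_ X Y Z).hom := fun U => by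
  simp only [tensor]; monoidal

theorem isHom_associator_inv :
    IsHom (σ.tensor (τ.tensor υ)) ((σ.tensor τ).tensor υ) (α_ X Y Z).inv := fun U => by
  simp only [tensor]; monoidal

theorem isHom_leftUnitor_hom : IsHom ((tensorUnit C).tensor σ) σ (λ_ X).hom := fun U => by
  simp only [tensor, tensorUnit]; monoidal

theorem isHom_leftUnitor_inv : IsHom σ ((tensorUnit C).tensor σ) (λ_ X).inv := fun U => by
  simp only [tensor, tensorUnit]; monoidal

theorem isHom_rightUnitor_hom : IsHom (σ.tensor (tensorUnit C)) σ (ρ_ X).hom := fun U => by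
  simp only [tensor, tensorUnit]; monoidal

theorem isHom_rightUnitor_inv : IsHom σ (σ.tensor (tensorUnit C)) (ρ_ X).inv := fun U => by
  simp only [tensor, tensorUnit]; monoidal

theorem isHom_braid : IsHom (σ.tensor τ) (τ.tensor σ) (σ.s Y) := fun U => by
  have h1 := σ.natural (τ.s U)
  rw [hexagon', hexagon'] at h1
  simp only [tensor]
  rw [← cancel_epi (α_ X Y U).inv, ← cancel_mono (α_ U Y X).inv]
  simpa using h1.symm

theorem hexagon_reverse : (α_ X Y Z).inv ≫ (σ.tensor τ).s Z ≫ (α_ Z X Y).inv =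
    X ◁ τ.s Z ≫ (α_ X Z Y).inv ≫ σ.s Z ▷ Y := by
  simp [tensor]

end LeftHalfBraiding

/-- A right half-braiding on `X`, that is, an object of the weak right center over `X`: a natural
transformation `t_U : U ⊗ X ⟶ X ⊗ U`, not necessarily invertible, compatible with tensor products
and with the unit object. -/
structure RightHalfBraiding (X : C) where
  /-- the natural transformation `t` -/
  t : ∀ U : C, U ⊗ X ⟶ X ⊗ U
  natural : ∀ {U V : C} (f : U ⟶ V), f ▷ X ≫ t V = t U ≫ X ◁ f
  hexagon : ∀ U V : C, (α_ U V X).inv ≫ t (U ⊗ V) ≫ (α_ X U V).inv =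
    U ◁ t V ≫ (α_ U X V).inv ≫ t U ▷ V
  unit : t (𝟙_ C) = (λ_ X).hom ≫ (ρ_ X).inv

namespace RightHalfBraiding

theorem ext' {X : C} {σ τ : RightHalfBraiding X} (h : ∀ U, σ.t U = τ.t U) : σ = τ := by
  cases σ; cases τ; congr; exact funext h

/-- `f` is a morphism of the weak right center. -/
def IsHom {X Y : C} (σ : RightHalfBraiding X) (τ : RightHalfBraiding Y) (f : X ⟶ Y) : Prop :=
  ∀ U : C, U ◁ f ≫ τ.t U = σ.t U ≫ f ▷ U

theorem hexagon' {X : C} (σ : RightHalfBraiding X) (U V : C) : σ.t (U ⊗ V) =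
    (α_ U V X).hom ≫ U ◁ σ.t V ≫ (α_ U X V).inv ≫ σ.t U ▷ V ≫ (α_ X U V).hom := by
  have := σ.hexagon U V
  rw [← Iso.inv_comp_eq]
  rw [← cancel_mono (α_ X U V).inv]
  simpa using this

/-- The tensor product of two half-braidings, the one of the weak right center. -/
def tensor {X Y : C} (σ : RightHalfBraiding X) (τ : RightHalfBraiding Y) :
    RightHalfBraiding (X ⊗ Y) where
  t U := (α_ U X Y).inv ≫ σ.t U ▷ Y ≫ (α_ X U Y).hom ≫ X ◁ τ.t U ≫ (α_ X Y U).inv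
  natural {U V} f := by
    calc
      _ = 𝟙 _ ⊗≫ (f ▷ X ≫ σ.t V) ▷ Y ⊗≫ X ◁ τ.t V ⊗≫ 𝟙 _ := by monoidal
      _ = 𝟙 _ ⊗≫ σ.t U ▷ Y ⊗≫ X ◁ (f ▷ Y ≫ τ.t V) ⊗≫ 𝟙 _ := by rw [σ.natural]; monoidal
      _ = _ := by rw [τ.natural]; monoidal
  hexagon U V := by
    rw [hexagon', hexagon']
    calc
      _ = 𝟙 _ ⊗≫ U ◁ σ.t V ▷ Y ⊗≫ (σ.t U ▷ _ ≫ _ ◁ τ.t V) ⊗≫ X ◁ τ.t U ▷ V ⊗≫ 𝟙 _ := by monoidal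
      _ = _ := by rw [← whisker_exchange]; monoidal
  unit := by
    rw [σ.unit, τ.unit]; monoidal

variable (C) in
/-- The half-braiding of the unit object. -/
def tensorUnit : RightHalfBraiding (𝟙_ C) where
  t U := (ρ_ U).hom ≫ (λ_ U).inv
  natural f := by simp
  hexagon U V := by monoidal
  unit := by monoidal

variable {X Y Z X' Y' : C} {σ : RightHalfBraiding X} {τ : RightHalfBraiding Y}
  {υ : RightHalfBraiding Z} {σ' : RightHalfBraiding X'} {τ' : RightHalfBraiding Y'}

theorem isHom_tensorHom {f : X ⟶ X'} {g : Y ⟶ Y'} (hf : IsHom σ σ' f) (hg : IsHom τ τ' g) :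
    IsHom (σ.tensor τ) (σ'.tensor τ') (f ⊗ₘ g) := fun U => by
  rw [MonoidalCategory.tensorHom_def']
  change _ ≫ (α_ U X' Y').inv ≫ σ'.t U ▷ Y' ≫ (α_ X' U Y').hom ≫ X' ◁ τ'.t U ≫ (α_ X' Y' U).inv =
    ((α_ U X Y).inv ≫ σ.t U ▷ Y ≫ (α_ X U Y).hom ≫ X ◁ τ.t U ≫ (α_ X Y U).inv) ≫ _
  calc
    _ = 𝟙 _ ⊗≫ U ◁ X ◁ g ⊗≫ (U ◁ f ≫ σ'.t U) ▷ Y' ⊗≫ X' ◁ τ'.t U ⊗≫ 𝟙 _ := by monoidal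
    _ = 𝟙 _ ⊗≫ ((U ⊗ X) ◁ g ≫ σ.t U ▷ Y') ⊗≫ (f ▷ (U ⊗ Y') ≫ X' ◁ τ'.t U) ⊗≫ 𝟙 _ := by
      rw [hf U]; monoidal
    _ = 𝟙 _ ⊗≫ ((U ⊗ X) ◁ g ≫ σ.t U ▷ Y') ⊗≫ (X ◁ τ'.t U ≫ f ▷ (Y' ⊗ U)) ⊗≫ 𝟙 _ := by
      rw [← whisker_exchange f]
    _ = 𝟙 _ ⊗≫ σ.t U ▷ Y ⊗≫ X ◁ (U ◁ g ≫ τ'.t U) ⊗≫ f ▷ (Y' ⊗ U) ⊗≫ 𝟙 _ := by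
      rw [whisker_exchange (σ.t U) g]; monoidal
    _ = _ := by rw [hg U]; monoidal

theorem isHom_associator_hom :
    IsHom ((σ.tensor τ).tensor υ) (σ.tensor (τ.tensor υ)) (α_ X Y Z).hom := fun U => by
  simp only [tensor]; monoidal

theorem isHom_associator_inv :
    IsHom (σ.tensor (τ.tensor υ)) ((σ.tensor τ).tensor υ) (α_ X Y Z).inv := fun U => by
  simp only [tensor]; monoidal

theorem isHom_leftUnitor_hom : IsHom ((tensorUnit C).tensor σ) σ (λ_ X).hom := fun U => by
  simp only [tensor, tensorUnit]; monoidal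

theorem isHom_leftUnitor_inv : IsHom σ ((tensorUnit C).tensor σ) (λ_ X).inv := fun U => by
  simp only [tensor, tensorUnit]; monoidal

theorem isHom_rightUnitor_hom : IsHom (σ.tensor (tensorUnit C)) σ (ρ_ X).hom := fun U => by
  simp only [tensor, tensorUnit]; monoidal

theorem isHom_rightUnitor_inv : IsHom σ (σ.tensor (tensorUnit C)) (ρ_ X).inv := fun U => by
  simp only [tensor, tensorUnit]; monoidal

theorem isHom_braid : IsHom (σ.tensor τ) (τ.tensor σ) (τ.t X) := fun U => by
  have h1 := τ.natural (σ.t U)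
  rw [hexagon', hexagon'] at h1
  simp only [tensor]
  rw [← cancel_epi (α_ U X Y).hom, ← cancel_mono (α_ Y X U).hom]
  simpa using h1.symm

theorem hexagon_forward : (α_ Z X Y).hom ≫ (σ.tensor τ).t Z ≫ (α_ X Y Z).hom =
    σ.t Z ▷ Y ≫ (α_ X Z Y).hom ≫ X ◁ τ.t Z := by
  simp [tensor]

end RightHalfBraiding

end HalfBraidings

section LeftYetterDrinfeld

open MonoidalCategory
open scoped TensorProduct

section

variable {k H V W W' : Type u} [Field k] [Ring H] [Algebra k H]
  [AddCommGroup V] [Module k V] [AddCommGroup W] [Module k W] [AddCommGroup W'] [Module k W']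

theorem map_map' {V₁ V₂ V₃ W₁ W₂ W₃ : Type u} [AddCommGroup V₁] [Module k V₁] [AddCommGroup V₂]
    [Module k V₂] [AddCommGroup V₃] [Module k V₃] [AddCommGroup W₁] [Module k W₁]
    [AddCommGroup W₂] [Module k W₂] [AddCommGroup W₃] [Module k W₃] (f : V₁ →ₗ[k] V₂)
    (f' : V₂ →ₗ[k] V₃) (g : W₁ →ₗ[k] W₂) (g' : W₂ →ₗ[k] W₃) (t : V₁ ⊗[k] W₁) :
    TensorProduct.map f' g' (TensorProduct.map f g t) =
      TensorProduct.map (f' ∘ₗ f) (g' ∘ₗ g) t := by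
  rw [TensorProduct.map_comp, LinearMap.comp_apply]

/-- For a left coaction `lam m = m₍₋₁₎ ⊗ m₍₀₎` of `H` on `V` and an action `σ` of `H` on `W`, the
linear map `V ⊗ W → W ⊗ V`, `m ⊗ w ↦ m₍₋₁₎ • w ⊗ m₍₀₎`. -/
def leftSwap (lam : V →ₗ[k] H ⊗[k] V) (σ : H →ₐ[k] Module.End k W) : V ⊗[k] W →ₗ[k] W ⊗[k] V :=
  TensorProduct.lift ((LinearMap.rTensorHom V ∘ₗ σ.toLinearMap.flip).flip ∘ₗ lam)

theorem leftSwap_tmul (lam : V →ₗ[k] H ⊗[k] V) (σ : H →ₐ[k] Module.End k W) (m : V) (w : W) :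
    leftSwap lam σ (m ⊗ₜ w) = TensorProduct.map (σ.toLinearMap.flip w) LinearMap.id (lam m) := rfl

theorem leftSwap_map {lam : V →ₗ[k] H ⊗[k] V} {σ : H →ₐ[k] Module.End k W}
    {σ' : H →ₐ[k] Module.End k W'} {f : W →ₗ[k] W'} (hf : ∀ h w, f (σ h w) = σ' h (f w))
    (t : V ⊗[k] W) :
    leftSwap lam σ' (TensorProduct.map LinearMap.id f t) =
      TensorProduct.map f LinearMap.id (leftSwap lam σ t) := by
  induction t using TensorProduct.induction_on with
  | zero => simp
  | add x y hx hy => simp only [map_add, hx, hy]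
  | tmul m w =>
    rw [TensorProduct.map_tmul, leftSwap_tmul, leftSwap_tmul]
    generalize lam m = z
    change TensorProduct.map (σ'.toLinearMap.flip (f w)) LinearMap.id z = _
    rw [map_map']
    congr 2
    ext h
    exact (hf h w).symm

theorem leftSwap_regular_one (lam : V →ₗ[k] H ⊗[k] V) (m : V) :
    leftSwap lam (Algebra.lmul k H) (m ⊗ₜ 1) = lam m := by
  rw [leftSwap_tmul]
  have : (Algebra.lmul k H).toLinearMap.flip (1 : H) = LinearMap.id := by ext; simp
  rw [this, TensorProduct.map_id, LinearMap.id_apply]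

theorem map_flip_one (f : V →ₗ[k] V) (σ : H →ₐ[k] Module.End k W) (w : W) (m : V) :
    TensorProduct.map f (σ.toLinearMap.flip w) (m ⊗ₜ (1 : H)) = f m ⊗ₜ[k] w := by
  simp

theorem flip_act (σ : H →ₐ[k] Module.End k W) (w : W) (h t : H) :
    σ.toLinearMap.flip w (Algebra.lmul k H h t) = σ h (σ.toLinearMap.flip w t) := by
  simp

end

variable (k H : Type u) [Field k] [Ring H] [Algebra k H] [Q : QuasiBialgebra k H]

/-- A left Yetter-Drinfeld module over the quasi-bialgebra `H`: a left `H`-module `M` with a linear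
map `coact : M → H ⊗ M`, `m ↦ m₍₋₁₎ ⊗ m₍₀₎`, such that, with `Φ = X¹ ⊗ X² ⊗ X³ = Y¹ ⊗ Y² ⊗ Y³`,
* `X¹ m₍₋₁₎ ⊗ (X² • m₍₀₎)₍₋₁₎ X³ ⊗ (X² • m₍₀₎)₍₀₎ =
   X¹ (Y¹ • m)₍₋₁₎₁ Y² ⊗ X² (Y¹ • m)₍₋₁₎₂ Y³ ⊗ X³ • (Y¹ • m)₍₀₎`,
* `ε(m₍₋₁₎) m₍₀₎ = m`,
* `h₁ m₍₋₁₎ ⊗ h₂ • m₍₀₎ = (h₁ • m)₍₋₁₎ h₂ ⊗ (h₁ • m)₍₀₎`.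
Here `Algebra.lmul k H` is the action of `H` on itself by left multiplication. -/
structure LeftYD where
  /-- the underlying left module -/
  toMod : HMod k H
  /-- the left coaction -/
  coact : toMod →ₗ[k] H ⊗[k] toMod
  coact_coassoc : ∀ m : toMod,
    TensorProduct.map LinearMap.id (leftSwap coact (Algebra.lmul k H))
      (tensorAct (Algebra.lmul k H) (tensorAct toMod.act (Algebra.lmul k H)) ↑Q.reassociator
        (TensorProduct.assoc k H toMod H (coact m ⊗ₜ[k] (1 : H)))) =
    tensorAct (Algebra.lmul k H) (tensorAct (Algebra.lmul k H) toMod.act) ↑Q.reassociator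
      (TensorProduct.assoc k H H toMod
        (leftSwap coact ((tensorAct (Algebra.lmul k H) (Algebra.lmul k H)).comp Q.comul)
          (tensorAct toMod.act (tensorAct (Algebra.lmul k H) (Algebra.lmul k H)) ↑Q.reassociator
            (m ⊗ₜ[k] ((1 : H) ⊗ₜ[k] (1 : H))))))
  coact_counit : ∀ m : toMod,
    TensorProduct.lid k toMod (TensorProduct.map Q.counit.toLinearMap LinearMap.id (coact m)) = m
  coact_compat : ∀ (h : H) (m : toMod),
    tensorAct (Algebra.lmul k H) toMod.act (Q.comul h) (coact m) =
      leftSwap coact (Algebra.lmul k H)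
        (tensorAct toMod.act (Algebra.lmul k H) (Q.comul h) (m ⊗ₜ[k] (1 : H)))

variable {k H}

namespace LeftYD

/-- A morphism of left Yetter-Drinfeld modules: a module homomorphism that preserves the
coaction. -/
@[ext]
structure Hom (M N : LeftYD k H) where
  /-- the underlying module homomorphism -/
  hom : M.toMod ⟶ N.toMod
  map_coact : ∀ m : M.toMod,
    N.coact (hom.lin m) = TensorProduct.map LinearMap.id hom.lin (M.coact m)

instance : Category (LeftYD k H) where
  Hom := Hom
  id M := ⟨𝟙 M.toMod, fun m => by simp⟩
  comp f g := ⟨f.hom ≫ g.hom, fun m => by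
    rw [HMod.comp_lin, LinearMap.comp_apply, g.map_coact, f.map_coact, ← LinearMap.comp_apply,
      ← TensorProduct.map_comp, LinearMap.id_comp]⟩

@[ext]
theorem hom_ext {M N : LeftYD k H} {f g : M ⟶ N} (h : f.hom = g.hom) : f = g := Hom.ext h

@[simp]
theorem id_hom (M : LeftYD k H) : Hom.hom (𝟙 M) = 𝟙 M.toMod := rfl

@[simp]
theorem comp_hom {M N P : LeftYD k H} (f : M ⟶ N) (g : N ⟶ P) : (f ≫ g).hom = f.hom ≫ g.hom := rfl

theorem leftSwap_act (M : LeftYD k H) (X : HMod k H) (h : H) (t : M.toMod ⊗[k] X) :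
    leftSwap M.coact X.act (tensorAct M.toMod.act X.act (Q.comul h) t) =
      tensorAct X.act M.toMod.act (Q.comul h) (leftSwap M.coact X.act t) := by
  induction t using TensorProduct.induction_on with
  | zero => simp
  | add x y hx hy => simp only [map_add, hx, hy]
  | tmul m x =>
    have e : m ⊗ₜ[k] x = TensorProduct.map LinearMap.id (X.act.toLinearMap.flip x)
      (m ⊗ₜ[k] (1 : H)) := (map_flip_one LinearMap.id X.act x m).symm
    rw [e, ← tensorAct_map (ρ := M.toMod.act) (fun _ _ => rfl) (flip_act X.act x),
      leftSwap_map (flip_act X.act x), ← M.coact_compat, leftSwap_map (flip_act X.act x),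
      leftSwap_regular_one, tensorAct_map (flip_act X.act x) (fun _ _ => rfl)]

theorem leftSwap_hexagon (M : LeftYD k H) (X Y : HMod k H) (m : M.toMod) (x : X) (y : Y) :
    tensorAct X.act (tensorAct Y.act M.toMod.act) ↑Q.reassociator (TensorProduct.assoc k X Y M.toMod
      (leftSwap M.coact ((tensorAct X.act Y.act).comp Q.comul)
        (tensorAct M.toMod.act (tensorAct X.act Y.act) ↑Q.reassociator (m ⊗ₜ[k] (x ⊗ₜ[k] y))))) =
    TensorProduct.map LinearMap.id (leftSwap M.coact Y.act)
      (tensorAct X.act (tensorAct M.toMod.act Y.act) ↑Q.reassociator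
        (TensorProduct.assoc k X M.toMod Y (leftSwap M.coact X.act (m ⊗ₜ x) ⊗ₜ[k] y))) := by
  set f := X.act.toLinearMap.flip x with hf
  set g := Y.act.toLinearMap.flip y with hg
  have hf' := flip_act X.act x
  have hg' := flip_act Y.act y
  rw [← hf] at hf'
  rw [← hg] at hg'
  have hf1 : f 1 = x := by simp [hf]
  have hg1 : g 1 = y := by simp [hg]
  have e1 : m ⊗ₜ[k] (x ⊗ₜ[k] y) = TensorProduct.map LinearMap.id (TensorProduct.map f g)
      (m ⊗ₜ[k] ((1 : H) ⊗ₜ[k] (1 : H))) := by simp [hf1, hg1]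
  have e2 : TensorProduct.map f LinearMap.id (M.coact m) ⊗ₜ[k] y =
      TensorProduct.map (TensorProduct.map f LinearMap.id) g (M.coact m ⊗ₜ[k] (1 : H)) := by
    simp [hg1]
  have hfg : ∀ (h : H) t, TensorProduct.map f g
      ((tensorAct (Algebra.lmul k H) (Algebra.lmul k H)).comp Q.comul h t) =
      (tensorAct X.act Y.act).comp Q.comul h (TensorProduct.map f g t) :=
    fun h t => tensorAct_map hf' hg' _ t
  rw [leftSwap_tmul, ← hf, e1, e2, ← tensorAct_map (ρ := M.toMod.act) (fun _ _ => rfl)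
    (tensorAct_map hf' hg'), leftSwap_map hfg, ← TensorProduct.map_map_assoc,
    ← tensorAct_map hf' (tensorAct_map (ρ := Algebra.lmul k H) hg' fun _ _ => rfl),
    ← M.coact_coassoc, ← TensorProduct.map_map_assoc,
    ← tensorAct_map hf' (tensorAct_map (ρ := M.toMod.act) (fun _ _ => rfl) hg')]
  rw [map_map', map_map', LinearMap.id_comp, LinearMap.comp_id]
  congr 2
  exact LinearMap.ext fun t => (leftSwap_map hg' t).symm

theorem leftSwap_unit (M : LeftYD k H) (m : M.toMod) (r : k) :
    leftSwap M.coact ((Algebra.lmul k k).comp Q.counit) (m ⊗ₜ r) = (1 : k) ⊗ₜ[k] (r • m) := by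
  apply (TensorProduct.lid k M.toMod).injective
  rw [leftSwap_tmul, TensorProduct.lid_tmul, one_smul]
  conv_rhs => rw [← M.coact_counit m]
  generalize M.coact m = z
  induction z using TensorProduct.induction_on with
  | zero => simp
  | add x y hx hy => simp only [map_add, hx, hy, smul_add]
  | tmul h m => simp [mul_smul, smul_comm r]

/-- The half-braiding `m ⊗ x ↦ m₍₋₁₎ • x ⊗ m₍₀₎` of a left Yetter-Drinfeld module: left
Yetter-Drinfeld modules are the objects of the weak left center of the category of left modules. -/
def halfBraiding (M : LeftYD k H) : LeftHalfBraiding M.toMod where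
  s X := ⟨leftSwap M.coact X.act, fun h t => leftSwap_act M X h t⟩
  natural f := HMod.Hom.ext (LinearMap.ext fun t => leftSwap_map f.map_act t)
  hexagon X Y := HMod.Hom.ext (TensorProduct.ext_threefold (M := M.toMod) (N := X) (P := Y)
    fun m x y => leftSwap_hexagon M X Y m x y)
  unit := HMod.Hom.ext (TensorProduct.ext' (M := M.toMod) (N := k) fun m r => leftSwap_unit M m r)

theorem s_eq_leftSwap {M : HMod k H} (σ : LeftHalfBraiding M) {lam : M →ₗ[k] H ⊗[k] M}
    (hl : ∀ m : M, lam m = (σ.s (HMod.regular k H)).lin (m ⊗ₜ[k] (1 : H) : M ⊗[k] H))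
    (X : HMod k H) : (σ.s X).lin = leftSwap lam X.act := by
  refine TensorProduct.ext' (M := M) (N := X) fun m x => ?_
  have := congrArg (fun f => HMod.Hom.lin f (m ⊗ₜ[k] (1 : H) : M ⊗[k] H)) (σ.natural (HMod.orbit x))
  have e : (M ◁ HMod.orbit x).lin (m ⊗ₜ[k] (1 : H) : M ⊗[k] H) = (m ⊗ₜ[k] x : M ⊗[k] X) :=
    congrArg (fun f : Module.End k X => m ⊗ₜ[k] f x) (map_one X.act)
  refine (congrArg (σ.s X).lin e).symm.trans (this.trans ?_)
  refine Eq.trans ?_ (leftSwap_tmul lam X.act m x).symm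
  rw [hl]; rfl

/-- The left Yetter-Drinfeld module of a left half-braiding; its coaction is
`m ↦ s_H(m ⊗ 1)`. -/
def ofHalfBraiding (M : HMod k H) (σ : LeftHalfBraiding M) : LeftYD k H :=
  let lam : M →ₗ[k] H ⊗[k] M :=
    (σ.s (HMod.regular k H)).lin ∘ₗ (TensorProduct.mk k M H).flip 1
  { toMod := M
    coact := lam
    coact_coassoc := fun m => by
      have h := congrArg (fun f => HMod.Hom.lin f (((m ⊗ₜ[k] (1 : H)) ⊗ₜ[k] (1 : H) :
        (M ⊗[k] H) ⊗[k] H))) (σ.hexagon (HMod.regular k H) (HMod.regular k H))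
      have e1 : (σ.s (HMod.regular k H)).lin = leftSwap lam (Algebra.lmul k H) :=
        s_eq_leftSwap σ (fun _ => rfl) _
      have e2 : (σ.s (HMod.regular k H ⊗ HMod.regular k H)).lin =
          leftSwap lam ((tensorAct (Algebra.lmul k H) (Algebra.lmul k H)).comp Q.comul) :=
        s_eq_leftSwap σ (fun _ => rfl) _
      rw [← e1, ← e2]
      exact h.symm
    coact_counit := fun m => by
      have h := congrArg (fun f => HMod.Hom.lin f (m ⊗ₜ[k] (1 : k) : M ⊗[k] k)) σ.unit
      have e1 : (σ.s (HMod.unit k H)).lin = leftSwap lam ((Algebra.lmul k k).comp Q.counit) :=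
        s_eq_leftSwap σ (fun _ => rfl) _
      have e2 : leftSwap lam ((Algebra.lmul k k).comp Q.counit) (m ⊗ₜ[k] (1 : k)) =
          (TensorProduct.lid k M).symm (TensorProduct.rid k M (m ⊗ₜ[k] (1 : k))) := by
        rw [← e1]
        exact h
      rw [TensorProduct.rid_tmul, one_smul, LinearEquiv.eq_symm_apply, leftSwap_tmul] at e2
      refine Eq.trans ?_ e2
      congr 3
      ext h
      simp
    coact_compat := fun h m => by
      have e1 : (σ.s (HMod.regular k H)).lin = leftSwap lam (Algebra.lmul k H) :=
        s_eq_leftSwap σ (fun _ => rfl) _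
      rw [← e1]
      exact ((σ.s (HMod.regular k H)).map_act h (m ⊗ₜ[k] (1 : H) : M ⊗[k] H)).symm }

theorem ofHalfBraiding_s (M : HMod k H) (σ : LeftHalfBraiding M) (X : HMod k H) :
    (ofHalfBraiding M σ).halfBraiding.s X = σ.s X :=
  HMod.Hom.ext (s_eq_leftSwap σ (fun _ => rfl) X).symm

theorem ofHalfBraiding_halfBraiding (M : HMod k H) (σ : LeftHalfBraiding M) :
    (ofHalfBraiding M σ).halfBraiding = σ :=
  LeftHalfBraiding.ext' (ofHalfBraiding_s M σ)

/-- A module homomorphism that is a morphism of the weak left center preserves the coactions. -/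
def homOfIsHom {M N : LeftYD k H} (f : M.toMod ⟶ N.toMod)
    (hf : LeftHalfBraiding.IsHom M.halfBraiding N.halfBraiding f) : M ⟶ N where
  hom := f
  map_coact m := by
    have h := congrArg (fun f => HMod.Hom.lin f (m ⊗ₜ[k] (1 : H) : M.toMod ⊗[k] H))
      (hf (HMod.regular k H))
    have e1 := leftSwap_regular_one N.coact (f.lin m)
    have e2 := leftSwap_regular_one M.coact m
    rw [← e1, ← e2]
    exact h

theorem isHom_hom {M N : LeftYD k H} (f : M ⟶ N) :
    LeftHalfBraiding.IsHom M.halfBraiding N.halfBraiding f.hom := fun X =>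
  HMod.Hom.ext (TensorProduct.ext' (M := M.toMod) (N := X) fun m x => by
    change leftSwap N.coact X.act (f.hom.lin m ⊗ₜ[k] x) =
      TensorProduct.map LinearMap.id f.hom.lin (leftSwap M.coact X.act (m ⊗ₜ[k] x))
    rw [leftSwap_tmul, leftSwap_tmul, f.map_coact, map_map', map_map', LinearMap.comp_id,
      LinearMap.id_comp, LinearMap.id_comp, LinearMap.comp_id])

/-- The tensor product of left Yetter-Drinfeld modules: the tensor product of the underlying
modules, with the tensor product of the half-braidings. Its coaction is
`m ⊗ n ↦ X¹ (x¹ Y¹ • m)₍₋₁₎ x² (Y² • n)₍₋₁₎ Y³ ⊗ X² • (x¹ Y¹ • m)₍₀₎ ⊗ X³ x³ • (Y² • n)₍₀₎`. -/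
def tensor (M N : LeftYD k H) : LeftYD k H :=
  ofHalfBraiding (M.toMod ⊗ N.toMod) (M.halfBraiding.tensor N.halfBraiding)

variable (k H) in
/-- The unit object: the field `k` with the action through `ε` and the coaction `r ↦ 1 ⊗ r`. -/
def unit : LeftYD k H :=
  ofHalfBraiding (𝟙_ (HMod k H)) (LeftHalfBraiding.tensorUnit (HMod k H))

theorem tensor_halfBraiding (M N : LeftYD k H) :
    (tensor M N).halfBraiding = M.halfBraiding.tensor N.halfBraiding :=
  ofHalfBraiding_halfBraiding _ _

theorem unit_halfBraiding : (unit k H).halfBraiding = LeftHalfBraiding.tensorUnit (HMod k H) :=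
  ofHalfBraiding_halfBraiding _ _

/-- The tensor product of two morphisms. -/
def tensorHom {M N M' N' : LeftYD k H} (f : M ⟶ M') (g : N ⟶ N') : tensor M N ⟶ tensor M' N' :=
  homOfIsHom (M := tensor M N) (N := tensor M' N') (f.hom ⊗ₘ g.hom) (by
    rw [tensor_halfBraiding, tensor_halfBraiding]
    exact LeftHalfBraiding.isHom_tensorHom (isHom_hom f) (isHom_hom g))

/-- The associativity constraint is the one of the underlying modules. -/
def associator (M N P : LeftYD k H) : tensor (tensor M N) P ≅ tensor M (tensor N P) where
  hom := homOfIsHom (M := tensor (tensor M N) P) (N := tensor M (tensor N P))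
    (α_ M.toMod N.toMod P.toMod).hom (by
      rw [tensor_halfBraiding, tensor_halfBraiding, tensor_halfBraiding, tensor_halfBraiding]
      exact LeftHalfBraiding.isHom_associator_hom)
  inv := homOfIsHom (N := tensor (tensor M N) P) (M := tensor M (tensor N P))
    (α_ M.toMod N.toMod P.toMod).inv (by
      rw [tensor_halfBraiding, tensor_halfBraiding, tensor_halfBraiding, tensor_halfBraiding]
      exact LeftHalfBraiding.isHom_associator_inv)
  hom_inv_id := LeftYD.hom_ext (α_ M.toMod N.toMod P.toMod).hom_inv_id
  inv_hom_id := LeftYD.hom_ext (α_ M.toMod N.toMod P.toMod).inv_hom_id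

/-- The left unit constraint is the one of the underlying module. -/
def leftUnitor (M : LeftYD k H) : tensor (unit k H) M ≅ M where
  hom := homOfIsHom (M := tensor (unit k H) M) (λ_ M.toMod).hom (by
    rw [tensor_halfBraiding, unit_halfBraiding]
    exact LeftHalfBraiding.isHom_leftUnitor_hom)
  inv := homOfIsHom (N := tensor (unit k H) M) (λ_ M.toMod).inv (by
    rw [tensor_halfBraiding, unit_halfBraiding]
    exact LeftHalfBraiding.isHom_leftUnitor_inv)
  hom_inv_id := LeftYD.hom_ext (λ_ M.toMod).hom_inv_id
  inv_hom_id := LeftYD.hom_ext (λ_ M.toMod).inv_hom_id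

/-- The right unit constraint is the one of the underlying module. -/
def rightUnitor (M : LeftYD k H) : tensor M (unit k H) ≅ M where
  hom := homOfIsHom (M := tensor M (unit k H)) (ρ_ M.toMod).hom (by
    rw [tensor_halfBraiding, unit_halfBraiding]
    exact LeftHalfBraiding.isHom_rightUnitor_hom)
  inv := homOfIsHom (N := tensor M (unit k H)) (ρ_ M.toMod).inv (by
    rw [tensor_halfBraiding, unit_halfBraiding]
    exact LeftHalfBraiding.isHom_rightUnitor_inv)
  hom_inv_id := LeftYD.hom_ext (ρ_ M.toMod).hom_inv_id
  inv_hom_id := LeftYD.hom_ext (ρ_ M.toMod).inv_hom_id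

instance : MonoidalCategoryStruct (LeftYD k H) where
  tensorObj := tensor
  whiskerLeft M _ _ f := tensorHom (𝟙 M) f
  whiskerRight f M := tensorHom f (𝟙 M)
  tensorHom f g := tensorHom f g
  tensorUnit := unit k H
  associator := associator
  leftUnitor := leftUnitor
  rightUnitor := rightUnitor

instance : MonoidalCategory (LeftYD k H) where
  tensorHom_def f g := LeftYD.hom_ext (MonoidalCategory.tensorHom_def f.hom g.hom)
  id_tensorHom_id M N := LeftYD.hom_ext (MonoidalCategory.id_tensorHom_id M.toMod N.toMod)
  tensorHom_comp_tensorHom f g f' g' := LeftYD.hom_ext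
    (MonoidalCategory.tensorHom_comp_tensorHom f.hom g.hom f'.hom g'.hom)
  whiskerLeft_id M N := LeftYD.hom_ext (MonoidalCategory.whiskerLeft_id M.toMod N.toMod)
  id_whiskerRight M N := LeftYD.hom_ext (MonoidalCategory.id_whiskerRight M.toMod N.toMod)
  associator_naturality f g h := LeftYD.hom_ext
    (MonoidalCategory.associator_naturality f.hom g.hom h.hom)
  leftUnitor_naturality f := LeftYD.hom_ext (MonoidalCategory.leftUnitor_naturality f.hom)
  rightUnitor_naturality f := LeftYD.hom_ext (MonoidalCategory.rightUnitor_naturality f.hom)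
  pentagon M N P R := LeftYD.hom_ext
    (MonoidalCategory.pentagon M.toMod N.toMod P.toMod R.toMod)
  triangle M N := LeftYD.hom_ext (MonoidalCategory.triangle M.toMod N.toMod)

/-- The prebraiding `m ⊗ n ↦ m₍₋₁₎ • n ⊗ m₍₀₎`. -/
instance : PrebraidedCategory (LeftYD k H) where
  braid M N := homOfIsHom (M := tensor M N) (N := tensor N M) (M.halfBraiding.s N.toMod) (by
    rw [tensor_halfBraiding, tensor_halfBraiding]
    exact LeftHalfBraiding.isHom_braid)
  naturality_right M _ _ f := LeftYD.hom_ext (M.halfBraiding.natural f.hom)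
  naturality_left f P := LeftYD.hom_ext (isHom_hom f P.toMod)
  hexagon_forward M N P := LeftYD.hom_ext (M.halfBraiding.hexagon N.toMod P.toMod)
  hexagon_reverse M N P := LeftYD.hom_ext (by
    have h := LeftHalfBraiding.hexagon_reverse (σ := M.halfBraiding) (τ := N.halfBraiding)
      (Z := P.toMod)
    rw [← tensor_halfBraiding] at h
    exact h)

end LeftYD

end LeftYetterDrinfeld

section LeftRightYetterDrinfeld

open MonoidalCategory
open scoped TensorProduct

section

variable {k H V W W' : Type u} [Field k] [Ring H] [Algebra k H]
  [AddCommGroup V] [Module k V] [AddCommGroup W] [Module k W] [AddCommGroup W'] [Module k W']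

/-- For a right coaction `rho m = m₍₀₎ ⊗ m₍₁₎` of `H` on `V` and an action `σ` of `H` on `W`, the
linear map `W ⊗ V → V ⊗ W`, `w ⊗ m ↦ m₍₀₎ ⊗ m₍₁₎ • w`. -/
def rightSwap (rho : V →ₗ[k] V ⊗[k] H) (σ : H →ₐ[k] Module.End k W) : W ⊗[k] V →ₗ[k] V ⊗[k] W :=
  TensorProduct.lift (LinearMap.lcomp k (V ⊗[k] W) rho ∘ₗ
    (LinearMap.lTensorHom V ∘ₗ σ.toLinearMap.flip))

theorem rightSwap_tmul (rho : V →ₗ[k] V ⊗[k] H) (σ : H →ₐ[k] Module.End k W) (m : V) (w : W) :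
    rightSwap rho σ (w ⊗ₜ m) = TensorProduct.map LinearMap.id (σ.toLinearMap.flip w) (rho m) := rfl

theorem rightSwap_map {rho : V →ₗ[k] V ⊗[k] H} {σ : H →ₐ[k] Module.End k W}
    {σ' : H →ₐ[k] Module.End k W'} {f : W →ₗ[k] W'} (hf : ∀ h w, f (σ h w) = σ' h (f w))
    (t : W ⊗[k] V) :
    rightSwap rho σ' (TensorProduct.map f LinearMap.id t) =
      TensorProduct.map LinearMap.id f (rightSwap rho σ t) := by
  induction t using TensorProduct.induction_on with
  | zero => simp
  | add x y hx hy => simp only [map_add, hx, hy]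
  | tmul w m =>
    rw [TensorProduct.map_tmul, rightSwap_tmul, rightSwap_tmul]
    generalize rho m = z
    change TensorProduct.map LinearMap.id (σ'.toLinearMap.flip (f w)) z = _
    rw [map_map']
    congr 2
    ext h
    exact (hf h w).symm

theorem rightSwap_regular_one (rho : V →ₗ[k] V ⊗[k] H) (m : V) :
    rightSwap rho (Algebra.lmul k H) (1 ⊗ₜ m) = rho m := by
  rw [rightSwap_tmul]
  have : (Algebra.lmul k H).toLinearMap.flip (1 : H) = LinearMap.id := by ext; simp
  rw [this, TensorProduct.map_id, LinearMap.id_apply]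

theorem map_one_flip (f : V →ₗ[k] V) (σ : H →ₐ[k] Module.End k W) (w : W) (m : V) :
    TensorProduct.map (σ.toLinearMap.flip w) f ((1 : H) ⊗ₜ m) = w ⊗ₜ[k] f m := by
  simp

end

variable (k H : Type u) [Field k] [Ring H] [Algebra k H] [Q : QuasiBialgebra k H]

/-- A left-right Yetter-Drinfeld module over the quasi-bialgebra `H`: a left `H`-module `M` with a
linear map `coact : M → M ⊗ H`, `m ↦ m₍₀₎ ⊗ m₍₁₎`, such that, with
`Φ⁻¹ = x¹ ⊗ x² ⊗ x³ = y¹ ⊗ y² ⊗ y³`,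
* `(x² • m₍₀₎)₍₀₎ ⊗ (x² • m₍₀₎)₍₁₎ x¹ ⊗ x³ m₍₁₎ =
   x¹ • (y³ • m)₍₀₎ ⊗ x² (y³ • m)₍₁₎₁ y¹ ⊗ x³ (y³ • m)₍₁₎₂ y²`,
* `ε(m₍₁₎) m₍₀₎ = m`,
* `h₁ • m₍₀₎ ⊗ h₂ m₍₁₎ = (h₂ • m)₍₀₎ ⊗ (h₂ • m)₍₁₎ h₁`.
Here `Algebra.lmul k H` is the action of `H` on itself by left multiplication. -/
structure LeftRightYD where
  /-- the underlying left module -/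
  toMod : HMod k H
  /-- the right coaction -/
  coact : toMod →ₗ[k] toMod ⊗[k] H
  coact_coassoc : ∀ m : toMod,
    TensorProduct.map (rightSwap coact (Algebra.lmul k H)) LinearMap.id
      ((TensorProduct.assoc k H toMod H).symm
        (tensorAct (Algebra.lmul k H) (tensorAct toMod.act (Algebra.lmul k H)) ↑Q.reassociator⁻¹
          ((1 : H) ⊗ₜ[k] coact m))) =
    (TensorProduct.assoc k toMod H H).symm
      (tensorAct toMod.act (tensorAct (Algebra.lmul k H) (Algebra.lmul k H)) ↑Q.reassociator⁻¹
        (rightSwap coact ((tensorAct (Algebra.lmul k H) (Algebra.lmul k H)).comp Q.comul)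
          ((TensorProduct.assoc k H H toMod).symm
            (tensorAct (Algebra.lmul k H) (tensorAct (Algebra.lmul k H) toMod.act)
              ↑Q.reassociator⁻¹ ((1 : H) ⊗ₜ[k] ((1 : H) ⊗ₜ[k] m))))))
  coact_counit : ∀ m : toMod,
    TensorProduct.rid k toMod (TensorProduct.map LinearMap.id Q.counit.toLinearMap (coact m)) = m
  coact_compat : ∀ (h : H) (m : toMod),
    tensorAct toMod.act (Algebra.lmul k H) (Q.comul h) (coact m) =
      rightSwap coact (Algebra.lmul k H)
        (tensorAct (Algebra.lmul k H) toMod.act (Q.comul h) ((1 : H) ⊗ₜ[k] m))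

variable {k H}

namespace LeftRightYD

/-- A morphism of left-right Yetter-Drinfeld modules: a module homomorphism that preserves the
coaction. -/
@[ext]
structure Hom (M N : LeftRightYD k H) where
  /-- the underlying module homomorphism -/
  hom : M.toMod ⟶ N.toMod
  map_coact : ∀ m : M.toMod,
    N.coact (hom.lin m) = TensorProduct.map hom.lin LinearMap.id (M.coact m)

instance : Category (LeftRightYD k H) where
  Hom := Hom
  id M := ⟨𝟙 M.toMod, fun m => by simp⟩
  comp f g := ⟨f.hom ≫ g.hom, fun m => by
    rw [HMod.comp_lin, LinearMap.comp_apply, g.map_coact, f.map_coact, ← LinearMap.comp_apply,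
      ← TensorProduct.map_comp, LinearMap.id_comp]⟩

@[ext]
theorem hom_ext {M N : LeftRightYD k H} {f g : M ⟶ N} (h : f.hom = g.hom) : f = g := Hom.ext h

@[simp]
theorem id_hom (M : LeftRightYD k H) : Hom.hom (𝟙 M) = 𝟙 M.toMod := rfl

@[simp]
theorem comp_hom {M N P : LeftRightYD k H} (f : M ⟶ N) (g : N ⟶ P) :
    (f ≫ g).hom = f.hom ≫ g.hom := rfl

theorem rightSwap_act (M : LeftRightYD k H) (X : HMod k H) (h : H) (t : X ⊗[k] M.toMod) :
    rightSwap M.coact X.act (tensorAct X.act M.toMod.act (Q.comul h) t) =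
      tensorAct M.toMod.act X.act (Q.comul h) (rightSwap M.coact X.act t) := by
  induction t using TensorProduct.induction_on with
  | zero => simp
  | add x y hx hy => simp only [map_add, hx, hy]
  | tmul x m =>
    have e : x ⊗ₜ[k] m = TensorProduct.map (X.act.toLinearMap.flip x) LinearMap.id
      ((1 : H) ⊗ₜ[k] m) := (map_one_flip LinearMap.id X.act x m).symm
    rw [e, ← tensorAct_map (σ := M.toMod.act) (flip_act X.act x) (fun _ _ => rfl),
      rightSwap_map (flip_act X.act x), ← M.coact_compat, rightSwap_map (flip_act X.act x),
      rightSwap_regular_one, tensorAct_map (fun _ _ => rfl) (flip_act X.act x)]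

theorem map_map_assoc_symm {V₁ V₂ V₃ W₁ W₂ W₃ : Type u} [AddCommGroup V₁] [Module k V₁]
    [AddCommGroup V₂] [Module k V₂] [AddCommGroup V₃] [Module k V₃] [AddCommGroup W₁] [Module k W₁]
    [AddCommGroup W₂] [Module k W₂] [AddCommGroup W₃] [Module k W₃] (f : V₁ →ₗ[k] W₁)
    (g : V₂ →ₗ[k] W₂) (h : V₃ →ₗ[k] W₃) (t : V₁ ⊗[k] (V₂ ⊗[k] V₃)) :
    TensorProduct.map (TensorProduct.map f g) h ((TensorProduct.assoc k V₁ V₂ V₃).symm t) =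
      (TensorProduct.assoc k W₁ W₂ W₃).symm (TensorProduct.map f (TensorProduct.map g h) t) := by
  rw [LinearEquiv.eq_symm_apply, ← TensorProduct.map_map_assoc, LinearEquiv.apply_symm_apply]

theorem rightSwap_hexagon (M : LeftRightYD k H) (X Y : HMod k H) (m : M.toMod) (x : X) (y : Y) :
    (TensorProduct.assoc k M.toMod X Y).symm
      (tensorAct M.toMod.act (tensorAct X.act Y.act) ↑Q.reassociator⁻¹
        (rightSwap M.coact ((tensorAct X.act Y.act).comp Q.comul)
          ((TensorProduct.assoc k X Y M.toMod).symm
            (tensorAct X.act (tensorAct Y.act M.toMod.act) ↑Q.reassociator⁻¹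
              (x ⊗ₜ[k] (y ⊗ₜ[k] m)))))) =
    TensorProduct.map (rightSwap M.coact X.act) LinearMap.id
      ((TensorProduct.assoc k X M.toMod Y).symm
        (tensorAct X.act (tensorAct M.toMod.act Y.act) ↑Q.reassociator⁻¹
          (x ⊗ₜ[k] rightSwap M.coact Y.act (y ⊗ₜ m)))) := by
  set f := X.act.toLinearMap.flip x with hf
  set g := Y.act.toLinearMap.flip y with hg
  have hf' := flip_act X.act x
  have hg' := flip_act Y.act y
  rw [← hf] at hf'
  rw [← hg] at hg'
  have hf1 : f 1 = x := by simp [hf]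
  have hg1 : g 1 = y := by simp [hg]
  have e1 : x ⊗ₜ[k] (y ⊗ₜ[k] m) = TensorProduct.map f (TensorProduct.map g LinearMap.id)
      ((1 : H) ⊗ₜ[k] ((1 : H) ⊗ₜ[k] m)) := by simp [hf1, hg1]
  have e2 : x ⊗ₜ[k] TensorProduct.map LinearMap.id g (M.coact m) =
      TensorProduct.map f (TensorProduct.map LinearMap.id g) ((1 : H) ⊗ₜ[k] M.coact m) := by
    simp [hf1]
  have hfg : ∀ (h : H) t, TensorProduct.map f g
      ((tensorAct (Algebra.lmul k H) (Algebra.lmul k H)).comp Q.comul h t) =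
      (tensorAct X.act Y.act).comp Q.comul h (TensorProduct.map f g t) :=
    fun h t => tensorAct_map hf' hg' _ t
  rw [rightSwap_tmul, ← hg, e1, e2,
    ← tensorAct_map hf' (tensorAct_map (σ := M.toMod.act) hg' fun _ _ => rfl),
    ← map_map_assoc_symm, rightSwap_map hfg,
    ← tensorAct_map (ρ := M.toMod.act) (fun _ _ => rfl) (tensorAct_map hf' hg'),
    ← map_map_assoc_symm, ← M.coact_coassoc,
    ← tensorAct_map hf' (tensorAct_map (ρ := M.toMod.act) (fun _ _ => rfl) hg'),
    ← map_map_assoc_symm]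
  rw [map_map', map_map', LinearMap.id_comp, LinearMap.comp_id]
  congr 2
  exact LinearMap.ext fun t => (rightSwap_map hf' t).symm

theorem rightSwap_unit (M : LeftRightYD k H) (m : M.toMod) (r : k) :
    rightSwap M.coact ((Algebra.lmul k k).comp Q.counit) (r ⊗ₜ m) = (r • m) ⊗ₜ[k] (1 : k) := by
  apply (TensorProduct.rid k M.toMod).injective
  rw [rightSwap_tmul, TensorProduct.rid_tmul, one_smul]
  conv_rhs => rw [← M.coact_counit m]
  generalize M.coact m = z
  induction z using TensorProduct.induction_on with
  | zero => simp
  | add x y hx hy => simp only [map_add, hx, hy, smul_add]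
  | tmul m h => simp [mul_smul, smul_comm r]

/-- The half-braiding `x ⊗ m ↦ m₍₀₎ ⊗ m₍₁₎ • x` of a left-right Yetter-Drinfeld module: left-right
Yetter-Drinfeld modules are the objects of the weak right center of the category of left
modules. -/
def halfBraiding (M : LeftRightYD k H) : RightHalfBraiding M.toMod where
  t X := ⟨rightSwap M.coact X.act, fun h t => rightSwap_act M X h t⟩
  natural f := HMod.Hom.ext (LinearMap.ext fun t => rightSwap_map f.map_act t)
  hexagon X Y := HMod.Hom.ext (TensorProduct.ext_threefold' (M := X) (N := Y) (P := M.toMod)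
    fun x y m => rightSwap_hexagon M X Y m x y)
  unit := HMod.Hom.ext (TensorProduct.ext' (M := k) (N := M.toMod) fun r m => rightSwap_unit M m r)

theorem t_eq_rightSwap {M : HMod k H} (σ : RightHalfBraiding M) {rho : M →ₗ[k] M ⊗[k] H}
    (hl : ∀ m : M, rho m = (σ.t (HMod.regular k H)).lin ((1 : H) ⊗ₜ[k] m : H ⊗[k] M))
    (X : HMod k H) : (σ.t X).lin = rightSwap rho X.act := by
  refine TensorProduct.ext' (M := X) (N := M) fun x m => ?_
  have := congrArg (fun f => HMod.Hom.lin f ((1 : H) ⊗ₜ[k] m : H ⊗[k] M)) (σ.natural (HMod.orbit x))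
  have e : (HMod.orbit x ▷ M).lin ((1 : H) ⊗ₜ[k] m : H ⊗[k] M) = (x ⊗ₜ[k] m : X ⊗[k] M) :=
    congrArg (fun f : Module.End k X => f x ⊗ₜ[k] m) (map_one X.act)
  refine (congrArg (σ.t X).lin e).symm.trans (this.trans ?_)
  refine Eq.trans ?_ (rightSwap_tmul rho X.act m x).symm
  rw [hl]; rfl

/-- The left-right Yetter-Drinfeld module of a right half-braiding; its coaction is
`m ↦ t_H(1 ⊗ m)`. -/
def ofHalfBraiding (M : HMod k H) (σ : RightHalfBraiding M) : LeftRightYD k H :=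
  let rho : M →ₗ[k] M ⊗[k] H :=
    (σ.t (HMod.regular k H)).lin ∘ₗ TensorProduct.mk k H M 1
  { toMod := M
    coact := rho
    coact_coassoc := fun m => by
      have h := congrArg (fun f => HMod.Hom.lin f ((1 : H) ⊗ₜ[k] ((1 : H) ⊗ₜ[k] m) :
        H ⊗[k] (H ⊗[k] M))) (σ.hexagon (HMod.regular k H) (HMod.regular k H))
      have e1 : (σ.t (HMod.regular k H)).lin = rightSwap rho (Algebra.lmul k H) :=
        t_eq_rightSwap σ (fun _ => rfl) _
      have e2 : (σ.t (HMod.regular k H ⊗ HMod.regular k H)).lin =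
          rightSwap rho ((tensorAct (Algebra.lmul k H) (Algebra.lmul k H)).comp Q.comul) :=
        t_eq_rightSwap σ (fun _ => rfl) _
      rw [← e1, ← e2]
      exact h.symm
    coact_counit := fun m => by
      have h := congrArg (fun f => HMod.Hom.lin f ((1 : k) ⊗ₜ[k] m : k ⊗[k] M)) σ.unit
      have e1 : (σ.t (HMod.unit k H)).lin = rightSwap rho ((Algebra.lmul k k).comp Q.counit) :=
        t_eq_rightSwap σ (fun _ => rfl) _
      have e2 : rightSwap rho ((Algebra.lmul k k).comp Q.counit) ((1 : k) ⊗ₜ[k] m) =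
          (TensorProduct.rid k M).symm (TensorProduct.lid k M ((1 : k) ⊗ₜ[k] m)) := by
        rw [← e1]
        exact h
      rw [TensorProduct.lid_tmul, one_smul, LinearEquiv.eq_symm_apply, rightSwap_tmul] at e2
      refine Eq.trans ?_ e2
      congr 3
      ext h
      simp
    coact_compat := fun h m => by
      have e1 : (σ.t (HMod.regular k H)).lin = rightSwap rho (Algebra.lmul k H) :=
        t_eq_rightSwap σ (fun _ => rfl) _
      rw [← e1]
      exact ((σ.t (HMod.regular k H)).map_act h ((1 : H) ⊗ₜ[k] m : H ⊗[k] M)).symm }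

theorem ofHalfBraiding_t (M : HMod k H) (σ : RightHalfBraiding M) (X : HMod k H) :
    (ofHalfBraiding M σ).halfBraiding.t X = σ.t X :=
  HMod.Hom.ext (t_eq_rightSwap σ (fun _ => rfl) X).symm

theorem ofHalfBraiding_halfBraiding (M : HMod k H) (σ : RightHalfBraiding M) :
    (ofHalfBraiding M σ).halfBraiding = σ :=
  RightHalfBraiding.ext' (ofHalfBraiding_t M σ)

/-- A module homomorphism that is a morphism of the weak right center preserves the coactions. -/
def homOfIsHom {M N : LeftRightYD k H} (f : M.toMod ⟶ N.toMod)
    (hf : RightHalfBraiding.IsHom M.halfBraiding N.halfBraiding f) : M ⟶ N where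
  hom := f
  map_coact m := by
    have h := congrArg (fun f => HMod.Hom.lin f ((1 : H) ⊗ₜ[k] m : H ⊗[k] M.toMod))
      (hf (HMod.regular k H))
    have e1 := rightSwap_regular_one N.coact (f.lin m)
    have e2 := rightSwap_regular_one M.coact m
    rw [← e1, ← e2]
    exact h

theorem isHom_hom {M N : LeftRightYD k H} (f : M ⟶ N) :
    RightHalfBraiding.IsHom M.halfBraiding N.halfBraiding f.hom := fun X =>
  HMod.Hom.ext (TensorProduct.ext' (M := X) (N := M.toMod) fun x m => by
    change rightSwap N.coact X.act (x ⊗ₜ[k] f.hom.lin m) =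
      TensorProduct.map f.hom.lin LinearMap.id (rightSwap M.coact X.act (x ⊗ₜ[k] m))
    rw [rightSwap_tmul, rightSwap_tmul, f.map_coact, map_map', map_map', LinearMap.comp_id,
      LinearMap.id_comp, LinearMap.id_comp, LinearMap.comp_id])

/-- The tensor product of left-right Yetter-Drinfeld modules: the tensor product of the underlying
modules, with the tensor product of the half-braidings. Its coaction is
`m ⊗ n ↦ x¹ X¹ • (y² • m)₍₀₎ ⊗ x² • (X³ y³ • n)₍₀₎ ⊗ x³ (X³ y³ • n)₍₁₎ X² (y² • m)₍₁₎ y¹`. -/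
def tensor (M N : LeftRightYD k H) : LeftRightYD k H :=
  ofHalfBraiding (M.toMod ⊗ N.toMod) (M.halfBraiding.tensor N.halfBraiding)

variable (k H) in
/-- The unit object: the field `k` with the action through `ε` and the coaction `r ↦ r ⊗ 1`. -/
def unit : LeftRightYD k H :=
  ofHalfBraiding (𝟙_ (HMod k H)) (RightHalfBraiding.tensorUnit (HMod k H))

theorem tensor_halfBraiding (M N : LeftRightYD k H) :
    (tensor M N).halfBraiding = M.halfBraiding.tensor N.halfBraiding :=
  ofHalfBraiding_halfBraiding _ _

theorem unit_halfBraiding : (unit k H).halfBraiding = RightHalfBraiding.tensorUnit (HMod k H) :=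
  ofHalfBraiding_halfBraiding _ _

/-- The tensor product of two morphisms. -/
def tensorHom {M N M' N' : LeftRightYD k H} (f : M ⟶ M') (g : N ⟶ N') : tensor M N ⟶ tensor M' N' :=
  homOfIsHom (M := tensor M N) (N := tensor M' N') (f.hom ⊗ₘ g.hom) (by
    rw [tensor_halfBraiding, tensor_halfBraiding]
    exact RightHalfBraiding.isHom_tensorHom (isHom_hom f) (isHom_hom g))

/-- The associativity constraint is the one of the underlying modules. -/
def associator (M N P : LeftRightYD k H) : tensor (tensor M N) P ≅ tensor M (tensor N P) where
  hom := homOfIsHom (M := tensor (tensor M N) P) (N := tensor M (tensor N P))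
    (α_ M.toMod N.toMod P.toMod).hom (by
      rw [tensor_halfBraiding, tensor_halfBraiding, tensor_halfBraiding, tensor_halfBraiding]
      exact RightHalfBraiding.isHom_associator_hom)
  inv := homOfIsHom (N := tensor (tensor M N) P) (M := tensor M (tensor N P))
    (α_ M.toMod N.toMod P.toMod).inv (by
      rw [tensor_halfBraiding, tensor_halfBraiding, tensor_halfBraiding, tensor_halfBraiding]
      exact RightHalfBraiding.isHom_associator_inv)
  hom_inv_id := LeftRightYD.hom_ext (α_ M.toMod N.toMod P.toMod).hom_inv_id
  inv_hom_id := LeftRightYD.hom_ext (α_ M.toMod N.toMod P.toMod).inv_hom_id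

/-- The left unit constraint is the one of the underlying module. -/
def leftUnitor (M : LeftRightYD k H) : tensor (unit k H) M ≅ M where
  hom := homOfIsHom (M := tensor (unit k H) M) (λ_ M.toMod).hom (by
    rw [tensor_halfBraiding, unit_halfBraiding]
    exact RightHalfBraiding.isHom_leftUnitor_hom)
  inv := homOfIsHom (N := tensor (unit k H) M) (λ_ M.toMod).inv (by
    rw [tensor_halfBraiding, unit_halfBraiding]
    exact RightHalfBraiding.isHom_leftUnitor_inv)
  hom_inv_id := LeftRightYD.hom_ext (λ_ M.toMod).hom_inv_id
  inv_hom_id := LeftRightYD.hom_ext (λ_ M.toMod).inv_hom_id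

/-- The right unit constraint is the one of the underlying module. -/
def rightUnitor (M : LeftRightYD k H) : tensor M (unit k H) ≅ M where
  hom := homOfIsHom (M := tensor M (unit k H)) (ρ_ M.toMod).hom (by
    rw [tensor_halfBraiding, unit_halfBraiding]
    exact RightHalfBraiding.isHom_rightUnitor_hom)
  inv := homOfIsHom (N := tensor M (unit k H)) (ρ_ M.toMod).inv (by
    rw [tensor_halfBraiding, unit_halfBraiding]
    exact RightHalfBraiding.isHom_rightUnitor_inv)
  hom_inv_id := LeftRightYD.hom_ext (ρ_ M.toMod).hom_inv_id
  inv_hom_id := LeftRightYD.hom_ext (ρ_ M.toMod).inv_hom_id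

instance : MonoidalCategoryStruct (LeftRightYD k H) where
  tensorObj := tensor
  whiskerLeft M _ _ f := tensorHom (𝟙 M) f
  whiskerRight f M := tensorHom f (𝟙 M)
  tensorHom f g := tensorHom f g
  tensorUnit := unit k H
  associator := associator
  leftUnitor := leftUnitor
  rightUnitor := rightUnitor

instance : MonoidalCategory (LeftRightYD k H) where
  tensorHom_def f g := LeftRightYD.hom_ext (MonoidalCategory.tensorHom_def f.hom g.hom)
  id_tensorHom_id M N := LeftRightYD.hom_ext (MonoidalCategory.id_tensorHom_id M.toMod N.toMod)
  tensorHom_comp_tensorHom f g f' g' := LeftRightYD.hom_ext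
    (MonoidalCategory.tensorHom_comp_tensorHom f.hom g.hom f'.hom g'.hom)
  whiskerLeft_id M N := LeftRightYD.hom_ext (MonoidalCategory.whiskerLeft_id M.toMod N.toMod)
  id_whiskerRight M N := LeftRightYD.hom_ext (MonoidalCategory.id_whiskerRight M.toMod N.toMod)
  associator_naturality f g h := LeftRightYD.hom_ext
    (MonoidalCategory.associator_naturality f.hom g.hom h.hom)
  leftUnitor_naturality f := LeftRightYD.hom_ext (MonoidalCategory.leftUnitor_naturality f.hom)
  rightUnitor_naturality f := LeftRightYD.hom_ext (MonoidalCategory.rightUnitor_naturality f.hom)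
  pentagon M N P R := LeftRightYD.hom_ext
    (MonoidalCategory.pentagon M.toMod N.toMod P.toMod R.toMod)
  triangle M N := LeftRightYD.hom_ext (MonoidalCategory.triangle M.toMod N.toMod)

/-- The prebraiding `m ⊗ n ↦ n₍₀₎ ⊗ n₍₁₎ • m`. -/
instance : PrebraidedCategory (LeftRightYD k H) where
  braid M N := homOfIsHom (M := tensor M N) (N := tensor N M) (N.halfBraiding.t M.toMod) (by
    rw [tensor_halfBraiding, tensor_halfBraiding]
    exact RightHalfBraiding.isHom_braid)
  naturality_right M _ _ f := LeftRightYD.hom_ext (isHom_hom f M.toMod)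
  naturality_left f P := LeftRightYD.hom_ext (P.halfBraiding.natural f.hom)
  hexagon_forward M N P := LeftRightYD.hom_ext (by
    have h := RightHalfBraiding.hexagon_forward (σ := N.halfBraiding) (τ := P.halfBraiding)
      (Z := M.toMod)
    rw [← tensor_halfBraiding] at h
    exact h)
  hexagon_reverse M N P := LeftRightYD.hom_ext (P.halfBraiding.hexagon M.toMod N.toMod)

end LeftRightYD

end LeftRightYetterDrinfeld

section RightHanded

variable (k H : Type u) [Field k] [Ring H] [Algebra k H] [QuasiBialgebra k H]

/-- The category of right-left Yetter-Drinfeld modules over `H`. A right `H`-module is a left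
`H^op`-module, through `m • h = op h • m`; the tensor product of right modules is given by
`(m ⊗ n) • h = m • h₁ ⊗ n • h₂`, and its associativity constraint by the right action of
`Φ⁻¹ = x¹ ⊗ x² ⊗ x³`. So these are the tensor product and the associativity constraint of left
modules over the quasi-bialgebra `H^op`. Written with right actions and with the multiplication
of `H`, the axioms are
* `m₍₋₁₎ x¹ ⊗ x³ (m₍₀₎ • x²)₍₋₁₎ ⊗ (m₍₀₎ • x²)₍₀₎ =
   y² (m • y¹)₍₋₁₎₁ x¹ ⊗ y³ (m • y¹)₍₋₁₎₂ x² ⊗ (m • y¹)₍₀₎ • x³`,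
* `ε(m₍₋₁₎) m₍₀₎ = m`,
* `m₍₋₁₎ h₁ ⊗ m₍₀₎ • h₂ = h₂ (m • h₁)₍₋₁₎ ⊗ (m • h₁)₍₀₎`;
the coaction of a tensor product is
`m ⊗ n ↦ x³ (n • x²)₍₋₁₎ X² (m • x¹ X¹)₍₋₁₎ y¹ ⊗ (m • x¹ X¹)₍₀₎ • y² ⊗ (n • x²)₍₀₎ • X³ y³`,
and the prebraiding is `m ⊗ n ↦ n • m₍₋₁₎ ⊗ m₍₀₎`. -/
abbrev RightLeftYD := LeftYD k Hᵐᵒᵖ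

/-- The category of right Yetter-Drinfeld modules over `H`; right `H`-modules are again left
`H^op`-modules. Written with right actions and with the multiplication of `H`, the axioms are
* `(m₍₀₎ • X²)₍₀₎ ⊗ X¹ (m₍₀₎ • X²)₍₁₎ ⊗ m₍₁₎ X³ =
   (m • Y³)₍₀₎ • X¹ ⊗ Y¹ (m • Y³)₍₁₎₁ X² ⊗ Y² (m • Y³)₍₁₎₂ X³`,
* `ε(m₍₁₎) m₍₀₎ = m`,
* `m₍₀₎ • h₁ ⊗ m₍₁₎ h₂ = (m • h₂)₍₀₎ ⊗ h₁ (m • h₂)₍₁₎`;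
the coaction of a tensor product is
`m ⊗ n ↦ (m • X²)₍₀₎ • x¹ Y¹ ⊗ (n • X³ x³)₍₀₎ • Y² ⊗ X¹ (m • X²)₍₁₎ x² (n • X³ x³)₍₁₎ Y³`,
and the prebraiding is `m ⊗ n ↦ n₍₀₎ ⊗ m • n₍₁₎`. -/
abbrev RightYD := LeftRightYD k Hᵐᵒᵖ

end RightHanded

section BraidedIsomorphisms

/-- The monoidal category `C` with the inverse braiding `c̃_{X,Y} = (c_{Y,X})⁻¹`. -/
def InverseBraided (C : Type u) : Type u := C

namespace InverseBraided

variable (C : Type u) [Category.{v} C]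

instance : Category (InverseBraided C) := inferInstanceAs (Category C)

instance [MonoidalCategory C] : MonoidalCategory (InverseBraided C) :=
  inferInstanceAs (MonoidalCategory C)

instance [MonoidalCategory C] [BraidedCategory C] : BraidedCategory (InverseBraided C) :=
  reverseBraiding C

end InverseBraided

/-- An isomorphism of braided monoidal categories: an isomorphism of categories, with a strict
inverse, that is a (strong) monoidal functor and is compatible with the braidings. -/
structure BraidedMonoidalIso (C D : Type u) [Category.{v} C] [MonoidalCategory C]
    [BraidedCategory C] [Category.{v} D] [MonoidalCategory D] [BraidedCategory D] where
  /-- the functor -/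
  functor : C ⥤ D
  /-- the inverse functor -/
  inverse : D ⥤ C
  functor_comp_inverse : functor ⋙ inverse = 𝟭 C
  inverse_comp_functor : inverse ⋙ functor = 𝟭 D
  /-- the structure of a braided strong monoidal functor -/
  braided : functor.Braided

end BraidedIsomorphisms

end QuasiHopfYD

end

/-!
# The four braided categories of Yetter-Drinfeld modules over a quasi-Hopf algebra

A left Yetter-Drinfeld module is an `H`-module `M` with a half-braiding, that is, a natural family
of morphisms `M ⊗ U ⟶ U ⊗ M` that satisfies one hexagon; a left-right one carries half-braidings
`U ⊗ M ⟶ M ⊗ U`. The right-handed categories are the same categories over `Hᵐᵒᵖ`. So the theorem is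
about half-braidings in the monoidal categories of modules over `H` and `Hᵐᵒᵖ`, and rests on three
facts.

**Half-braidings over a quasi-Hopf algebra are invertible.** In a category with duals, the inverse of
a half-braiding at `V` is obtained by braiding with the dual of `V`. Modules of infinite dimension
have no duals. However, the contraction `d ⊗ v ↦ d α • v` from `H ⊗ V`, with the action
`h • d = d S(h)` on `H`, has values in `V` with the trivial action, where every half-braiding is
the flip (`halfBraiding_trivialize`), and the axioms for `α` and `β` recover the vectors of `V`
from it. This is enough to invert right half-braidings (`RightHalfBraiding.isIso_t`). Left
half-braidings are reduced to right ones over `Hᵐᵒᵖ` by the next fact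
(`LeftHalfBraiding.isIso_s`). Passing to the inverse half-braidings then is an isomorphism from
`LeftYD` to `LeftRightYD` with the inverse braiding (`LeftYD.inverseFunctor`). Over `Hᵐᵒᵖ`, it is
one from `RightLeftYD` to `RightYD` with the inverse braiding.

**The antipode is a monoidal functor.** Viewed through `S`, a left module becomes a right module.
This functor reverses tensor products up to the Drinfeld twist, an invertible `f` in `H ⊗ H` with
`f Δ(S(h)) = (S(h₂) ⊗ S(h₁)) f`. Instead of being computed, `f` is read off from the isomorphism
`Hom(M, Hom(N, k)) ≅ Hom(M ⊗ N, k)` of the closed structure (`exists_twist`). Its coherence with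
`Φ` is that of nested evaluations (`dualLax_assoc`), tested on products of functionals
(`twistAct_assoc`). The result is a monoidal equivalence from the modules over `H` to the monoidal
opposite of the modules over `Hᵐᵒᵖ` (`antipodeFunctorCore`).

**Half-braidings are transported along monoidal equivalences** (`LeftHalfBraiding.transport`). This
gives a braided functor from `LeftYD` to the monoidal opposite of `RightYD`
(`LeftYD.ydAntipodeFunctor`).

The inverses are strict because the functors are fully faithful and bijective on objects
(`BraidedMonoidalIso.ofBijective`); for the antipode functor, this uses that `S` is bijective and
that transport is a bijection on half-braidings.
-/

noncomputable section

namespace QuasiHopfYD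

/-! ### Identities for the reassociator, the antipode, `α` and `β` -/

section AntipodeIdentities

open scoped TensorProduct
open Algebra.TensorProduct (map assoc includeLeft)

section Induction

variable {k : Type u} [CommSemiring k] {A B C D : Type u} [AddCommMonoid A] [Module k A]
  [AddCommMonoid B] [Module k B] [AddCommMonoid C] [Module k C] [AddCommMonoid D] [Module k D]

theorem tensor₃_induction {p : A ⊗[k] (B ⊗[k] C) → Prop} (zero : p 0)
    (add : ∀ x y, p x → p y → p (x + y)) (tmul : ∀ a b c, p (a ⊗ₜ (b ⊗ₜ c)))
    (z : A ⊗[k] (B ⊗[k] C)) : p z := by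
  induction z using TensorProduct.induction_on with
  | zero => exact zero
  | add x y hx hy => exact add x y hx hy
  | tmul a z =>
    induction z using TensorProduct.induction_on with
    | zero => simpa using zero
    | add x y hx hy => rw [TensorProduct.tmul_add]; exact add _ _ hx hy
    | tmul b c => exact tmul a b c

theorem tensor₄_induction {p : A ⊗[k] (B ⊗[k] (C ⊗[k] D)) → Prop} (zero : p 0)
    (add : ∀ x y, p x → p y → p (x + y)) (tmul : ∀ a b c d, p (a ⊗ₜ (b ⊗ₜ (c ⊗ₜ d))))
    (z : A ⊗[k] (B ⊗[k] (C ⊗[k] D))) : p z := by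
  induction z using TensorProduct.induction_on with
  | zero => exact zero
  | add x y hx hy => exact add x y hx hy
  | tmul a z =>
    refine tensor₃_induction (p := fun z => p (a ⊗ₜ z)) (by simpa using zero) (fun x y hx hy => ?_)
      (fun b c d => tmul a b c d) z
    rw [TensorProduct.tmul_add]; exact add _ _ hx hy

end Induction

variable {k H : Type u} [Field k] [Ring H] [Algebra k H]

section Counit

variable [Q : QuasiBialgebra k H]

variable (k H) in
/-- The element `1 ⊗ z` of `H ⊗ H ⊗ H ⊗ H`. -/
abbrev oneTmul (z : H ⊗[k] (H ⊗[k] H)) : H ⊗[k] (H ⊗[k] (H ⊗[k] H)) := 1 ⊗ₜ z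

/-- The element `z ⊗ 1`, rebracketed to the right. -/
abbrev tmulOne (z : H ⊗[k] (H ⊗[k] H)) : H ⊗[k] (H ⊗[k] (H ⊗[k] H)) :=
  map (.id k H) (assoc k k k H H H).toAlgHom (assoc k k k H (H ⊗[k] H) H (z ⊗ₜ[k] (1 : H)))

/-- The map `Δ ⊗ id`, rebracketed to the right. -/
abbrev comulL {C : Type u} [Ring C] [Algebra k C] (z : H ⊗[k] C) : H ⊗[k] (H ⊗[k] C) :=
  assoc k k k H H C (map Q.comul (.id k C) z)

/-- `(id ⊗ id ⊗ ε)(Φ) = 1`. It is the coherence of the right unitor with a tensor product, read off at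
`1 ⊗ 1` in the regular module. -/
theorem counit_right_reassociator :
    map (.id k H) ((Algebra.TensorProduct.rid k k H).toAlgHom.comp (map (.id k H) Q.counit))
      (Q.reassociator : H ⊗[k] (H ⊗[k] H)) = 1 := by
  have h := congrArg (fun f => HMod.Hom.lin f (((1 : H) ⊗ₜ[k] (1 : H)) ⊗ₜ[k] (1 : k)))
    (MonoidalCategory.rightUnitor_tensor_hom (HMod.regular k H) (HMod.regular k H))
  have e : ∀ z : H ⊗[k] (H ⊗[k] H), TensorProduct.map LinearMap.id
      (TensorProduct.rid k H).toLinearMap (tensorAct (Algebra.lmul k H) (tensorAct (Algebra.lmul k H)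
        ((Algebra.lmul k k).comp Q.counit)) z ((1 : H) ⊗ₜ[k] ((1 : H) ⊗ₜ[k] (1 : k)))) =
      map (.id k H) ((Algebra.TensorProduct.rid k k H).toAlgHom.comp (map (.id k H) Q.counit)) z :=
    tensor₃_induction (by simp) (fun x y hx hy => by simp only [map_add, LinearMap.add_apply, hx, hy])
      fun a b c => by simp
  rw [← e]
  refine h.symm.trans ?_
  exact (TensorProduct.rid_tmul _ _).trans (one_smul _ _)

/-- `(ε ⊗ id ⊗ id)(Φ) = 1`. It is the coherence of the left unitor with a tensor product, read off at
`1 ⊗ 1` in the regular module. -/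
theorem counit_left_reassociator :
    (Algebra.TensorProduct.lid k (H ⊗[k] H)) (map Q.counit (.id k (H ⊗[k] H))
      (Q.reassociator : H ⊗[k] (H ⊗[k] H))) = 1 := by
  have h := congrArg (fun f => HMod.Hom.lin f (((1 : k) ⊗ₜ[k] (1 : H)) ⊗ₜ[k] (1 : H)))
    (MonoidalCategory.leftUnitor_whiskerRight (HMod.regular k H) (HMod.regular k H))
  have e : ∀ z : H ⊗[k] (H ⊗[k] H), TensorProduct.lid k (H ⊗[k] H)
      (tensorAct ((Algebra.lmul k k).comp Q.counit) (tensorAct (Algebra.lmul k H) (Algebra.lmul k H))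
        z ((1 : k) ⊗ₜ[k] ((1 : H) ⊗ₜ[k] (1 : H)))) =
      (Algebra.TensorProduct.lid k (H ⊗[k] H)) (map Q.counit (.id k (H ⊗[k] H)) z) :=
    tensor₃_induction (by simp) (fun x y hx hy => by simp only [map_add, LinearMap.add_apply, hx, hy])
      fun a b c => by simp
  rw [← e]
  refine Eq.trans ?_ (h.symm.trans ?_)
  · rfl
  · exact congrArg (· ⊗ₜ[k] (1 : H)) ((TensorProduct.lid_tmul _ _).trans (one_smul _ _))

theorem map_inv_reassociator {A : Type u} [Ring A] [Algebra k A] {f : H ⊗[k] (H ⊗[k] H) →ₐ[k] A}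
    (hf : f Q.reassociator = 1) : f ↑Q.reassociator⁻¹ = 1 := by
  have := congrArg f (Units.mul_inv Q.reassociator)
  rwa [map_mul, hf, one_mul, map_one] at this

theorem counit_right_reassociator_inv :
    map (.id k H) ((Algebra.TensorProduct.rid k k H).toAlgHom.comp (map (.id k H) Q.counit))
      (↑Q.reassociator⁻¹ : H ⊗[k] (H ⊗[k] H)) = 1 :=
  map_inv_reassociator counit_right_reassociator

theorem counit_left_reassociator_inv :
    (Algebra.TensorProduct.lid k (H ⊗[k] H)) (map Q.counit (.id k (H ⊗[k] H))
      (↑Q.reassociator⁻¹ : H ⊗[k] (H ⊗[k] H))) = 1 :=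
  map_inv_reassociator (f := (Algebra.TensorProduct.lid k (H ⊗[k] H)).toAlgHom.comp
    (map Q.counit (.id k (H ⊗[k] H)))) counit_left_reassociator

end Counit

section Cocycle

variable {R : Type u} [Monoid R] {a b c d e a' b' c' d' e' : R}

/-! The pentagon for the reassociator has the form `a b c = d e` with invertible factors. The three
lemmas below solve it for the products in which it is used. -/

theorem mul_eq_of_cocycle₁ (h : a * b * c = d * e) (hc : c * c' = 1) (hd : d' * d = 1) :
    e * c' = d' * (a * b) := by
  calc e * c' = d' * d * e * c' := by rw [hd, one_mul]
    _ = d' * (a * b) * (c * c') := by rw [mul_assoc d', ← h]; simp only [mul_assoc]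
    _ = _ := by rw [hc, mul_one]

theorem mul_eq_of_cocycle₃ (h : a * b * c = d * e) (ha : a' * a = 1) (he : e * e' = 1) :
    a' * d = b * (c * e') := by
  calc a' * d = a' * d * (e * e') := by rw [he, mul_one]
    _ = a' * a * (b * (c * e')) := by rw [mul_assoc a', ← mul_assoc d, ← h]; simp only [mul_assoc]
    _ = _ := by rw [ha, one_mul]

theorem mul_eq_of_cocycle₂ (h : a * b * c = d * e) (ha : a' * a = 1) (hb : b' * b = 1)
    (he : e * e' = 1) :
    c * e' = b' * (a' * d) := by
  rw [mul_eq_of_cocycle₃ h ha he, ← mul_assoc, hb, one_mul]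

end Cocycle

section Antipode

variable [Q : QuasiHopfAlgebra k H]

local notation "Φ" => (Q.reassociator : H ⊗[k] (H ⊗[k] H))
local notation "Φinv" => ((Q.reassociator⁻¹ : (H ⊗[k] (H ⊗[k] H))ˣ) : H ⊗[k] (H ⊗[k] H))

variable (k H) in
/-- The linear map `a ⊗ b ↦ S(a) α b`. -/
def alphaMap : H ⊗[k] H →ₗ[k] H :=
  LinearMap.mul' k H ∘ₗ
    TensorProduct.map (LinearMap.mulRight k Q.alpha ∘ₗ Q.antipode.toLinearMap) LinearMap.id

variable (k H) in
/-- The linear map `a ⊗ b ↦ a β S(b)`. -/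
def betaMap : H ⊗[k] H →ₗ[k] H :=
  LinearMap.mul' k H ∘ₗ TensorProduct.map (LinearMap.mulRight k Q.beta) Q.antipode.toLinearMap

@[simp]
theorem alphaMap_tmul (a b : H) : alphaMap k H (a ⊗ₜ b) = Q.antipode a * Q.alpha * b := rfl

@[simp]
theorem betaMap_tmul (a b : H) : betaMap k H (a ⊗ₜ b) = a * Q.beta * Q.antipode b := rfl

theorem alphaMap_mul (w : H ⊗[k] H) (a b : H) :
    alphaMap k H (w * a ⊗ₜ b) = Q.antipode a * alphaMap k H w * b := by
  induction w using TensorProduct.induction_on with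
  | zero => simp
  | add x y hx hy => simp only [map_add, add_mul, mul_add, hx, hy]
  | tmul c d => simp [Q.antipode_mul, mul_assoc]

theorem betaMap_mul (w : H ⊗[k] H) (a b : H) :
    betaMap k H (a ⊗ₜ b * w) = a * betaMap k H w * Q.antipode b := by
  induction w using TensorProduct.induction_on with
  | zero => simp
  | add x y hx hy => simp only [map_add, add_mul, mul_add, hx, hy]
  | tmul c d => simp [Q.antipode_mul, mul_assoc]

@[simp]
theorem alphaMap_comul (h : H) : alphaMap k H (Q.comul h) = Q.counit h • Q.alpha :=
  Q.antipode_alpha h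

@[simp]
theorem betaMap_comul (h : H) : betaMap k H (Q.comul h) = Q.counit h • Q.beta :=
  Q.antipode_beta h

theorem alphaMap_comul_mul (h : H) (z : H ⊗[k] H) :
    alphaMap k H (Q.comul h * z) = Q.counit h • alphaMap k H z := by
  induction z using TensorProduct.induction_on with
  | zero => simp
  | add x y hx hy => simp only [map_add, mul_add, smul_add, hx, hy]
  | tmul c d => simp [alphaMap_mul]

theorem betaMap_mul_comul (h : H) (z : H ⊗[k] H) :
    betaMap k H (z * Q.comul h) = Q.counit h • betaMap k H z := by
  induction z using TensorProduct.induction_on with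
  | zero => simp
  | add x y hx hy => simp only [map_add, add_mul, smul_add, hx, hy]
  | tmul c d => simp [betaMap_mul]

variable (k H) in
/-- The element `p = x¹ ⊗ x² β S(x³)` of `H ⊗ H`, where `Φ⁻¹ = x¹ ⊗ x² ⊗ x³`. -/
def pElem : H ⊗[k] H := TensorProduct.map LinearMap.id (betaMap k H) Φinv

/-- With `T(a ⊗ b ⊗ c) = a ⊗ b β S(c)`, this is `T((u ⊗ b) z) = u T(z) (1 ⊗ S(b))`. -/
theorem map_betaMap_assoc_mul (u : H ⊗[k] H) (b : H) (z : H ⊗[k] (H ⊗[k] H)) :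
    TensorProduct.map LinearMap.id (betaMap k H) (assoc k k k H H H (u ⊗ₜ b) * z) =
      u * TensorProduct.map LinearMap.id (betaMap k H) z * (1 ⊗ₜ Q.antipode b) := by
  induction u using TensorProduct.induction_on with
  | zero => simp
  | add x y hx hy => simp only [TensorProduct.add_tmul, map_add, add_mul, hx, hy]
  | tmul c d =>
    induction z using TensorProduct.induction_on with
    | zero => simp
    | add x y hx hy => simp only [map_add, add_mul, mul_add, hx, hy]
    | tmul e y => simp [betaMap_mul]

theorem map_betaMap_mul_comul (w : H ⊗[k] H) (z : H ⊗[k] (H ⊗[k] H)) :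
    TensorProduct.map LinearMap.id (betaMap k H) (z * map (.id k H) Q.comul w) =
      TensorProduct.map LinearMap.id (betaMap k H) z *
        (Algebra.TensorProduct.rid k k H (map (.id k H) Q.counit w) ⊗ₜ 1) := by
  induction w using TensorProduct.induction_on with
  | zero => simp
  | add x y hx hy => simp only [TensorProduct.add_tmul, map_add, mul_add, hx, hy]
  | tmul c d =>
    induction z using TensorProduct.induction_on with
    | zero => simp
    | add x y hx hy => simp only [map_add, add_mul, mul_add, hx, hy]
    | tmul e y => simp [betaMap_mul_comul, TensorProduct.smul_tmul]

/-- `p (h ⊗ 1) = (h₁)₁ p¹ ⊗ (h₁)₂ p² S(h₂)`, which makes currying with `p` linear over `H`. -/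
theorem pElem_mul (h : H) : pElem k H * (h ⊗ₜ 1) =
    TensorProduct.map LinearMap.id (betaMap k H)
      (assoc k k k H H H (map Q.comul (.id k H) (Q.comul h)) * Φinv) := by
  have h2 : Φinv * map (.id k H) Q.comul (Q.comul h) =
      assoc k k k H H H (map Q.comul (.id k H) (Q.comul h)) * Φinv := by
    rw [Q.quasi_coassoc h, mul_assoc (G := H ⊗[k] (H ⊗[k] H)), Units.inv_mul_cancel_left]
  rw [← h2, map_betaMap_mul_comul, Q.counit_right]; rfl

theorem tmulOne_mul_inv : tmulOne Φ * tmulOne Φinv = 1 := by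
  rw [← map_mul, ← map_mul, Algebra.TensorProduct.tmul_mul_tmul, Units.mul_inv, mul_one]
  exact (congrArg _ (map_one _)).trans (map_one _)

theorem oneTmul_inv_mul : oneTmul k H Φinv * oneTmul k H Φ = 1 := by
  rw [Algebra.TensorProduct.tmul_mul_tmul, Units.inv_mul, mul_one]; rfl

theorem comulL_mul_inv : comulL Φ * comulL Φinv = 1 := by
  rw [← map_mul, ← map_mul, Units.mul_inv, map_one, map_one]

theorem comulL_mul_tmulOne_inv :
    comulL Φ * tmulOne Φinv = map (.id k H) (map (.id k H) Q.comul) Φinv *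
      (oneTmul k H Φ *
        map (.id k H) ((assoc k k k H H H).toAlgHom.comp (map Q.comul (.id k H))) Φ) := by
  refine mul_eq_of_cocycle₁ (R := H ⊗[k] (H ⊗[k] (H ⊗[k] H))) Q.cocycle tmulOne_mul_inv ?_
  rw [← map_mul, Units.inv_mul, map_one]

theorem tmulOne_mul_comulL_inv : tmulOne Φ * comulL Φinv =
    map (.id k H) ((assoc k k k H H H).toAlgHom.comp (map Q.comul (.id k H))) Φinv *
      (oneTmul k H Φinv * map (.id k H) (map (.id k H) Q.comul) Φ) := by
  refine mul_eq_of_cocycle₂ (R := H ⊗[k] (H ⊗[k] (H ⊗[k] H))) Q.cocycle oneTmul_inv_mul ?_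
    comulL_mul_inv
  rw [← map_mul, Units.inv_mul, map_one]

theorem oneTmul_inv_mul_comul : oneTmul k H Φinv * map (.id k H) (map (.id k H) Q.comul) Φ =
    map (.id k H) ((assoc k k k H H H).toAlgHom.comp (map Q.comul (.id k H))) Φ *
      (tmulOne Φ * comulL Φinv) :=
  mul_eq_of_cocycle₃ (R := H ⊗[k] (H ⊗[k] (H ⊗[k] H))) Q.cocycle oneTmul_inv_mul comulL_mul_inv

variable (k H) in
/-- The linear map `a ⊗ b ⊗ c ↦ a β S(b) α c`, which sends `Φ` to `1`. -/
def betaAlphaMap : H ⊗[k] (H ⊗[k] H) →ₗ[k] H :=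
  LinearMap.mul' k H ∘ₗ TensorProduct.map (LinearMap.mulRight k Q.beta) (alphaMap k H)

@[simp]
theorem betaAlphaMap_tmul (a b c : H) : betaAlphaMap k H (a ⊗ₜ (b ⊗ₜ c)) =
    a * Q.beta * (Q.antipode b * Q.alpha * c) := rfl

@[simp]
theorem betaAlphaMap_tmul' (a : H) (z : H ⊗[k] H) : betaAlphaMap k H (a ⊗ₜ z) =
    a * Q.beta * alphaMap k H z := rfl

@[simp]
theorem betaAlphaMap_reassociator : betaAlphaMap k H Φ = 1 := Q.antipode_reassociator

variable (k H) in
/-- The linear map `a ⊗ b ⊗ c ↦ S(a) α b β S(c)`, which sends `Φ⁻¹` to `1`. -/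
def alphaBetaMap : H ⊗[k] (H ⊗[k] H) →ₗ[k] H :=
  LinearMap.mul' k H ∘ₗ TensorProduct.map
    (LinearMap.mulRight k Q.alpha ∘ₗ Q.antipode.toLinearMap) (betaMap k H)

theorem alphaBetaMap_tmul (a : H) (z : H ⊗[k] H) : alphaBetaMap k H (a ⊗ₜ z) =
    Q.antipode a * Q.alpha * betaMap k H z := rfl

@[simp]
theorem alphaBetaMap_reassociator_inv : alphaBetaMap k H Φinv = 1 := Q.antipode_reassociator_inv

theorem betaAlphaMap_mul_left (a h : H) (z : H ⊗[k] (H ⊗[k] H)) :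
    betaAlphaMap k H (a ⊗ₜ Q.comul h * z) = Q.counit h • (a * betaAlphaMap k H z) := by
  induction z using TensorProduct.induction_on with
  | zero => simp
  | add x y hx hy => simp only [map_add, mul_add, smul_add, hx, hy]
  | tmul c d => simp [alphaMap_comul_mul, mul_assoc]

theorem betaAlphaMap_mul_right (c h : H) (z : H ⊗[k] (H ⊗[k] H)) :
    betaAlphaMap k H (z * assoc k k k H H H (Q.comul h ⊗ₜ c)) =
      Q.counit h • (betaAlphaMap k H z * c) := by
  have e : ∀ (w : H ⊗[k] H) (a b d : H),
      betaAlphaMap k H (a ⊗ₜ (b ⊗ₜ d) * assoc k k k H H H (w ⊗ₜ c)) =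
      a * betaMap k H w * (Q.antipode b * Q.alpha * (d * c)) := fun w a b d => by
    induction w using TensorProduct.induction_on with
    | zero => simp
    | add x y hx hy => simp only [map_add, mul_add, add_mul, TensorProduct.add_tmul, hx, hy]
    | tmul x y => simp [Q.antipode_mul, mul_assoc]
  induction z using tensor₃_induction with
  | zero => simp
  | add x y hx hy => simp only [map_add, mul_add, add_mul, smul_add, hx, hy]
  | tmul a b d => rw [e]; simp [mul_assoc]

theorem alphaBetaMap_mul_left (c h : H) (z : H ⊗[k] (H ⊗[k] H)) :
    alphaBetaMap k H (assoc k k k H H H (Q.comul h ⊗ₜ c) * z) =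
      Q.counit h • (alphaBetaMap k H z * Q.antipode c) := by
  have e : ∀ (w : H ⊗[k] H) (a b d : H),
      alphaBetaMap k H (assoc k k k H H H (w ⊗ₜ c) * a ⊗ₜ (b ⊗ₜ d)) =
      Q.antipode a * alphaMap k H w * (b * Q.beta * Q.antipode d * Q.antipode c) :=
    fun w a b d => by
    induction w using TensorProduct.induction_on with
    | zero => simp
    | add x y hx hy => simp only [map_add, mul_add, add_mul, TensorProduct.add_tmul, hx, hy]
    | tmul x y => simp [Q.antipode_mul, mul_assoc, alphaBetaMap_tmul]
  induction z using tensor₃_induction with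
  | zero => simp
  | add x y hx hy => simp only [map_add, mul_add, add_mul, smul_add, hx, hy]
  | tmul a b d => rw [e]; simp [mul_assoc, alphaBetaMap_tmul]

theorem alphaBetaMap_mul_right (a h : H) (z : H ⊗[k] (H ⊗[k] H)) :
    alphaBetaMap k H (z * a ⊗ₜ Q.comul h) = Q.counit h • (Q.antipode a * alphaBetaMap k H z) := by
  induction z using TensorProduct.induction_on with
  | zero => simp
  | add x y hx hy => simp only [map_add, add_mul, mul_add, smul_add, hx, hy]
  | tmul c d => simp [alphaBetaMap_tmul, betaMap_mul_comul, mul_assoc, Q.antipode_mul]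

end Antipode

end AntipodeIdentities

section AntipodeIdentities

-- Instances on fourfold tensor powers need a larger search.
set_option synthInstance.maxSize 2000
set_option maxSynthPendingDepth 6
set_option synthInstance.maxHeartbeats 400000

open scoped TensorProduct
open Algebra.TensorProduct (map assoc includeLeft)

variable {k H : Type u} [Field k] [Ring H] [Algebra k H]

section Antipode

variable [Q : QuasiHopfAlgebra k H]

local notation "Φ" => (Q.reassociator : H ⊗[k] (H ⊗[k] H))
local notation "Φinv" => ((Q.reassociator⁻¹ : (H ⊗[k] (H ⊗[k] H))ˣ) : H ⊗[k] (H ⊗[k] H))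

theorem map_betaAlphaMap_mul_left (P : H ⊗[k] (H ⊗[k] H)) (z : H ⊗[k] (H ⊗[k] (H ⊗[k] H))) :
    TensorProduct.map LinearMap.id (betaAlphaMap k H) (map (.id k H) (map (.id k H) Q.comul) P * z) =
      map (.id k H) ((Algebra.TensorProduct.rid k k H).toAlgHom.comp (map (.id k H) Q.counit)) P *
        TensorProduct.map LinearMap.id (betaAlphaMap k H) z := by
  induction P using tensor₃_induction with
  | zero => simp
  | add x y hx hy => simp only [map_add, add_mul, hx, hy]
  | tmul a b h =>
    induction z using TensorProduct.induction_on with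
    | zero => simp
    | add x y hx hy => simp only [map_add, mul_add, hx, hy]
    | tmul c y => simp [betaAlphaMap_mul_left]

theorem map_betaAlphaMap_mul_right (P : H ⊗[k] (H ⊗[k] H)) (z : H ⊗[k] (H ⊗[k] (H ⊗[k] H))) :
    TensorProduct.map LinearMap.id (betaAlphaMap k H)
      (z * map (.id k H) ((assoc k k k H H H).toAlgHom.comp (map Q.comul (.id k H))) P) =
      TensorProduct.map LinearMap.id (betaAlphaMap k H) z *
        map (.id k H) ((Algebra.TensorProduct.lid k H).toAlgHom.comp (map Q.counit (.id k H))) P := by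
  induction P using tensor₃_induction with
  | zero => simp
  | add x y hx hy => simp only [map_add, mul_add, hx, hy]
  | tmul a h b =>
    induction z using TensorProduct.induction_on with
    | zero => simp
    | add x y hx hy => simp only [map_add, add_mul, hx, hy]
    | tmul c y => simp [betaAlphaMap_mul_right]

theorem map_betaAlphaMap_comulL_mul (X z : H ⊗[k] (H ⊗[k] H)) :
    TensorProduct.map LinearMap.id (betaAlphaMap k H) (comulL X * tmulOne z) =
      LinearMap.mul' k (H ⊗[k] H) (TensorProduct.map
        (LinearMap.mulRight k (TensorProduct.map LinearMap.id (betaMap k H) z) ∘ₗ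
          Q.comul.toLinearMap)
        (Algebra.TensorProduct.includeRight.toLinearMap ∘ₗ alphaMap k H) X) := by
  have e : ∀ (u : H ⊗[k] H) (b c : H) (z : H ⊗[k] (H ⊗[k] H)),
      TensorProduct.map LinearMap.id (betaAlphaMap k H)
        (assoc k k k H H (H ⊗[k] H) (u ⊗ₜ (b ⊗ₜ c)) * tmulOne z) =
      u * TensorProduct.map LinearMap.id (betaMap k H) z * (1 ⊗ₜ alphaMap k H (b ⊗ₜ c)) := by
    intro u b c z
    simp only [tmulOne]
    induction u using TensorProduct.induction_on with
    | zero => simp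
    | add x y hx hy => simp only [TensorProduct.add_tmul, map_add, add_mul, hx, hy]
    | tmul u v =>
      induction z using tensor₃_induction with
      | zero => simp
      | add x y hx hy => simp only [TensorProduct.add_tmul, map_add, mul_add, add_mul, hx, hy]
      | tmul x y z => simp [Q.antipode_mul, mul_assoc]
  simp only [comulL, tmulOne] at *
  induction X using tensor₃_induction with
  | zero => simp
  | add x y hx hy => simp only [map_add, add_mul, hx, hy]
  | tmul a b c => exact e (Q.comul a) b c z

/-- `Δ(X¹) (x¹ ⊗ x² β S(x³)) (1 ⊗ S(X²) α X³) = 1 ⊗ 1`, from the pentagon. This is one of the two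
zigzag identities of the adjunction between `⊗` and the internal hom. -/
theorem comul_mul_pElem_mul_alphaMap :
    LinearMap.mul' k (H ⊗[k] H) (TensorProduct.map
      (LinearMap.mulRight k (pElem k H) ∘ₗ Q.comul.toLinearMap)
      (Algebra.TensorProduct.includeRight.toLinearMap ∘ₗ alphaMap k H) Φ) = 1 := by
  rw [pElem, ← map_betaAlphaMap_comulL_mul, comulL_mul_tmulOne_inv, map_betaAlphaMap_mul_left,
    counit_right_reassociator_inv, one_mul, map_betaAlphaMap_mul_right, Q.counit_reassociator,
    mul_one, TensorProduct.map_tmul, betaAlphaMap_reassociator]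
  rfl

theorem map_alphaBetaMap_tmulOne_mul (X z : H ⊗[k] (H ⊗[k] H)) :
    TensorProduct.map LinearMap.id (alphaBetaMap k H) (tmulOne z * comulL X) =
      TensorProduct.map LinearMap.id (alphaMap k H) (z * assoc k k k H H H
        (TensorProduct.map Q.comul.toLinearMap (betaMap k H) X)) := by
  have e : ∀ (u : H ⊗[k] H) (b c : H),
      TensorProduct.map LinearMap.id (alphaBetaMap k H)
        (tmulOne z * assoc k k k H H (H ⊗[k] H) (u ⊗ₜ (b ⊗ₜ c))) =
      TensorProduct.map LinearMap.id (alphaMap k H) (z * assoc k k k H H H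
        (u ⊗ₜ betaMap k H (b ⊗ₜ c))) := by
    intro u b c
    simp only [tmulOne]
    induction u using TensorProduct.induction_on with
    | zero => simp
    | add x y hx hy => simp only [TensorProduct.add_tmul, map_add, mul_add, hx, hy]
    | tmul u v =>
      induction z using tensor₃_induction with
      | zero => simp
      | add x y hx hy => simp only [TensorProduct.add_tmul, map_add, add_mul, hx, hy]
      | tmul x y z => simp [Q.antipode_mul, mul_assoc, alphaBetaMap_tmul]
  simp only [comulL, tmulOne] at *
  induction X using tensor₃_induction with
  | zero => simp
  | add x y hx hy => simp only [map_add, mul_add, hx, hy]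
  | tmul a b c => exact e (Q.comul a) b c

/-- `X¹ p¹₁ ⊗ S(X² p¹₂) α X³ p² = 1 ⊗ 1`, where `p = x¹ ⊗ x² β S(x³)`. This is the other zigzag
identity of the adjunction between `⊗` and the internal hom. -/
theorem map_alphaMap_mul_comul_pElem :
    TensorProduct.map LinearMap.id (alphaMap k H) (Φ * assoc k k k H H H
      (map Q.comul (.id k H) (pElem k H))) = 1 := by
  have e : map Q.comul (.id k H) (pElem k H) =
      TensorProduct.map Q.comul.toLinearMap (betaMap k H) Φinv :=
    map_map' _ _ _ _ _
  have left : ∀ (P : H ⊗[k] (H ⊗[k] H)) (z : H ⊗[k] (H ⊗[k] H)),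
      alphaBetaMap k H z = 1 →
      TensorProduct.map LinearMap.id (alphaBetaMap k H)
        (map (.id k H) ((assoc k k k H H H).toAlgHom.comp (map Q.comul (.id k H))) P *
          (oneTmul k H z * map (.id k H) (map (.id k H) Q.comul) Φ)) =
      TensorProduct.map LinearMap.id Q.antipode.toLinearMap
        (map (.id k H) ((Algebra.TensorProduct.lid k H).toAlgHom.comp
          (map Q.counit (.id k H))) P) := by
    intro P z hz
    have right : ∀ (y : H ⊗[k] (H ⊗[k] H)) (a h c : H),
        TensorProduct.map LinearMap.id (alphaBetaMap k H)
          (map (.id k H) ((assoc k k k H H H).toAlgHom.comp (map Q.comul (.id k H)))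
            (a ⊗ₜ (h ⊗ₜ c)) * (oneTmul k H z * map (.id k H) (map (.id k H) Q.comul) y)) =
        Q.counit h • ((a ⊗ₜ 1) * TensorProduct.map LinearMap.id Q.antipode.toLinearMap
          (map (.id k H) ((Algebra.TensorProduct.rid k k H).toAlgHom.comp
            (map (.id k H) Q.counit)) y) * (1 ⊗ₜ Q.antipode c)) := by
      intro y a h c
      simp only [oneTmul]
      induction y using tensor₃_induction with
      | zero => simp
      | add x y hx hy => simp only [map_add, mul_add, add_mul, smul_add, hx, hy]
      | tmul d e f => simp [alphaBetaMap_mul_left, alphaBetaMap_mul_right, hz]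
    induction P using tensor₃_induction with
    | zero => simp
    | add x y hx hy => simp only [map_add, add_mul, hx, hy]
    | tmul a h c =>
      rw [right, counit_right_reassociator, Algebra.TensorProduct.one_def]
      simp [Q.antipode_one]
  rw [e, ← map_alphaBetaMap_tmulOne_mul, tmulOne_mul_comulL_inv,
    left _ _ alphaBetaMap_reassociator_inv, counit_reassociator_inv,
    Algebra.TensorProduct.one_def]
  simp [Q.antipode_one]

variable (k H) in
/-- The linear map `a ⊗ b ⊗ c ⊗ d ↦ a β S(b) α c ⊗ d`. -/
def betaAlphaMapL : H ⊗[k] (H ⊗[k] (H ⊗[k] H)) →ₗ[k] H ⊗[k] H :=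
  TensorProduct.map (LinearMap.mul' k H) LinearMap.id ∘ₗ
    (TensorProduct.assoc k H H H).symm.toLinearMap ∘ₗ
    TensorProduct.map (LinearMap.mulRight k Q.beta)
      (TensorProduct.map (alphaMap k H) LinearMap.id ∘ₗ
        (TensorProduct.assoc k H H H).symm.toLinearMap)

@[simp]
theorem betaAlphaMapL_tmul (a b c d : H) : betaAlphaMapL k H (a ⊗ₜ (b ⊗ₜ (c ⊗ₜ d))) =
    (a * Q.beta * (Q.antipode b * Q.alpha * c)) ⊗ₜ d := rfl

/-- `X¹ β S(y¹ X²) α y² X³₁ ⊗ y³ X³₂ = 1 ⊗ 1`, where `Φ⁻¹ = y¹ ⊗ y² ⊗ y³`. It says that the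
contraction with `α`, applied to the first factor of a tensor product, undoes the insertion of
`β`. -/
theorem betaAlphaMapL_oneTmul_mul :
    betaAlphaMapL k H (oneTmul k H Φinv * map (.id k H) (map (.id k H) Q.comul) Φ) = 1 := by
  have left : ∀ (P : H ⊗[k] (H ⊗[k] H)) (z : H ⊗[k] (H ⊗[k] (H ⊗[k] H))),
      betaAlphaMapL k H
        (map (.id k H) ((assoc k k k H H H).toAlgHom.comp (map Q.comul (.id k H))) P * z) =
      map (.id k H) ((Algebra.TensorProduct.lid k H).toAlgHom.comp (map Q.counit (.id k H))) P *
        betaAlphaMapL k H z := by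
    intro P z
    have e : ∀ (w : H ⊗[k] H) (a b c d x y : H), betaAlphaMapL k H
        ((x ⊗ₜ assoc k k k H H H (w ⊗ₜ y)) * (a ⊗ₜ (b ⊗ₜ (c ⊗ₜ d)))) =
        (x * a * Q.beta * Q.antipode b * alphaMap k H w * c) ⊗ₜ (y * d) := by
      intro w a b c d x y
      induction w using TensorProduct.induction_on with
      | zero => simp
      | add x y hx hy => simp only [TensorProduct.add_tmul, TensorProduct.tmul_add, map_add,
          mul_add, add_mul, hx, hy]
      | tmul u v => simp [Q.antipode_mul, mul_assoc]
    induction P using tensor₃_induction with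
    | zero => simp
    | add x y hx hy => simp only [map_add, add_mul, hx, hy]
    | tmul x h y =>
      induction z using tensor₄_induction with
      | zero => simp
      | add x y hx hy => simp only [map_add, mul_add, hx, hy]
      | tmul a b c d =>
        refine (e (Q.comul h) a b c d x y).trans ?_
        simp [mul_assoc, TensorProduct.smul_tmul']
  have right : ∀ (P : H ⊗[k] (H ⊗[k] H)) (z : H ⊗[k] (H ⊗[k] (H ⊗[k] H))),
      betaAlphaMapL k H (z * comulL P) = betaAlphaMapL k H z *
        Algebra.TensorProduct.lid k (H ⊗[k] H) (map Q.counit (.id k (H ⊗[k] H)) P) := by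
    intro P z
    have e : ∀ (w : H ⊗[k] H) (a b c d x y : H), betaAlphaMapL k H
        ((a ⊗ₜ (b ⊗ₜ (c ⊗ₜ d))) * assoc k k k H H (H ⊗[k] H) (w ⊗ₜ (x ⊗ₜ y))) =
        (a * betaMap k H w * Q.antipode b * Q.alpha * c * x) ⊗ₜ (d * y) := by
      intro w a b c d x y
      induction w using TensorProduct.induction_on with
      | zero => simp
      | add x y hx hy => simp only [TensorProduct.add_tmul, map_add,
          mul_add, add_mul, hx, hy]
      | tmul u v => simp [Q.antipode_mul, mul_assoc]
    simp only [comulL]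
    induction P using tensor₃_induction with
    | zero => simp
    | add x y hx hy => simp only [map_add, mul_add, hx, hy]
    | tmul h x y =>
      induction z using tensor₄_induction with
      | zero => simp
      | add x y hx hy => simp only [map_add, add_mul, hx, hy]
      | tmul a b c d =>
        refine (e (Q.comul h) a b c d x y).trans ?_
        simp [mul_assoc, TensorProduct.smul_tmul']
  have mid : ∀ z : H ⊗[k] (H ⊗[k] H), betaAlphaMapL k H (tmulOne z) = betaAlphaMap k H z ⊗ₜ 1 := by
    intro z
    simp only [tmulOne]
    induction z using tensor₃_induction with
    | zero => simp
    | add x y hx hy => simp only [TensorProduct.add_tmul, map_add, hx, hy]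
    | tmul x h y => simp
  rw [oneTmul_inv_mul_comul, left, Q.counit_reassociator, one_mul, right,
    counit_left_reassociator_inv, mul_one, mid, betaAlphaMap_reassociator]
  rfl

end Antipode

end AntipodeIdentities

/-! ### The internal hom of two modules -/

section InternalHom

open MonoidalCategory
open scoped TensorProduct
open Algebra.TensorProduct (map assoc)

variable {k H : Type u} [Field k] [Ring H] [Algebra k H]

section Linear

variable (V Y : HMod k H)

/-- The action of `H` on `Hom_k(V, Y)` through `Y`. -/
def postAct : H →ₐ[k] Module.End k (V →ₗ[k] Y) :=
  .ofLinearMap (LinearMap.llcomp k V Y Y ∘ₗ Y.act.toLinearMap)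
    (by ext; simp) (by intro a b; ext; simp)

@[simp]
theorem postAct_apply (a : H) (F : V →ₗ[k] Y) (v : V) : postAct V Y a F v = Y.act a (F v) := rfl

/-- For `z = a ⊗ b`, the map `F ⊗ v ↦ a • F (b • v)`. -/
def evalAt (z : H ⊗[k] H) : (V →ₗ[k] Y) ⊗[k] V →ₗ[k] Y :=
  TensorProduct.lift LinearMap.id ∘ₗ tensorAct (postAct V Y) V.act z

@[simp]
theorem evalAt_tmul (a b : H) (F : V →ₗ[k] Y) (v : V) :
    evalAt V Y (a ⊗ₜ b) (F ⊗ₜ v) = Y.act a (F (V.act b v)) := rfl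

@[simp]
theorem evalAt_add (x y : H ⊗[k] H) : evalAt V Y (x + y) = evalAt V Y x + evalAt V Y y := by
  rw [evalAt, map_add, LinearMap.comp_add]; rfl

@[simp]
theorem evalAt_zero : evalAt V Y 0 = 0 := by
  rw [evalAt, map_zero, LinearMap.comp_zero]

theorem evalAt_one (F : V →ₗ[k] Y) (v : V) : evalAt V Y 1 (F ⊗ₜ v) = F v := by
  rw [Algebra.TensorProduct.one_def, evalAt_tmul]; simp

theorem evalAt_mul (a : H) (z : H ⊗[k] H) (t : (V →ₗ[k] Y) ⊗[k] V) :
    evalAt V Y (a ⊗ₜ 1 * z) t = Y.act a (evalAt V Y z t) := by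
  induction t using TensorProduct.induction_on with
  | zero => simp
  | add x y hx hy => simp only [map_add, hx, hy]
  | tmul F v =>
    induction z using TensorProduct.induction_on with
    | zero => simp
    | add x y hx hy => simp only [mul_add, evalAt_add, LinearMap.add_apply, map_add, hx, hy]
    | tmul b c => simp

end Linear

variable [Q : QuasiHopfAlgebra k H]

local notation "Φ" => (Q.reassociator : H ⊗[k] (H ⊗[k] H))
local notation "Φinv" => ((Q.reassociator⁻¹ : (H ⊗[k] (H ⊗[k] H))ˣ) : H ⊗[k] (H ⊗[k] H))

/-- The action of `H ⊗ H` on `Hom_k(V, Y)`: `((a ⊗ b) F) v = a • F (S(b) • v)`. -/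
def homAct (V Y : HMod k H) : H ⊗[k] H →ₐ[k] Module.End k (V →ₗ[k] Y) :=
  Algebra.TensorProduct.lift (postAct V Y)
    (.ofLinearMap ((LinearMap.llcomp k V V Y).flip ∘ₗ V.act.toLinearMap ∘ₗ Q.antipode.toLinearMap)
      (by ext; simp [Q.antipode_one]) (by intro a b; ext; simp [Q.antipode_mul]))
    (fun a b => by ext; simp)

@[simp]
theorem homAct_tmul (V Y : HMod k H) (a b : H) (F : V →ₗ[k] Y) (v : V) :
    homAct V Y (a ⊗ₜ b) F v = Y.act a (F (V.act (Q.antipode b) v)) := rfl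

/-- The internal hom `Hom_k(V, Y)`, with the action `(h F) v = h₁ • F (S(h₂) • v)`. -/
abbrev ihom (V Y : HMod k H) : HMod k H where
  carrier := V →ₗ[k] Y
  act := (homAct V Y).comp Q.comul

theorem evalAt_homAct (V Y : HMod k H) (x : H ⊗[k] (H ⊗[k] H)) (w : (H ⊗[k] H) ⊗[k] H)
    (t : (V →ₗ[k] Y) ⊗[k] V) :
    evalAt V Y (TensorProduct.map LinearMap.id (alphaMap k H) x)
        (tensorAct (homAct V Y) V.act w t) =
      evalAt V Y (TensorProduct.map LinearMap.id (alphaMap k H) (x * assoc k k k H H H w)) t := by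
  induction w using TensorProduct.induction_on with
  | zero => simp
  | add x y hx hy => simp only [map_add, mul_add, LinearMap.add_apply, evalAt_add, hx, hy]
  | tmul w c =>
    induction w using TensorProduct.induction_on with
    | zero => simp
    | add x y hx hy =>
      simp only [TensorProduct.add_tmul, map_add, mul_add, LinearMap.add_apply, evalAt_add, hx, hy]
    | tmul a b =>
      induction x using tensor₃_induction with
      | zero => simp
      | add x y hx hy => simp only [map_add, add_mul, LinearMap.add_apply, evalAt_add, hx, hy]
      | tmul d e f =>
        induction t using TensorProduct.induction_on with
        | zero => simp
        | add x y hx hy => simp only [map_add, hx, hy]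
        | tmul F v => simp [Q.antipode_mul]

theorem map_alphaMap_comul_mul (w : H ⊗[k] H) (x : H ⊗[k] (H ⊗[k] H)) :
    TensorProduct.map LinearMap.id (alphaMap k H) (map (.id k H) Q.comul w * x) =
      (Algebra.TensorProduct.rid k k H (map (.id k H) Q.counit w) ⊗ₜ 1) *
        TensorProduct.map LinearMap.id (alphaMap k H) x := by
  induction w using TensorProduct.induction_on with
  | zero => simp
  | add x y hx hy => simp only [TensorProduct.add_tmul, map_add, add_mul, hx, hy]
  | tmul c d =>
    induction x using TensorProduct.induction_on with
    | zero => simp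
    | add x y hx hy => simp only [map_add, mul_add, hx, hy]
    | tmul e y => simp [alphaMap_comul_mul, TensorProduct.smul_tmul]

variable (k H) in
/-- The element `q = X¹ ⊗ S(X²) α X³`. -/
def qElem : H ⊗[k] H := TensorProduct.map LinearMap.id (alphaMap k H) Φ

/-- The evaluation is linear over `H`: by quasi-coassociativity, `Δ(h)` on both factors becomes the
action of `h₁` on the value, times `S(h₂₁) α h₂₂ = ε(h₂) α`. -/
theorem evalAt_act (V Y : HMod k H) (h : H) (t : (V →ₗ[k] Y) ⊗[k] V) :
    evalAt V Y (qElem k H) (tensorAct (ihom V Y).act V.act (Q.comul h) t) =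
      Y.act h (evalAt V Y (qElem k H) t) := by
  have e := tensorAct_comp (ρ := homAct V Y) (σ := V.act) Q.comul (.id k H) (Q.comul h)
  rw [AlgHom.comp_id] at e
  have e' : map (.id k H) Q.comul (Q.comul h) * Φ =
      Φ * assoc k k k H H H (map Q.comul (.id k H) (Q.comul h)) := by
    rw [Q.quasi_coassoc h, Units.inv_mul_cancel_right]
  change evalAt V Y (qElem k H) (tensorAct ((homAct V Y).comp Q.comul) V.act (Q.comul h) t) = _
  rw [e, qElem, evalAt_homAct, ← e', map_alphaMap_comul_mul, Q.counit_right, evalAt_mul]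

/-- The evaluation `F ⊗ v ↦ X¹ • F (S(X²) α X³ • v)`. -/
def ihomEv (V Y : HMod k H) : ihom V Y ⊗ V ⟶ Y where
  lin := evalAt V Y (qElem k H)
  map_act h t := evalAt_act V Y h t

section Curry

theorem homAct_apply (V Y : HMod k H) (z : H ⊗[k] H) (F : V →ₗ[k] Y) (v : V) :
    homAct V Y z F v =
      evalAt V Y (TensorProduct.map LinearMap.id Q.antipode.toLinearMap z) (F ⊗ₜ v) := by
  induction z using TensorProduct.induction_on with
  | zero => simp
  | add x y hx hy => simp only [map_add, LinearMap.add_apply, evalAt_add, hx, hy]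
  | tmul a b => simp

variable {V W Y : HMod k H}

theorem evalAt_curry {e : W ⊗[k] V →ₗ[k] Y}
    (he : ∀ h t, e (tensorAct W.act V.act (Q.comul h) t) = Y.act h (e t)) (x z : H ⊗[k] H)
    (w : W) (v : V) :
    evalAt V Y z (TensorProduct.curry (e ∘ₗ tensorAct W.act V.act x) w ⊗ₜ v) =
      e (tensorAct W.act V.act (LinearMap.mul' k (H ⊗[k] H) (TensorProduct.map
        (LinearMap.mulRight k x ∘ₗ Q.comul.toLinearMap)
        Algebra.TensorProduct.includeRight.toLinearMap z)) (w ⊗ₜ v)) := by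
  induction z using TensorProduct.induction_on with
  | zero => simp
  | add x y hx hy => simp only [map_add, LinearMap.add_apply, evalAt_add, hx, hy]
  | tmul a b => simp [← he]

theorem curry_act_aux {e : W ⊗[k] V →ₗ[k] Y}
    (he : ∀ h t, e (tensorAct W.act V.act (Q.comul h) t) = Y.act h (e t)) (h : H) (w : W) :
    TensorProduct.curry (e ∘ₗ tensorAct W.act V.act (pElem k H)) (W.act h w) =
      homAct V Y (Q.comul h)
        (TensorProduct.curry (e ∘ₗ tensorAct W.act V.act (pElem k H)) w) := by
  refine LinearMap.ext fun v => ?_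
  have key : ∀ z : H ⊗[k] H, LinearMap.mul' k (H ⊗[k] H) (TensorProduct.map
      (LinearMap.mulRight k (pElem k H) ∘ₗ Q.comul.toLinearMap)
      Algebra.TensorProduct.includeRight.toLinearMap
        (TensorProduct.map LinearMap.id Q.antipode.toLinearMap z)) =
      TensorProduct.map LinearMap.id (betaMap k H)
        (assoc k k k H H H (map Q.comul (.id k H) z) * Φinv) := by
    intro z
    induction z using TensorProduct.induction_on with
    | zero => simp
    | add x y hx hy => simp only [map_add, add_mul, hx, hy]
    | tmul a b =>
      rw [Algebra.TensorProduct.map_tmul, map_betaMap_assoc_mul]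
      simp [pElem]
  rw [homAct_apply, evalAt_curry he, key, ← pElem_mul, map_mul]
  simp

/-- The morphism `W ⟶ Hom_k(V, Y)` that corresponds to `e : W ⊗ V ⟶ Y`:
`w ↦ (v ↦ e (p¹ • w ⊗ p² • v))` with `p = x¹ ⊗ x² β S(x³)`. -/
def curry (e : W ⊗ V ⟶ Y) : W ⟶ ihom V Y where
  lin := TensorProduct.curry (M := W) (N := V)
    ((show W ⊗[k] V →ₗ[k] Y from e.lin) ∘ₗ tensorAct W.act V.act (pElem k H))
  map_act h w := curry_act_aux (fun h t => e.map_act h t) h w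

/-- The morphism `W ⊗ V ⟶ Y` that corresponds to `j : W ⟶ Hom_k(V, Y)`. -/
def uncurry (j : W ⟶ ihom V Y) : W ⊗ V ⟶ Y := j ▷ V ≫ ihomEv V Y

theorem uncurry_curry (e : W ⊗ V ⟶ Y) : uncurry (curry e) = e := by
  refine HMod.tensor_ext fun w v => ?_
  refine (evalAt_curry (fun h t => e.map_act h t) (pElem k H) (qElem k H) w v).trans ?_
  have h : LinearMap.mul' k (H ⊗[k] H) (TensorProduct.map
      (LinearMap.mulRight k (pElem k H) ∘ₗ Q.comul.toLinearMap)
      Algebra.TensorProduct.includeRight.toLinearMap (qElem k H)) = 1 := by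
    rw [← comul_mul_pElem_mul_alphaMap (k := k) (H := H), qElem, map_map', LinearMap.comp_id]
  rw [h, map_one]; rfl

theorem evalAt_act_curry (j : W →ₗ[k] (V →ₗ[k] Y))
    (hj : ∀ h w, j (W.act h w) = homAct V Y (Q.comul h) (j w)) (t : W ⊗[k] V) :
    evalAt V Y (qElem k H) (TensorProduct.map j LinearMap.id
      (tensorAct W.act V.act (pElem k H) t)) = TensorProduct.lift j t := by
  have h1 := tensorAct_natural (ρ := W.act) (σ := V.act) (ρ' := homAct V Y) (σ' := V.act) (f := j)
    (g := LinearMap.id) (p := Q.comul) (q := .id k H) hj (fun _ _ => rfl) (pElem k H) t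
  rw [h1, qElem, evalAt_homAct, map_alphaMap_mul_comul_pElem]
  clear h1
  induction t using TensorProduct.induction_on with
  | zero => simp
  | add x y hx hy => simp only [map_add, hx, hy]
  | tmul w v => simp [evalAt_one]

theorem curry_uncurry (j : W ⟶ ihom V Y) : curry (uncurry j) = j :=
  HMod.hom_ext fun w => LinearMap.ext fun v =>
    evalAt_act_curry (V := V) (Y := Y) j.lin j.map_act (w ⊗ₜ v)

theorem uncurry_injective {j j' : W ⟶ ihom V Y} (h : uncurry j = uncurry j') : j = j' := by
  rw [← curry_uncurry j, h, curry_uncurry]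

end Curry
end InternalHom

/-! ### The Drinfeld twist -/

section DrinfeldTwist

open MonoidalCategory
open scoped TensorProduct
open Algebra.TensorProduct (map assoc)

theorem regular_tensorAct_one {k H : Type u} [Field k] [Ring H] [Algebra k H] (x : H ⊗[k] H) :
    tensorAct (Algebra.lmul k H) (Algebra.lmul k H) x (1 ⊗ₜ 1) = x := by
  induction x using TensorProduct.induction_on with
  | zero => simp
  | add x y hx hy => simp only [map_add, LinearMap.add_apply, hx, hy]
  | tmul a b => simp

variable {k H : Type u} [Field k] [Ring H] [Algebra k H] [Q : QuasiHopfAlgebra k H]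

local notation "Φ" => (Q.reassociator : H ⊗[k] (H ⊗[k] H))
local notation "Φinv" => ((Q.reassociator⁻¹ : (H ⊗[k] (H ⊗[k] H))ˣ) : H ⊗[k] (H ⊗[k] H))

variable (k H) in
/-- The trivial module `k`. It is the unit object, in a form whose carrier is reducibly `k`. -/
abbrev trivialMod : HMod k H where
  carrier := k
  act := (Algebra.lmul k k).comp Q.counit

/-- The dual module `Hom_k(V, k)`. -/
abbrev dual (V : HMod k H) : HMod k H := ihom V (trivialMod k H)

/-- The evaluation `φ ⊗ v ↦ φ (α • v)`. -/
def dualEv (V : HMod k H) : dual V ⊗ V ⟶ 𝟙_ (HMod k H) := ihomEv V (trivialMod k H)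

/-- The action on the dual is `(h φ) v = φ (S(h) • v)`. -/
theorem dual_act (V : HMod k H) (h : H) (φ : V →ₗ[k] k) :
    (dual V).act h φ = φ ∘ₗ V.act (Q.antipode h) := by
  have : ∀ z : H ⊗[k] H, homAct V (trivialMod k H) z φ = φ ∘ₗ V.act (Q.antipode
      (Algebra.TensorProduct.lid k H (map Q.counit (.id k H) z))) := by
    intro z
    induction z using TensorProduct.induction_on with
    | zero => simp
    | add x y hx hy => simp only [map_add, LinearMap.add_apply, hx, hy, LinearMap.comp_add]
    | tmul a b => ext v; simp; rfl
  have h1 := this (Q.comul h)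
  rwa [Q.counit_left] at h1

theorem evalAt_trivialMod (V : HMod k H) (t : (V →ₗ[k] k) ⊗[k] V) :
    evalAt V (trivialMod k H) (qElem k H) t =
      TensorProduct.lift LinearMap.id (TensorProduct.map LinearMap.id (V.act Q.alpha) t) := by
  have : ∀ z : H ⊗[k] (H ⊗[k] H), evalAt V (trivialMod k H)
      (TensorProduct.map LinearMap.id (alphaMap k H) z) t =
      TensorProduct.lift LinearMap.id (TensorProduct.map LinearMap.id
        (V.act (alphaMap k H (Algebra.TensorProduct.lid k (H ⊗[k] H)
        (map Q.counit (.id k (H ⊗[k] H)) z)))) t) := by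
    intro z
    induction z using TensorProduct.induction_on with
    | zero => simp
    | add x y hx hy =>
      simp only [map_add, evalAt_add, LinearMap.add_apply, hx, hy, TensorProduct.map_add_right]
    | tmul a b =>
      induction t using TensorProduct.induction_on with
      | zero => simp
      | add x y hx hy => simp only [map_add, hx, hy]
      | tmul φ v => simp; rfl
  have h1 := this Φ
  rwa [counit_left_reassociator, Algebra.TensorProduct.one_def, alphaMap_tmul, Q.antipode_one,
    one_mul, mul_one] at h1

variable (k H) in
/-- The map `h ↦ S(h₂) ⊗ S(h₁)`. -/
def antipodeComul : H →ₗ[k] H ⊗[k] H :=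
  (TensorProduct.comm k H H).toLinearMap ∘ₗ
    TensorProduct.map Q.antipode.toLinearMap Q.antipode.toLinearMap ∘ₗ Q.comul.toLinearMap

section Pairing

variable (M N : HMod k H)

theorem lift_homAct (z : H ⊗[k] H) (G : M →ₗ[k] (N →ₗ[k] k)) (t : M ⊗[k] N) :
    TensorProduct.lift (homAct M (dual N) z G) t =
      TensorProduct.lift G (tensorAct M.act N.act (TensorProduct.comm k H H
        (TensorProduct.map Q.antipode.toLinearMap Q.antipode.toLinearMap z)) t) := by
  induction t using TensorProduct.induction_on with
  | zero => simp
  | add x y hx hy => simp only [map_add, hx, hy]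
  | tmul m n =>
    induction z using TensorProduct.induction_on with
    | zero => simp
    | add x y hx hy =>
      simp only [TensorProduct.lift.tmul, map_add, LinearMap.add_apply] at hx hy ⊢
      rw [hx, hy]
    | tmul a b =>
      exact congrArg (fun f : N →ₗ[k] k => f n) (dual_act N a (G (M.act (Q.antipode b) m)))

theorem lift_ihom_act (h : H) (G : M →ₗ[k] (N →ₗ[k] k)) (t : M ⊗[k] N) :
    TensorProduct.lift ((ihom M (dual N)).act h G) t =
      TensorProduct.lift G (tensorAct M.act N.act (antipodeComul k H h) t) :=
  lift_homAct M N (Q.comul h) G t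

theorem evalAt_dual (z : H ⊗[k] H) (G : M →ₗ[k] (N →ₗ[k] k)) (m : M) (n : N) :
    evalAt M (dual N) z (G ⊗ₜ m) n =
      TensorProduct.lift G (tensorAct M.act N.act (TensorProduct.comm k H H
        (TensorProduct.map Q.antipode.toLinearMap LinearMap.id z)) (m ⊗ₜ n)) := by
  induction z using TensorProduct.induction_on with
  | zero => simp
  | add x y hx hy => simp only [map_add, evalAt_add, LinearMap.add_apply, hx, hy]
  | tmul a b => exact congrArg (fun f : N →ₗ[k] k => f n) (dual_act N a (G (M.act b m)))

/-- The twofold evaluation `Hom(M, Hom(N, k)) ⊗ (M ⊗ N) → k`, rebracketed without `Φ`. -/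
def evalEval : (M →ₗ[k] (N →ₗ[k] k)) ⊗[k] (M ⊗[k] N) →ₗ[k] k :=
  evalAt N (trivialMod k H) (qElem k H) ∘ₗ
    TensorProduct.map (evalAt M (dual N) (qElem k H)) LinearMap.id ∘ₗ
    (TensorProduct.assoc k (M →ₗ[k] (N →ₗ[k] k)) M N).symm.toLinearMap

end Pairing

/-- The morphism `Hom(M, Hom(N, k)) ⟶ Hom(M ⊗ N, k)` of the adjunction. -/
def dualTensorInv (M N : HMod k H) : ihom M (dual N) ⟶ dual (M ⊗ N) :=
  curry ((α_ (ihom M (dual N)) M N).inv ≫ ihomEv M (dual N) ▷ N ≫ dualEv N)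

/-- The morphism `Hom(M ⊗ N, k) ⟶ Hom(M, Hom(N, k))` of the adjunction. -/
def dualTensor (M N : HMod k H) : dual (M ⊗ N) ⟶ ihom M (dual N) :=
  curry (curry ((α_ (dual (M ⊗ N)) M N).hom ≫ dualEv (M ⊗ N)))

theorem uncurry_dualTensorInv (M N : HMod k H) : dualTensorInv M N ▷ (M ⊗ N) ≫ dualEv (M ⊗ N) =
    (α_ (ihom M (dual N)) M N).inv ≫ ihomEv M (dual N) ▷ N ≫ dualEv N :=
  uncurry_curry (Y := trivialMod k H)
    ((α_ (ihom M (dual N)) M N).inv ≫ ihomEv M (dual N) ▷ N ≫ dualEv N)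

theorem uncurry_dualTensor (M N : HMod k H) :
    (dualTensor M N ▷ M ≫ ihomEv M (dual N)) ▷ N ≫ dualEv N =
    (α_ (dual (M ⊗ N)) M N).hom ≫ dualEv (M ⊗ N) := by
  have h1 : dualTensor M N ▷ M ≫ ihomEv M (dual N) = _ :=
    uncurry_curry (curry (Y := trivialMod k H) ((α_ (dual (M ⊗ N)) M N).hom ≫ dualEv (M ⊗ N)))
  rw [h1]
  exact uncurry_curry (Y := trivialMod k H) ((α_ (dual (M ⊗ N)) M N).hom ≫ dualEv (M ⊗ N))

theorem dual_hom_ext {W V : HMod k H} {f g : W ⟶ dual V}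
    (h : f ▷ V ≫ dualEv V = g ▷ V ≫ dualEv V) : f = g :=
  uncurry_injective h

theorem ihom_hom_ext {W V Y : HMod k H} {f g : W ⟶ ihom V Y}
    (h : f ▷ V ≫ ihomEv V Y = g ▷ V ≫ ihomEv V Y) : f = g :=
  uncurry_injective h

theorem dualTensorInv_comp (M N : HMod k H) : dualTensorInv M N ≫ dualTensor M N = 𝟙 _ := by
  apply ihom_hom_ext
  apply dual_hom_ext
  rw [comp_whiskerRight (dualTensorInv M N), Category.assoc,
    comp_whiskerRight (dualTensorInv M N ▷ M), Category.assoc,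
    uncurry_dualTensor, ← Category.assoc, associator_naturality_left, Category.assoc,
    uncurry_dualTensorInv, Iso.hom_inv_id_assoc, id_whiskerRight, Category.id_comp]

theorem dualTensor_comp (M N : HMod k H) : dualTensor M N ≫ dualTensorInv M N = 𝟙 _ := by
  apply dual_hom_ext
  rw [comp_whiskerRight, Category.assoc, uncurry_dualTensorInv, ← Category.assoc,
    associator_inv_naturality_left, Category.assoc, ← Category.assoc (_ ▷ _ ▷ _),
    ← comp_whiskerRight, uncurry_dualTensor, Iso.inv_hom_id_assoc, id_whiskerRight,
    Category.id_comp]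

theorem exists_evalEval (z : H ⊗[k] (H ⊗[k] H)) : ∃ w : H ⊗[k] H, ∀ (M N : HMod k H)
    (G : M →ₗ[k] (N →ₗ[k] k)) (t : M ⊗[k] N),
    evalEval M N (tensorAct (ihom M (dual N)).act (tensorAct M.act N.act) z (G ⊗ₜ t)) =
    TensorProduct.lift G (tensorAct M.act N.act w t) := by
  induction z using tensor₃_induction with
  | zero => exact ⟨0, fun M N G t => by simp⟩
  | add x y hx hy =>
    obtain ⟨w, hw⟩ := hx
    obtain ⟨w', hw'⟩ := hy
    exact ⟨w + w', fun M N G t => by simp only [map_add, LinearMap.add_apply, hw, hw']⟩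
  | tmul a b c =>
    refine ⟨antipodeComul k H a * TensorProduct.comm k H H
      (TensorProduct.map Q.antipode.toLinearMap LinearMap.id (qElem k H)) * (b ⊗ₜ (Q.alpha * c)),
      fun M N G t => ?_⟩
    induction t using TensorProduct.induction_on with
    | zero => simp
    | add x y hx hy => simp only [map_add, TensorProduct.tmul_add, hx, hy]
    | tmul m n =>
      have h1 := evalAt_dual M N (qElem k H) ((ihom M (dual N)).act a G) (M.act b m)
        (N.act Q.alpha (N.act c n))
      rw [lift_ihom_act] at h1
      exact (evalAt_trivialMod N (evalAt M (dual N) (qElem k H)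
        ((ihom M (dual N)).act a G ⊗ₜ M.act b m) ⊗ₜ N.act c n)).trans
        (h1.trans (by simp [map_mul]))

/-- The maps `Hom(M, Hom(N, k)) → Hom(M ⊗ N, k)` of the adjunction are given by an element of
`H ⊗ H`. -/
theorem exists_dualTensorInv : ∃ w : H ⊗[k] H, ∀ (M N : HMod k H)
    (G : M →ₗ[k] (N →ₗ[k] k)) (t : M ⊗[k] N),
    (show M ⊗[k] N →ₗ[k] k from (dualTensorInv M N).lin G) t =
      TensorProduct.lift G (tensorAct M.act N.act w t) := by
  obtain ⟨w, hw⟩ := exists_evalEval Φinv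
  have key : ∀ z : H ⊗[k] H, ∃ w : H ⊗[k] H, ∀ (M N : HMod k H)
      (G : M →ₗ[k] (N →ₗ[k] k)) (t : M ⊗[k] N),
      evalEval M N (tensorAct (ihom M (dual N)).act (tensorAct M.act N.act) Φinv
        (tensorAct (ihom M (dual N)).act ((tensorAct M.act N.act).comp Q.comul) z (G ⊗ₜ t))) =
      TensorProduct.lift G (tensorAct M.act N.act w t) := by
    intro z
    induction z using TensorProduct.induction_on with
    | zero => exact ⟨0, fun M N G t => by simp⟩
    | add x y hx hy =>
      obtain ⟨w, hw⟩ := hx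
      obtain ⟨w', hw'⟩ := hy
      exact ⟨w + w', fun M N G t => by simp only [map_add, LinearMap.add_apply, hw, hw']⟩
    | tmul a b =>
      refine ⟨antipodeComul k H a * w * Q.comul b, fun M N G t => ?_⟩
      rw [tensorAct_tmul, hw, lift_ihom_act]
      simp [map_mul]
  obtain ⟨w', hw'⟩ := key (pElem k H)
  exact ⟨w', hw'⟩

/-- The morphism `dualTensor` in terms of the actions: the two curryings insert `p` twice, the
associator contributes `Φ`, and the evaluation contributes `Δ(α)`. -/
theorem dualTensor_apply (M N : HMod k H) (F : M ⊗[k] N →ₗ[k] k) (m : M) (n : N) :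
    (show N →ₗ[k] k from (show M →ₗ[k] (N →ₗ[k] k) from (dualTensor M N).lin F) m) n =
      TensorProduct.lift LinearMap.id (TensorProduct.map LinearMap.id
        (tensorAct M.act N.act (Q.comul Q.alpha))
        (tensorAct (dual (M ⊗ N)).act (tensorAct M.act N.act)
        (Φ * assoc k k k H H H (map Q.comul (.id k H) (pElem k H) * (pElem k H ⊗ₜ 1)))
          (F ⊗ₜ (m ⊗ₜ n)))) := by
  have h1 := tensorAct_comp (ρ := tensorAct (dual (M ⊗ N)).act M.act) (σ := N.act) Q.comul
    (.id k H) (pElem k H)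
  rw [AlgHom.comp_id] at h1
  have h2 := tensorAct_assoc (ρ := (dual (M ⊗ N)).act) (σ := M.act) (τ := N.act)
  refine (evalAt_trivialMod (M ⊗ N) (tensorAct (dual (M ⊗ N)).act (tensorAct M.act N.act) Φ
    (TensorProduct.assoc k (dual (M ⊗ N)) M N
      (tensorAct ((tensorAct (dual (M ⊗ N)).act M.act).comp Q.comul) N.act (pElem k H)
        (tensorAct (dual (M ⊗ N)).act M.act (pElem k H) (F ⊗ₜ m) ⊗ₜ n))))).trans ?_
  have h3 : tensorAct (dual (M ⊗ N)).act M.act (pElem k H) (F ⊗ₜ m) ⊗ₜ[k] n =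
    tensorAct (tensorAct (dual (M ⊗ N)).act M.act) N.act (pElem k H ⊗ₜ 1) ((F ⊗ₜ m) ⊗ₜ n) := by
    rw [tensorAct_tmul, map_one]; rfl
  rw [h1, h3, ← Module.End.mul_apply, ← map_mul, h2, ← Module.End.mul_apply, ← map_mul]
  rfl

/-- The action of `H` on the dual of `M ⊗ N`. -/
def dualTensorAct (M N : HMod k H) : H →ₐ[k] Module.End k (M ⊗[k] N →ₗ[k] k) := (dual (M ⊗ N)).act

theorem exists_dualTensor_aux (z : H ⊗[k] (H ⊗[k] H)) : ∃ w : H ⊗[k] H, ∀ (M N : HMod k H)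
    (F : M ⊗[k] N →ₗ[k] k) (t : M ⊗[k] N),
    TensorProduct.lift LinearMap.id (TensorProduct.map LinearMap.id
      (tensorAct M.act N.act (Q.comul Q.alpha))
      (tensorAct (dualTensorAct M N) (tensorAct M.act N.act) z (F ⊗ₜ t))) =
    F (tensorAct M.act N.act w t) := by
  induction z using TensorProduct.induction_on with
  | zero => exact ⟨0, fun M N F t => by simp⟩
  | add x y hx hy =>
    obtain ⟨w, hw⟩ := hx
    obtain ⟨w', hw'⟩ := hy
    exact ⟨w + w', fun M N F t => by simp only [map_add, LinearMap.add_apply, hw, hw']⟩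
  | tmul a u =>
    refine ⟨Q.comul (Q.antipode a) * Q.comul Q.alpha * u, fun M N F t => ?_⟩
    refine (congrArg (fun f : M ⊗[k] N →ₗ[k] k => f (tensorAct M.act N.act (Q.comul Q.alpha)
      (tensorAct M.act N.act u t))) (dual_act (M ⊗ N) a F)).trans ?_
    rw [map_mul, map_mul]; rfl

/-- The maps `Hom(M ⊗ N, k) → Hom(M, Hom(N, k))` of the adjunction are given by an element of
`H ⊗ H`. -/
theorem exists_dualTensor : ∃ w : H ⊗[k] H, ∀ (M N : HMod k H)
    (F : M ⊗[k] N →ₗ[k] k) (t : M ⊗[k] N),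
    TensorProduct.lift (show M →ₗ[k] (N →ₗ[k] k) from (dualTensor M N).lin F) t =
      F (tensorAct M.act N.act w t) := by
  obtain ⟨w, hw⟩ := exists_dualTensor_aux (k := k) (H := H)
    (Φ * assoc k k k H H H (map Q.comul (.id k H) (pElem k H) * (pElem k H ⊗ₜ 1)))
  refine ⟨w, fun M N F t => ?_⟩
  induction t using TensorProduct.induction_on with
  | zero => simp
  | add x y hx hy => simp only [map_add, hx, hy]
  | tmul m n => exact (dualTensor_apply M N F m n).trans (hw M N F (m ⊗ₜ n))

/-- An element of `H ⊗ H` is determined by its action on the tensor square of the regular module. -/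
theorem eq_of_forall_tensorAct {x y : H ⊗[k] H} (h : ∀ (M N : HMod k H)
    (F : M ⊗[k] N →ₗ[k] k) (t : M ⊗[k] N),
    F (tensorAct M.act N.act x t) = F (tensorAct M.act N.act y t)) : x = y := by
  refine sub_eq_zero.1 ((Module.forall_dual_apply_eq_zero_iff k (x - y)).1 fun F => ?_)
  have h1 := h (HMod.regular k H) (HMod.regular k H) F ((1 : H) ⊗ₜ[k] (1 : H))
  rw [map_sub, sub_eq_zero]
  have h2 := regular_tensorAct_one x
  have h3 := regular_tensorAct_one y
  rw [← h2, ← h3]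
  exact h1

/-- The Drinfeld twist exists: an invertible `f` in `H ⊗ H` that induces the isomorphism of
`Hom(M, Hom(N, k))` and `Hom(M ⊗ N, k)` for all modules `M`, `N`. -/
theorem exists_twist : ∃ f : (H ⊗[k] H)ˣ, ∀ (M N : HMod k H)
    (G : M →ₗ[k] (N →ₗ[k] k)) (t : M ⊗[k] N),
    (show M ⊗[k] N →ₗ[k] k from (dualTensorInv M N).lin G) t =
      TensorProduct.lift G (tensorAct M.act N.act f t) := by
  obtain ⟨f, hf⟩ := exists_dualTensorInv (k := k) (H := H)
  obtain ⟨g, hg⟩ := exists_dualTensor (k := k) (H := H)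
  have h1 : f * g = 1 := eq_of_forall_tensorAct fun M N F t => by
    have a1 : TensorProduct.lift (show M →ₗ[k] (N →ₗ[k] k) from
        (dualTensorInv M N ≫ dualTensor M N).lin (TensorProduct.curry F)) t =
        TensorProduct.lift (TensorProduct.curry F) t := by rw [dualTensorInv_comp]; rfl
    have a2 := (hg M N ((dualTensorInv M N).lin (TensorProduct.curry F)) t).symm.trans a1
    rw [map_mul, map_one, Module.End.mul_apply, Module.End.one_apply]
    have a3 := (hf M N (TensorProduct.curry F) (tensorAct M.act N.act g t)).symm.trans a2
    have a4 : TensorProduct.lift (TensorProduct.curry F) = F :=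
      TensorProduct.ext' fun m n => rfl
    rwa [a4] at a3
  have h2 : g * f = 1 := eq_of_forall_tensorAct fun M N F t => by
    have a1 : (show M ⊗[k] N →ₗ[k] k from (dualTensor M N ≫ dualTensorInv M N).lin F) t = F t := by
      rw [dualTensor_comp]; rfl
    have a2 := (hf M N ((dualTensor M N).lin F) t).symm.trans a1
    rw [map_mul, map_one, Module.End.mul_apply, Module.End.one_apply]
    exact (hg M N F (tensorAct M.act N.act f t)).symm.trans a2
  exact ⟨⟨f, g, h1, h2⟩, hf⟩

variable (k H) in
/-- The Drinfeld twist: the element `f` of `H ⊗ H` such that the isomorphism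
`Hom(M, Hom(N, k)) → Hom(M ⊗ N, k)` sends `G` to `m ⊗ n ↦ G (f¹ • m) (f² • n)`. It is only
characterized by this property, and no explicit formula for it is needed. -/
def drinfeldTwist : (H ⊗[k] H)ˣ := exists_twist.choose

theorem dualTensorInv_apply (M N : HMod k H) (G : M →ₗ[k] (N →ₗ[k] k)) (t : M ⊗[k] N) :
    (show M ⊗[k] N →ₗ[k] k from (dualTensorInv M N).lin G) t =
      TensorProduct.lift G (tensorAct M.act N.act (drinfeldTwist k H : H ⊗[k] H) t) :=
  exists_twist.choose_spec M N G t

/-- `f Δ(S(h)) = (S(h₂) ⊗ S(h₁)) f`: the isomorphism that defines `f` is linear over `H`. -/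
theorem drinfeldTwist_mul_comul (h : H) : (drinfeldTwist k H : H ⊗[k] H) * Q.comul (Q.antipode h) =
    antipodeComul k H h * drinfeldTwist k H :=
  eq_of_forall_tensorAct fun M N F t => by
    have a4 : TensorProduct.lift (TensorProduct.curry F) = F :=
      TensorProduct.ext' fun m n => rfl
    have a1 := (dualTensorInv M N).map_act h (TensorProduct.curry F)
    have a2 := congrArg (fun f : M ⊗[k] N →ₗ[k] k => f t)
      (dual_act (M ⊗ N) h ((dualTensorInv M N).lin (TensorProduct.curry F)))
    have a3 := congrArg (fun f : M ⊗[k] N →ₗ[k] k => f t) a1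
    have a5 := a3.trans a2
    have a6 := (dualTensorInv_apply M N _ t).symm.trans a5
    have a7 := a6.trans (dualTensorInv_apply M N (TensorProduct.curry F)
      (tensorAct M.act N.act (Q.comul (Q.antipode h)) t))
    rw [lift_ihom_act, a4] at a7
    rw [map_mul, map_mul]
    exact a7.symm

end DrinfeldTwist

/-! ### The dual of a tensor product -/

section DualLax

open MonoidalCategory
open scoped TensorProduct
open Algebra.TensorProduct (map assoc)

section Nested

variable {C : Type u} [Category.{v} C] [MonoidalCategory C]

/-- The nested evaluation `(N' ⊗ M') ⊗ (M ⊗ N) ⟶ 1`, which contracts `M'` with `M` first. -/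
def nestedEv {M' M N' N : C} (e : M' ⊗ M ⟶ 𝟙_ C) (e' : N' ⊗ N ⟶ 𝟙_ C) :
    (N' ⊗ M') ⊗ (M ⊗ N) ⟶ 𝟙_ C :=
  (α_ (N' ⊗ M') M N).inv ≫ ((α_ N' M' M).hom ≫ N' ◁ e ≫ (ρ_ N').hom) ▷ N ≫ e'

/-- If `l` and `r` are compatible with nested evaluations, the two ways to nest three evaluations
agree up to the associators. -/
theorem nestedEv_assoc {M' M N' N P' P A B : C} (e : M' ⊗ M ⟶ 𝟙_ C) (e' : N' ⊗ N ⟶ 𝟙_ C)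
    (e'' : P' ⊗ P ⟶ 𝟙_ C) (a : A ⊗ (N ⊗ P) ⟶ 𝟙_ C) (b : B ⊗ (M ⊗ N) ⟶ 𝟙_ C) (l : P' ⊗ N' ⟶ A)
    (r : N' ⊗ M' ⟶ B) (hl : l ▷ (N ⊗ P) ≫ a = nestedEv e' e'')
    (hr : r ▷ (M ⊗ N) ≫ b = nestedEv e e') :
    (l ▷ M') ▷ ((M ⊗ N) ⊗ P) ≫ (A ⊗ M') ◁ (α_ M N P).hom ≫ nestedEv e a =
      (α_ P' N' M').hom ▷ ((M ⊗ N) ⊗ P) ≫ (P' ◁ r) ▷ ((M ⊗ N) ⊗ P) ≫ nestedEv b e'' := by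
  calc
    _ = 𝟙 _ ⊗≫ ((l ▷ (M' ⊗ M)) ≫ A ◁ e) ▷ (N ⊗ P) ⊗≫ a := by
      rw [nestedEv]; monoidal
    _ = 𝟙 _ ⊗≫ (P' ⊗ N') ◁ e ▷ (N ⊗ P) ⊗≫ (l ▷ (N ⊗ P) ≫ a) := by
      rw [← whisker_exchange]; monoidal
    _ = 𝟙 _ ⊗≫ P' ◁ (nestedEv e e') ▷ P ⊗≫ e'' := by
      rw [hl, nestedEv, nestedEv]; monoidal
    _ = _ := by
      rw [← hr, nestedEv]; monoidal

end Nested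

variable {k H : Type u} [Field k] [Ring H] [Algebra k H] [Q : QuasiHopfAlgebra k H]

local notation "Φ" => (Q.reassociator : H ⊗[k] (H ⊗[k] H))
local notation "Φinv" => ((Q.reassociator⁻¹ : (H ⊗[k] (H ⊗[k] H))ˣ) : H ⊗[k] (H ⊗[k] H))

/-- The linear map `ν ⊗ φ ↦ (m ↦ φ(m) ν)`. -/
def dualPairLin (M N : HMod k H) :
    (N →ₗ[k] k) ⊗[k] (M →ₗ[k] k) →ₗ[k] (M →ₗ[k] (N →ₗ[k] k)) :=
  TensorProduct.lift (LinearMap.smulRightₗ (R := k) (M := N →ₗ[k] k) (M₂ := M)).flip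

theorem dualPairLin_act (M N : HMod k H) (z : H ⊗[k] H) (t : (N →ₗ[k] k) ⊗[k] (M →ₗ[k] k)) :
    dualPairLin M N (tensorAct (dual N).act (dual M).act z t) =
      homAct M (dual N) z (dualPairLin M N t) := by
  induction z using TensorProduct.induction_on with
  | zero => simp
  | add x y hx hy => simp only [map_add, LinearMap.add_apply, hx, hy]
  | tmul a b =>
    induction t using TensorProduct.induction_on with
    | zero => simp
    | add x y hx hy => simp only [map_add, hx, hy]
    | tmul ν φ =>
      have h1 := dual_act M b φ
      refine LinearMap.ext fun m => ?_
      change (show M →ₗ[k] k from (dual M).act b φ) m • (dual N).act a ν =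
        (dual N).act a (φ (M.act (Q.antipode b) m) • ν)
      rw [map_smul]
      exact congrArg (fun f : M →ₗ[k] k => f m • (dual N).act a ν) h1

/-- The morphism `ν ⊗ φ ↦ (m ↦ φ(m) ν)`. -/
def dualPair (M N : HMod k H) : dual N ⊗ dual M ⟶ ihom M (dual N) where
  lin := dualPairLin M N
  map_act h t := dualPairLin_act M N (Q.comul h) t

theorem uncurry_dualPair (M N : HMod k H) : dualPair M N ▷ M ≫ ihomEv M (dual N) =
    (α_ (dual N) (dual M) M).hom ≫ dual N ◁ dualEv M ≫ (ρ_ (dual N)).hom := by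
  refine HMod.Hom.ext (TensorProduct.ext_threefold (M := N →ₗ[k] k) (N := M →ₗ[k] k) (P := M)
    fun ν φ m => ?_)
  have key : ∀ z : H ⊗[k] (H ⊗[k] H), evalAt M (dual N)
      (TensorProduct.map LinearMap.id (alphaMap k H) z) (dualPairLin M N (ν ⊗ₜ φ) ⊗ₜ m) =
      TensorProduct.rid k (N →ₗ[k] k) (TensorProduct.map LinearMap.id
        (TensorProduct.lift LinearMap.id ∘ₗ TensorProduct.map LinearMap.id (M.act Q.alpha))
        (tensorAct (dual N).act (tensorAct (dual M).act M.act) z (ν ⊗ₜ (φ ⊗ₜ m)))) := by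
    intro z
    induction z using tensor₃_induction with
    | zero => simp
    | add x y hx hy => simp only [map_add, evalAt_add, LinearMap.add_apply, hx, hy]
    | tmul a b c =>
      have h1 := dual_act M b φ
      change (dual N).act a (φ (M.act (Q.antipode b * Q.alpha * c) m) • ν) =
        (show M →ₗ[k] k from (dual M).act b φ) (M.act Q.alpha (M.act c m)) • (dual N).act a ν
      rw [map_smul]
      refine Eq.trans ?_ (congrArg (fun f : M →ₗ[k] k =>
        f (M.act Q.alpha (M.act c m)) • (dual N).act a ν) h1).symm
      simp [map_mul]
  refine (key Φ).trans ?_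
  have h2 : evalAt M (trivialMod k H) (qElem k H) = (TensorProduct.lift LinearMap.id ∘ₗ
      TensorProduct.map LinearMap.id (M.act Q.alpha)) :=
    LinearMap.ext fun t => evalAt_trivialMod M t
  rw [← h2]
  rfl

/-- The lax structure `N* ⊗ M* ⟶ (M ⊗ N)*` of the duality functor. -/
def dualLax (M N : HMod k H) : dual N ⊗ dual M ⟶ dual (M ⊗ N) :=
  dualPair M N ≫ dualTensorInv M N

theorem uncurry_dualLax (M N : HMod k H) :
    dualLax M N ▷ (M ⊗ N) ≫ dualEv (M ⊗ N) = nestedEv (dualEv M) (dualEv N) := by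
  rw [dualLax, comp_whiskerRight, Category.assoc, uncurry_dualTensorInv, ← Category.assoc,
    associator_inv_naturality_left, Category.assoc, ← Category.assoc (_ ▷ _ ▷ _),
    ← comp_whiskerRight, uncurry_dualPair, nestedEv]

/-- The functional `m ⊗ n ↦ φ(m) ν(n)`. -/
def pairing {V W : Type u} [AddCommGroup V] [Module k V] [AddCommGroup W] [Module k W]
    (φ : V →ₗ[k] k) (ν : W →ₗ[k] k) : V ⊗[k] W →ₗ[k] k :=
  TensorProduct.lift (φ.smulRight ν)

/-- The lax structure of the duality functor is given by the Drinfeld twist: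
`ν ⊗ φ ↦ (m ⊗ n ↦ φ (f¹ • m) ν (f² • n))`. -/
theorem dualLax_tmul (M N : HMod k H) (φ : M →ₗ[k] k) (ν : N →ₗ[k] k) :
    (show M ⊗[k] N →ₗ[k] k from (dualLax M N).lin (ν ⊗ₜ φ : (N →ₗ[k] k) ⊗[k] (M →ₗ[k] k))) =
      pairing φ ν ∘ₗ tensorAct M.act N.act (drinfeldTwist k H : H ⊗[k] H) :=
  LinearMap.ext fun t => dualTensorInv_apply M N (φ.smulRight ν) t

/-- The transpose of a morphism. -/
def dualMap {V W : HMod k H} (g : V ⟶ W) : dual W ⟶ dual V where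
  lin := LinearMap.lcomp k k g.lin
  map_act h φ := by
    have h1 := dual_act W h φ
    have h2 := dual_act V h (LinearMap.lcomp k k g.lin φ)
    refine (congrArg (LinearMap.lcomp k k g.lin) h1).trans (Eq.trans ?_ h2.symm)
    ext v
    simp [g.map_act]

theorem dualMap_whiskerRight {V W : HMod k H} (g : V ⟶ W) :
    dualMap g ▷ V ≫ dualEv V = dual W ◁ g ≫ dualEv W :=
  HMod.tensor_ext fun φ v => by
    refine (evalAt_trivialMod V ((φ ∘ₗ g.lin) ⊗ₜ v)).trans
      (Eq.trans ?_ (evalAt_trivialMod W (φ ⊗ₜ g.lin v)).symm)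
    simp [g.map_act]

/-- The lax structure of the duality functor is coherent with the associators. Both sides have the
same nested evaluation. -/
theorem dualLax_assoc (M N P : HMod k H) :
    dualLax N P ▷ dual M ≫ dualLax M (N ⊗ P) ≫ dualMap (α_ M N P).hom =
      (α_ (dual P) (dual N) (dual M)).hom ≫ dual P ◁ dualLax M N ≫ dualLax (M ⊗ N) P := by
  apply dual_hom_ext
  simp only [comp_whiskerRight, Category.assoc, dualMap_whiskerRight, uncurry_dualLax]
  rw [← whisker_exchange_assoc, uncurry_dualLax]
  exact nestedEv_assoc _ _ _ _ _ _ _ (uncurry_dualLax N P) (uncurry_dualLax M N)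

end DualLax

/-! ### Coherence of the Drinfeld twist -/

section TwistCoherence

open MonoidalCategory
open scoped TensorProduct
open Algebra.TensorProduct (map assoc)

section Pairing

variable {k V W X : Type u} [Field k] [AddCommGroup V] [Module k V] [AddCommGroup W] [Module k W]
  [AddCommGroup X] [Module k X]

/-- Contractions with functionals on the first factor separate the points of a tensor product. -/
theorem eq_zero_of_forall_lid_map {x : V ⊗[k] W}
    (h : ∀ φ : V →ₗ[k] k, TensorProduct.lid k W (TensorProduct.map φ LinearMap.id x) = 0) :
    x = 0 := by
  classical
  let b := Module.Basis.ofVectorSpace k V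
  refine (TensorProduct.equivFinsuppOfBasisLeft (N := W) b).injective (Finsupp.ext fun i => ?_)
  rw [TensorProduct.equivFinsuppOfBasisLeft_apply, map_zero]
  exact h (b.coord i)

theorem pairing_apply (φ : V →ₗ[k] k) (ν : W →ₗ[k] k) (x : V ⊗[k] W) :
    pairing φ ν x = ν (TensorProduct.lid k W (TensorProduct.map φ LinearMap.id x)) := by
  induction x using TensorProduct.induction_on with
  | zero => simp
  | add x y hx hy => simp only [map_add, hx, hy]
  | tmul v w => simp [pairing]

/-- Product functionals separate the points of a threefold tensor product. -/
theorem eq_of_forall_pairing {x y : V ⊗[k] (W ⊗[k] X)}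
    (h : ∀ (φ : V →ₗ[k] k) (ν : W →ₗ[k] k) (π : X →ₗ[k] k),
      pairing φ (pairing ν π) x = pairing φ (pairing ν π) y) : x = y := by
  refine sub_eq_zero.1 (eq_zero_of_forall_lid_map fun φ => eq_zero_of_forall_lid_map fun ν =>
    (Module.forall_dual_apply_eq_zero_iff k _).1 fun π => ?_)
  have h1 := h φ ν π
  rwa [pairing_apply, pairing_apply φ, ← sub_eq_zero, ← map_sub, ← map_sub, ← map_sub,
    pairing_apply] at h1

theorem pairing_assoc (φ : V →ₗ[k] k) (ν : W →ₗ[k] k) (π : X →ₗ[k] k)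
    (t : (V ⊗[k] W) ⊗[k] X) : pairing (pairing φ ν) π t =
      pairing φ (pairing ν π) (TensorProduct.assoc k V W X t) := by
  have : pairing (pairing φ ν) π =
      pairing φ (pairing ν π) ∘ₗ (TensorProduct.assoc k V W X).toLinearMap :=
    TensorProduct.ext_threefold fun v w x => by simp [pairing, mul_assoc]
  rw [this]; rfl

theorem pairing_map {V' W' : Type u} [AddCommGroup V'] [Module k V'] [AddCommGroup W']
    [Module k W'] (φ : V →ₗ[k] k) (ν : W →ₗ[k] k) (f : V' →ₗ[k] V) (g : W' →ₗ[k] W) :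
    pairing (φ ∘ₗ f) (ν ∘ₗ g) = pairing φ ν ∘ₗ TensorProduct.map f g :=
  TensorProduct.ext' fun v w => by simp [pairing]

end Pairing

variable {k H : Type u} [Field k] [Ring H] [Algebra k H] [Q : QuasiHopfAlgebra k H]

local notation "Φ" => (Q.reassociator : H ⊗[k] (H ⊗[k] H))
local notation "Φinv" => ((Q.reassociator⁻¹ : (H ⊗[k] (H ⊗[k] H))ˣ) : H ⊗[k] (H ⊗[k] H))

/-- The action of the Drinfeld twist on `M ⊗ N`. -/
def twistAct (M N : HMod k H) : M ⊗[k] N →ₗ[k] M ⊗[k] N :=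
  tensorAct M.act N.act (drinfeldTwist k H : H ⊗[k] H)

variable (k H) in
/-- The map `a ⊗ b ⊗ c ↦ S(c) ⊗ S(b) ⊗ S(a)`. -/
def antipodeReverse : H ⊗[k] (H ⊗[k] H) →ₗ[k] H ⊗[k] (H ⊗[k] H) :=
  (TensorProduct.assoc k H H H).toLinearMap ∘ₗ (TensorProduct.comm k H (H ⊗[k] H)).toLinearMap ∘ₗ
    TensorProduct.map Q.antipode.toLinearMap ((TensorProduct.comm k H H).toLinearMap ∘ₗ
      TensorProduct.map Q.antipode.toLinearMap Q.antipode.toLinearMap)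

@[simp]
theorem antipodeReverse_tmul (a b c : H) : antipodeReverse k H (a ⊗ₜ (b ⊗ₜ c)) =
    Q.antipode c ⊗ₜ (Q.antipode b ⊗ₜ Q.antipode a) := rfl

/-- If `L` and `L'` are given by operators `f` and `f'`, an element `z` that acts on a product of three
functionals before `L` and `L'` acts on the arguments through its reversed antipode. -/
theorem pairing_dual_act {M N P : HMod k H}
    (L : (N →ₗ[k] k) ⊗[k] (M →ₗ[k] k) →ₗ[k] (M ⊗[k] N →ₗ[k] k)) {f : M ⊗[k] N →ₗ[k] M ⊗[k] N}
    (hL : ∀ φ ν, L (ν ⊗ₜ φ) = pairing φ ν ∘ₗ f)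
    (L' : (P →ₗ[k] k) ⊗[k] (M ⊗[k] N →ₗ[k] k) →ₗ[k] ((M ⊗[k] N) ⊗[k] P →ₗ[k] k))
    {f' : (M ⊗[k] N) ⊗[k] P →ₗ[k] (M ⊗[k] N) ⊗[k] P}
    (hL' : ∀ χ π, L' (π ⊗ₜ χ) = pairing χ π ∘ₗ f') (φ : M →ₗ[k] k) (ν : N →ₗ[k] k)
    (π : P →ₗ[k] k) (t : (M ⊗[k] N) ⊗[k] P) (z : H ⊗[k] (H ⊗[k] H)) :
    L' (TensorProduct.map LinearMap.id L (tensorAct (dual P).act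
      (tensorAct (dual N).act (dual M).act) z (π ⊗ₜ (ν ⊗ₜ φ)))) t =
    pairing φ (pairing ν π) (tensorAct M.act (tensorAct N.act P.act) (antipodeReverse k H z)
      (TensorProduct.assoc k M N P (TensorProduct.map f LinearMap.id (f' t)))) := by
  induction z using tensor₃_induction with
  | zero => simp
  | add x y hx hy => simp only [map_add, LinearMap.add_apply, hx, hy]
  | tmul a b c =>
    have e1 : tensorAct (dual P).act (tensorAct (dual N).act (dual M).act) (a ⊗ₜ (b ⊗ₜ c))
        (π ⊗ₜ (ν ⊗ₜ φ)) = (π ∘ₗ P.act (Q.antipode a)) ⊗ₜ[k] ((ν ∘ₗ N.act (Q.antipode b)) ⊗ₜ[k]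
          (φ ∘ₗ M.act (Q.antipode c))) := by
      rw [← dual_act, ← dual_act, ← dual_act]; rfl
    rw [e1, TensorProduct.map_tmul, hL, hL', pairing_map, LinearMap.comp_assoc,
      LinearMap.id_apply, pairing_map, antipodeReverse_tmul]
    change pairing (pairing φ ν) π (TensorProduct.map (TensorProduct.map (M.act (Q.antipode c))
      (N.act (Q.antipode b)) ∘ₗ f) (P.act (Q.antipode a)) (f' t)) =
      pairing φ (pairing ν π) (TensorProduct.map (M.act (Q.antipode c)) (TensorProduct.map
        (N.act (Q.antipode b)) (P.act (Q.antipode a))) _)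
    rw [pairing_assoc, TensorProduct.map_map_assoc, map_map', LinearMap.comp_id]

/-- The Drinfeld twist satisfies
`(1 ⊗ f) (id ⊗ Δ)(f) Φ = (S(X³) ⊗ S(X²) ⊗ S(X¹)) (f ⊗ 1) (Δ ⊗ id)(f)`, as operators. It is
`dualLax_assoc`, evaluated at products of functionals. -/
theorem twistAct_assoc (M N P : HMod k H) (t : (M ⊗[k] N) ⊗[k] P) :
    TensorProduct.map LinearMap.id (twistAct N P) (twistAct M (N ⊗ P)
      (tensorAct M.act (tensorAct N.act P.act) Φ (TensorProduct.assoc k M N P t))) =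
    tensorAct M.act (tensorAct N.act P.act) (antipodeReverse k H Φ) (TensorProduct.assoc k M N P
      (TensorProduct.map (twistAct M N) LinearMap.id (twistAct (M ⊗ N) P t))) := by
  refine eq_of_forall_pairing fun φ ν π => ?_
  have h1 := congrArg (fun f => (show (M ⊗[k] N) ⊗[k] P →ₗ[k] k from HMod.Hom.lin f
    ((π ⊗ₜ ν) ⊗ₜ φ : ((P →ₗ[k] k) ⊗[k] (N →ₗ[k] k)) ⊗[k] (M →ₗ[k] k))) t) (dualLax_assoc M N P)
  have left : (show (M ⊗[k] N) ⊗[k] P →ₗ[k] k from (dualLax N P ▷ dual M ≫ dualLax M (N ⊗ P) ≫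
      dualMap (α_ M N P).hom).lin
      ((π ⊗ₜ ν) ⊗ₜ φ : ((P →ₗ[k] k) ⊗[k] (N →ₗ[k] k)) ⊗[k] (M →ₗ[k] k))) t =
      pairing φ (pairing ν π) (TensorProduct.map LinearMap.id (twistAct N P) (twistAct M (N ⊗ P)
      (tensorAct M.act (tensorAct N.act P.act) Φ (TensorProduct.assoc k M N P t)))) := by
    have a1 := congrArg (fun f : M ⊗[k] (N ⊗[k] P) →ₗ[k] k => f
      (tensorAct M.act (tensorAct N.act P.act) Φ (TensorProduct.assoc k M N P t)))
      (dualLax_tmul M (N ⊗ P) φ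
        ((dualLax N P).lin (π ⊗ₜ ν : (P →ₗ[k] k) ⊗[k] (N →ₗ[k] k))))
    refine a1.trans ?_
    have a2 := dualLax_tmul N P ν π
    have a3 := congrArg (fun f : N ⊗[k] P →ₗ[k] k => pairing φ f (twistAct M (N ⊗ P)
      (tensorAct M.act (tensorAct N.act P.act) Φ (TensorProduct.assoc k M N P t)))) a2
    refine a3.trans ?_
    have a4 := pairing_map φ (pairing ν π) LinearMap.id (twistAct N P)
    rw [LinearMap.comp_id] at a4
    exact congrArg (fun f : M ⊗[k] (N ⊗[k] P) →ₗ[k] k => f (twistAct M (N ⊗ P)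
      (tensorAct M.act (tensorAct N.act P.act) Φ (TensorProduct.assoc k M N P t)))) a4
  have right := pairing_dual_act (M := M) (N := N) (P := P) (dualLax M N).lin
    (fun φ ν => dualLax_tmul M N φ ν) (dualLax (M ⊗ N) P).lin
    (fun χ π => dualLax_tmul (M ⊗ N) P χ π) φ ν π t Φ
  exact left.symm.trans (h1.trans right)

/-- The counit, applied to `S(h₁) α h₂ = ε(h) α`. -/
theorem counit_antipode_mul (h : H) :
    Q.counit (Q.antipode h) * Q.counit Q.alpha = Q.counit h * Q.counit Q.alpha := by
  have e : ∀ z : H ⊗[k] H, Q.counit (alphaMap k H z) =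
      Q.counit (Q.antipode (Algebra.TensorProduct.rid k k H (map (.id k H) Q.counit z))) *
        Q.counit Q.alpha := by
    intro z
    induction z using TensorProduct.induction_on with
    | zero => simp
    | add x y hx hy => simp only [map_add, add_mul, hx, hy]
    | tmul a b => simp; ring
  have h1 := e (Q.comul h)
  rw [alphaMap_comul, Q.counit_right] at h1
  rw [← h1]; simp

variable (k H) in
/-- The counit, applied to `X¹ β S(X²) α X³ = 1`. -/
theorem counit_beta_mul_counit_alpha : Q.counit Q.beta * Q.counit Q.alpha = 1 := by
  have e : ∀ z : H ⊗[k] (H ⊗[k] H), Q.counit (betaAlphaMap k H z) =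
      Q.counit Q.beta * Q.counit Q.alpha * LinearMap.mul' k k (map Q.counit Q.counit
        (map (.id k H) ((Algebra.TensorProduct.lid k H).toAlgHom.comp
          (map Q.counit (.id k H))) z)) := by
    intro z
    induction z using tensor₃_induction with
    | zero => simp
    | add x y hx hy => simp only [map_add, mul_add, hx, hy]
    | tmul a b c =>
      have h := counit_antipode_mul (k := k) b
      simp only [betaAlphaMap_tmul, map_mul]
      rw [h]
      simp; ring
  have h1 := e Φ
  rw [Q.counit_reassociator, betaAlphaMap_reassociator] at h1
  rw [map_one, map_one, Algebra.TensorProduct.one_def, LinearMap.mul'_apply] at h1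
  simpa using h1.symm

theorem counit_antipode (h : H) : Q.counit (Q.antipode h) = Q.counit h :=
  mul_right_cancel₀ (right_ne_zero_of_mul_eq_one (counit_beta_mul_counit_alpha k H))
    (counit_antipode_mul h)

section Unit

variable {C : Type u} [Category.{v} C] [MonoidalCategory C]

theorem nestedEv_unit_left {D N' N : C} (e : D ⊗ 𝟙_ C ⟶ 𝟙_ C) (e' : N' ⊗ N ⟶ 𝟙_ C)
    (i : 𝟙_ C ⟶ D) (hi : i ▷ 𝟙_ C ≫ e = (λ_ (𝟙_ C)).hom) :
    (N' ◁ i) ▷ (𝟙_ C ⊗ N) ≫ nestedEv e e' =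
      (ρ_ N').hom ▷ (𝟙_ C ⊗ N) ≫ N' ◁ (λ_ N).hom ≫ e' := by
  calc
    _ = 𝟙 _ ⊗≫ N' ◁ (i ▷ 𝟙_ C ≫ e) ▷ N ⊗≫ e' := by rw [nestedEv]; monoidal
    _ = _ := by rw [hi]; monoidal

theorem nestedEv_unit_right {D M' M : C} (e : M' ⊗ M ⟶ 𝟙_ C) (e' : D ⊗ 𝟙_ C ⟶ 𝟙_ C)
    (i : 𝟙_ C ⟶ D) (hi : i ▷ 𝟙_ C ≫ e' = (λ_ (𝟙_ C)).hom) :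
    (i ▷ M') ▷ (M ⊗ 𝟙_ C) ≫ nestedEv e e' =
      (λ_ M').hom ▷ (M ⊗ 𝟙_ C) ≫ M' ◁ (ρ_ M).hom ≫ e := by
  calc
    _ = 𝟙 _ ⊗≫ (i ▷ (M' ⊗ M) ≫ D ◁ e) ▷ 𝟙_ C ⊗≫ e' := by rw [nestedEv]; monoidal
    _ = 𝟙 _ ⊗≫ e ⊗≫ (i ▷ 𝟙_ C ≫ e') := by rw [← whisker_exchange]; monoidal
    _ = _ := by rw [hi]; monoidal

end Unit

variable (k H) in
/-- The unit constraint `r ↦ (s ↦ ε(β) r s)` of the duality functor. The evaluation of the dual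
contributes `ε(α)`, the inverse of `ε(β)`. -/
def dualUnit : 𝟙_ (HMod k H) ⟶ dual (𝟙_ (HMod k H)) where
  lin := Q.counit Q.beta • LinearMap.mul k k
  map_act h := fun (r : k) => by
    have h1 := dual_act (𝟙_ (HMod k H)) h ((Q.counit Q.beta • LinearMap.mul k k) (r : k))
    refine Eq.trans ?_ h1.symm
    refine LinearMap.ext fun (s : k) => ?_
    change Q.counit Q.beta * ((Q.counit h * r) * s) =
      Q.counit Q.beta * (r * (Q.counit (Q.antipode h) * s))
    rw [counit_antipode]; ring

theorem uncurry_dualUnit : dualUnit k H ▷ 𝟙_ (HMod k H) ≫ dualEv (𝟙_ (HMod k H)) =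
    (λ_ (𝟙_ (HMod k H))).hom := by
  refine HMod.tensor_ext fun (r : k) (s : k) => ?_
  refine (evalAt_trivialMod (𝟙_ (HMod k H))
    ((Q.counit Q.beta • LinearMap.mul k k) (r : k) ⊗ₜ s)).trans ?_
  change Q.counit Q.beta * (r * (Q.counit Q.alpha * s)) = r * s
  linear_combination (r * s : k) * counit_beta_mul_counit_alpha k H

theorem dualLax_unit_left (N : HMod k H) : dual N ◁ dualUnit k H ≫ dualLax (𝟙_ (HMod k H)) N =
    (ρ_ (dual N)).hom ≫ dualMap (λ_ N).hom := by
  apply dual_hom_ext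
  rw [comp_whiskerRight, Category.assoc, uncurry_dualLax, comp_whiskerRight, Category.assoc,
    dualMap_whiskerRight]
  exact nestedEv_unit_left _ _ _ uncurry_dualUnit

theorem dualLax_unit_right (M : HMod k H) : dualUnit k H ▷ dual M ≫ dualLax M (𝟙_ (HMod k H)) =
    (λ_ (dual M)).hom ≫ dualMap (ρ_ M).hom := by
  apply dual_hom_ext
  rw [comp_whiskerRight, Category.assoc, uncurry_dualLax, comp_whiskerRight, Category.assoc,
    dualMap_whiskerRight]
  exact nestedEv_unit_right _ _ _ uncurry_dualUnit

theorem pairing_smul_id {W : Type u} [AddCommGroup W] [Module k W] (c : k) (ν : W →ₗ[k] k)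
    (t : k ⊗[k] W) : pairing (c • LinearMap.id) ν t = ν (c • TensorProduct.lid k W t) := by
  rw [pairing_apply, TensorProduct.map_smul_left, TensorProduct.map_id]; simp

theorem pairing_smul_id_right {W : Type u} [AddCommGroup W] [Module k W] (c : k) (ν : W →ₗ[k] k)
    (t : W ⊗[k] k) : pairing ν (c • LinearMap.id) t = ν (c • TensorProduct.rid k W t) := by
  induction t using TensorProduct.induction_on with
  | zero => simp
  | add x y hx hy => simp only [map_add, smul_add, hx, hy]
  | tmul w r => simp [pairing]; ring

theorem dualUnit_one : (show k →ₗ[k] k from (dualUnit k H).lin (1 : k)) =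
    Q.counit Q.beta • LinearMap.id :=
  LinearMap.ext fun s => by
    change Q.counit Q.beta * (1 * s) = Q.counit Q.beta * s
    rw [one_mul]

theorem eq_of_forall_dual {V : Type u} [AddCommGroup V] [Module k V] {x y : V}
    (h : ∀ ν : V →ₗ[k] k, ν x = ν y) : x = y :=
  sub_eq_zero.1 ((Module.forall_dual_apply_eq_zero_iff k _).1 fun ν => by
    rw [map_sub, h ν, sub_self])

/-- `(ε ⊗ id)(f) = ε(β)⁻¹`, as operators. -/
theorem lid_twistAct (N : HMod k H) (t : k ⊗[k] N) :
    Q.counit Q.beta • TensorProduct.lid k N (twistAct (𝟙_ (HMod k H)) N t) =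
      TensorProduct.lid k N t := by
  refine eq_of_forall_dual (k := k) fun ν => ?_
  have h1 := congrArg (fun f => (show k ⊗[k] N →ₗ[k] k from HMod.Hom.lin f
    (ν ⊗ₜ (1 : k) : (N →ₗ[k] k) ⊗[k] k)) t) (dualLax_unit_left N)
  have h2 := congrArg (fun f : k ⊗[k] N →ₗ[k] k => f t)
    (dualLax_tmul (𝟙_ (HMod k H)) N ((dualUnit k H).lin (1 : k)) ν)
  have h3 := congrArg (fun f : k →ₗ[k] k => pairing f ν (twistAct (𝟙_ (HMod k H)) N t))
    (dualUnit_one (k := k) (H := H))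
  have h4 := (h2.trans h3).symm.trans h1
  refine (pairing_smul_id _ ν _).symm.trans (h4.trans ?_)
  exact congrArg (fun f : N →ₗ[k] k => f (TensorProduct.lid k N t)) (one_smul k ν)

/-- `(id ⊗ ε)(f) = ε(β)⁻¹`, as operators. -/
theorem rid_twistAct (M : HMod k H) (t : M ⊗[k] k) :
    Q.counit Q.beta • TensorProduct.rid k M (twistAct M (𝟙_ (HMod k H)) t) =
      TensorProduct.rid k M t := by
  refine eq_of_forall_dual (k := k) fun ν => ?_
  have h1 := congrArg (fun f => (show M ⊗[k] k →ₗ[k] k from HMod.Hom.lin f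
    ((1 : k) ⊗ₜ ν : k ⊗[k] (M →ₗ[k] k))) t) (dualLax_unit_right M)
  have h2 := congrArg (fun f : M ⊗[k] k →ₗ[k] k => f t)
    (dualLax_tmul M (𝟙_ (HMod k H)) ν ((dualUnit k H).lin (1 : k)))
  have h3 := congrArg (fun f : k →ₗ[k] k => pairing ν f (twistAct M (𝟙_ (HMod k H)) t))
    (dualUnit_one (k := k) (H := H))
  have h4 := (h2.trans h3).symm.trans h1
  refine (pairing_smul_id_right _ ν _).symm.trans (h4.trans ?_)
  exact congrArg (fun f : M →ₗ[k] k => f (TensorProduct.rid k M t)) (one_smul k ν)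

end TwistCoherence

/-! ### The antipode functor -/

section AntipodeFunctor

open MonoidalCategory
open scoped TensorProduct
open Algebra.TensorProduct (map assoc)

section CommMap

variable {k : Type u} [Field k] {V V' W X : Type u} [AddCommGroup V] [Module k V]
  [AddCommGroup V'] [Module k V'] [AddCommGroup W] [Module k W] [AddCommGroup X] [Module k X]

theorem map_id_comp_comm (f : V →ₗ[k] V') (g : V' →ₗ[k] X) (s : V ⊗[k] W) :
    TensorProduct.map LinearMap.id (g ∘ₗ f) (TensorProduct.comm k V W s) =
      TensorProduct.map LinearMap.id g
        (TensorProduct.comm k V' W (TensorProduct.map f LinearMap.id s)) := by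
  induction s using TensorProduct.induction_on with
  | zero => simp
  | add x y hx hy => simp only [map_add, hx, hy]
  | tmul v w => simp

theorem map_comp_id_comm (f : V →ₗ[k] V') (g : V' →ₗ[k] X) (s : W ⊗[k] V) :
    TensorProduct.map (g ∘ₗ f) LinearMap.id (TensorProduct.comm k W V s) =
      TensorProduct.map g LinearMap.id
        (TensorProduct.comm k W V' (TensorProduct.map LinearMap.id f s)) := by
  induction s using TensorProduct.induction_on with
  | zero => simp
  | add x y hx hy => simp only [map_add, hx, hy]
  | tmul v w => simp

theorem rid_map_smul_comm (c : k) (f : k →ₗ[k] k) (hf : ∀ r, f r = c * r) (s : k ⊗[k] V) :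
    TensorProduct.rid k V (TensorProduct.map LinearMap.id f (TensorProduct.comm k k V s)) =
      c • TensorProduct.lid k V s := by
  induction s using TensorProduct.induction_on with
  | zero => simp
  | add x y hx hy => simp only [map_add, hx, hy, smul_add]
  | tmul r v => simp [hf, mul_smul]

theorem lid_map_smul_comm (c : k) (f : k →ₗ[k] k) (hf : ∀ r, f r = c * r) (s : V ⊗[k] k) :
    TensorProduct.lid k V (TensorProduct.map f LinearMap.id (TensorProduct.comm k V k s)) =
      c • TensorProduct.rid k V s := by
  induction s using TensorProduct.induction_on with
  | zero => simp
  | add x y hx hy => simp only [map_add, hx, hy, smul_add]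
  | tmul v r => simp [hf, mul_smul]

end CommMap

variable {k H : Type u} [Field k] [Ring H] [Algebra k H] [Q : QuasiHopfAlgebra k H]

local notation "Φ" => (Q.reassociator : H ⊗[k] (H ⊗[k] H))

/-- The right action `v • h = S(h) • v` of `H` on a left module. -/
def opAct (V : HMod k H) : Hᵐᵒᵖ →ₐ[k] Module.End k V :=
  .ofLinearMap (V.act.toLinearMap ∘ₗ Q.antipode.toLinearMap ∘ₗ
      (MulOpposite.opLinearEquiv k).symm.toLinearMap)
    (by simp [Q.antipode_one]) (by intro a b; simp [Q.antipode_mul])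

@[simp]
theorem opAct_op (V : HMod k H) (h : H) : opAct V (MulOpposite.op h) = V.act (Q.antipode h) := rfl

/-- The left module `V`, regarded as a right module through the antipode. -/
abbrev toOp (V : HMod k H) : HMod k Hᵐᵒᵖ where
  carrier := V
  act := opAct V

/-- A morphism of left modules is a morphism of the right modules given by the antipode. -/
def toOpMap {V W : HMod k H} (f : V ⟶ W) : toOp V ⟶ toOp W where
  lin := f.lin
  map_act h v := f.map_act (Q.antipode h.unop) v

/-- The action of the Drinfeld twist, as a linear equivalence. -/
def twistEquiv (M N : HMod k H) : M ⊗[k] N ≃ₗ[k] M ⊗[k] N where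
  toLinearMap := twistAct M N
  invFun := tensorAct M.act N.act ↑(drinfeldTwist k H)⁻¹
  left_inv x := by
    change (tensorAct M.act N.act ↑(drinfeldTwist k H)⁻¹ *
      tensorAct M.act N.act ↑(drinfeldTwist k H)) x = x
    rw [← map_mul, Units.inv_mul, map_one]; rfl
  right_inv x := by
    change (tensorAct M.act N.act ↑(drinfeldTwist k H) *
      tensorAct M.act N.act ↑(drinfeldTwist k H)⁻¹) x = x
    rw [← map_mul, Units.mul_inv, map_one]; rfl

theorem comm_tensorAct_opAct (M N : HMod k H) (z : H ⊗[k] H) (t : M ⊗[k] N) :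
    tensorAct (opAct N) (opAct M) (o₂ (MulOpposite.opLinearEquiv k : H ≃ₗ[k] Hᵐᵒᵖ) z)
        (TensorProduct.comm k M N t) =
      TensorProduct.comm k M N (tensorAct M.act N.act (TensorProduct.comm k H H
        (TensorProduct.map Q.antipode.toLinearMap Q.antipode.toLinearMap z)) t) := by
  induction z using TensorProduct.induction_on with
  | zero => simp
  | add x y hx hy => simp only [map_add, LinearMap.add_apply, hx, hy]
  | tmul a b =>
    induction t using TensorProduct.induction_on with
    | zero => simp
    | add x y hx hy => simp only [map_add, hx, hy]
    | tmul m n => simp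

theorem comm_twistAct_act (M N : HMod k H) (h : H) (t : M ⊗[k] N) :
    TensorProduct.comm k M N (twistAct M N (tensorAct M.act N.act (Q.comul (Q.antipode h)) t)) =
      tensorAct (opAct N) (opAct M) (o₂ (MulOpposite.opLinearEquiv k : H ≃ₗ[k] Hᵐᵒᵖ) (Q.comul h))
        (TensorProduct.comm k M N (twistAct M N t)) := by
  rw [comm_tensorAct_opAct, twistAct, ← Module.End.mul_apply, ← map_mul, drinfeldTwist_mul_comul,
    map_mul]
  rfl

/-- The isomorphism `m ⊗ n ↦ f² • n ⊗ f¹ • m` of right modules, where `f = f¹ ⊗ f²` is the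
Drinfeld twist. -/
def toOpTensor (M N : HMod k H) : toOp (M ⊗ N) ≅ toOp N ⊗ toOp M :=
  HMod.mkIso (M := toOp (M ⊗ N)) (N := toOp N ⊗ toOp M)
    ((twistEquiv M N).trans (TensorProduct.comm k M N))
    fun h t => comm_twistAct_act M N h.unop t

theorem toOpTensor_natural {M N M' N' : HMod k H} (f : M ⟶ M') (g : N ⟶ N') :
    toOpMap (f ⊗ₘ g) ≫ (toOpTensor M' N').hom =
      (toOpTensor M N).hom ≫ (toOpMap g ⊗ₘ toOpMap f) :=
  HMod.hom_ext fun (t : M ⊗[k] N) => by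
    have h1 := tensorAct_map f.map_act g.map_act (drinfeldTwist k H : H ⊗[k] H) t
    change TensorProduct.comm k M' N' (tensorAct M'.act N'.act (drinfeldTwist k H : H ⊗[k] H)
      (TensorProduct.map f.lin g.lin t)) = TensorProduct.map g.lin f.lin
        (TensorProduct.comm k M N (twistAct M N t))
    rw [← h1, TensorProduct.map_comm]
    rfl

theorem assoc_symm_opAct (M N P : HMod k H) (z : H ⊗[k] (H ⊗[k] H)) (t : (M ⊗[k] N) ⊗[k] P) :
    (TensorProduct.assoc k P N M).symm (tensorAct (opAct P) (tensorAct (opAct N) (opAct M))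
      (o₃ (MulOpposite.opLinearEquiv k : H ≃ₗ[k] Hᵐᵒᵖ) z)
      (TensorProduct.map LinearMap.id (TensorProduct.comm k M N).toLinearMap
        (TensorProduct.comm k (M ⊗[k] N) P t))) =
    TensorProduct.map (TensorProduct.comm k N P).toLinearMap LinearMap.id
      (TensorProduct.comm k M (N ⊗[k] P) (tensorAct M.act (tensorAct N.act P.act)
        (antipodeReverse k H z) (TensorProduct.assoc k M N P t))) := by
  induction z using tensor₃_induction with
  | zero => simp
  | add x y hx hy => simp only [map_add, LinearMap.add_apply, hx, hy]
  | tmul a b c =>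
    induction t using TensorProduct.induction_on with
    | zero => simp
    | add x y hx hy => simp only [map_add, hx, hy]
    | tmul s p =>
      induction s using TensorProduct.induction_on with
      | zero => simp
      | add x y hx hy => simp only [map_add, TensorProduct.add_tmul, hx, hy]
      | tmul m n => simp

/-- The coherence of `toOpTensor` with the associators. The reversal of the factors turns the reversed
antipode of `Φ` into the inverse associator over `Hᵐᵒᵖ`. -/
theorem toOpTensor_assoc (M N P : HMod k H) :
    (toOpTensor (M ⊗ N) P).hom ≫ toOp P ◁ (toOpTensor M N).hom ≫
        (α_ (toOp P) (toOp N) (toOp M)).inv =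
      toOpMap (α_ M N P).hom ≫ (toOpTensor M (N ⊗ P)).hom ≫ (toOpTensor N P).hom ▷ toOp M :=
  HMod.hom_ext fun (t : (M ⊗[k] N) ⊗[k] P) => by
    have h1 := twistAct_assoc M N P t
    have h2 := assoc_symm_opAct M N P Φ
      (TensorProduct.map (twistAct M N) LinearMap.id (twistAct (M ⊗ N) P t))
    rw [← h1] at h2
    change (TensorProduct.assoc k P N M).symm (tensorAct (opAct P) (tensorAct (opAct N) (opAct M))
      (o₃ (MulOpposite.opLinearEquiv k : H ≃ₗ[k] Hᵐᵒᵖ) Φ)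
      (TensorProduct.map LinearMap.id ((TensorProduct.comm k M N).toLinearMap ∘ₗ twistAct M N)
        (TensorProduct.comm k (M ⊗[k] N) P (twistAct (M ⊗ N) P t)))) =
      TensorProduct.map ((TensorProduct.comm k N P).toLinearMap ∘ₗ twistAct N P) LinearMap.id
        (TensorProduct.comm k M (N ⊗[k] P) (twistAct M (N ⊗ P)
          (tensorAct M.act (tensorAct N.act P.act) Φ (TensorProduct.assoc k M N P t))))
    have h3 := map_id_comp_comm (twistAct M N) (TensorProduct.comm k M N).toLinearMap
      (twistAct (M ⊗ N) P t)
    have h4 := map_comp_id_comm (twistAct N P) (TensorProduct.comm k N P).toLinearMap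
      (twistAct M (N ⊗ P)
          (tensorAct M.act (tensorAct N.act P.act) Φ (TensorProduct.assoc k M N P t)))
    exact (congrArg (fun u => (TensorProduct.assoc k P N M).symm (tensorAct (opAct P)
      (tensorAct (opAct N) (opAct M)) (o₃ (MulOpposite.opLinearEquiv k : H ≃ₗ[k] Hᵐᵒᵖ) Φ) u))
        h3).trans (h2.trans h4.symm)

variable (k H) in
/-- The isomorphism `r ↦ ε(β) r` of the unit objects. -/
def toOpUnit : toOp (𝟙_ (HMod k H)) ≅ 𝟙_ (HMod k Hᵐᵒᵖ) :=
  HMod.mkIso (M := toOp (𝟙_ (HMod k H))) (N := 𝟙_ (HMod k Hᵐᵒᵖ))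
    (LinearEquiv.smulOfNeZero k k (Q.counit Q.beta)
      (left_ne_zero_of_mul_eq_one (counit_beta_mul_counit_alpha k H)))
    fun h (r : k) => by
      change Q.counit Q.beta * (Q.counit (Q.antipode h.unop) * r) =
        Q.counit h.unop * (Q.counit Q.beta * r)
      rw [counit_antipode]; ring

theorem toOpTensor_unit_left (N : HMod k H) :
    (toOpTensor (𝟙_ (HMod k H)) N).hom ≫ toOp N ◁ (toOpUnit k H).hom ≫ (ρ_ (toOp N)).hom =
      toOpMap (λ_ N).hom :=
  HMod.hom_ext fun (t : k ⊗[k] N) =>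
    (rid_map_smul_comm (Q.counit Q.beta) (toOpUnit k H).hom.lin (fun _ => rfl)
      (twistAct (𝟙_ (HMod k H)) N t)).trans (lid_twistAct N t)

theorem toOpTensor_unit_right (M : HMod k H) :
    (toOpTensor M (𝟙_ (HMod k H))).hom ≫ (toOpUnit k H).hom ▷ toOp M ≫ (λ_ (toOp M)).hom =
      toOpMap (ρ_ M).hom :=
  HMod.hom_ext fun (t : M ⊗[k] k) =>
    (lid_map_smul_comm (Q.counit Q.beta) (toOpUnit k H).hom.lin (fun _ => rfl)
      (twistAct M (𝟙_ (HMod k H)) t)).trans (rid_twistAct M t)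

variable (k H) in
/-- The functor from left modules to right modules that is given by the antipode. It reverses
tensor products, hence it takes values in the monoidal opposite. -/
def antipodeFunctor : HMod k H ⥤ (HMod k Hᵐᵒᵖ)ᴹᵒᵖ where
  obj V := .mop (toOp V)
  map f := (toOpMap f).mop

variable (k H) in
/-- The Drinfeld twist makes the antipode functor monoidal. -/
def antipodeFunctorCore : (antipodeFunctor k H).CoreMonoidal :=
  .mk' (toOpUnit k H).symm.mop (fun M N => (toOpTensor M N).symm.mop)
    (fun f X' => MonoidalOpposite.hom_ext (by
      have h := toOpTensor_natural f (𝟙 X')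
      rw [tensorHom_id] at h
      exact h.symm))
    (fun X' f => MonoidalOpposite.hom_ext (by
      have h := toOpTensor_natural (𝟙 X') f
      rw [id_tensorHom] at h
      exact h.symm))
    (fun M N P => MonoidalOpposite.hom_ext (toOpTensor_assoc M N P))
    (fun M => MonoidalOpposite.hom_ext (by
      have h := toOpTensor_unit_left M
      change (ρ_ (toOp M)).inv = toOpMap (λ_ M).inv ≫ (toOpTensor _ M).hom ≫ _ ◁ (toOpUnit k H).hom
      rw [← cancel_mono (ρ_ (toOp M)).hom, Iso.inv_hom_id, Category.assoc, Category.assoc, h]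
      exact (congrArg toOpMap (λ_ M).inv_hom_id).symm))
    (fun M => MonoidalOpposite.hom_ext (by
      have h := toOpTensor_unit_right M
      change (λ_ (toOp M)).inv = toOpMap (ρ_ M).inv ≫ (toOpTensor M _).hom ≫ (toOpUnit k H).hom ▷ _
      rw [← cancel_mono (λ_ (toOp M)).hom, Iso.inv_hom_id, Category.assoc, Category.assoc, h]
      exact (congrArg toOpMap (ρ_ M).inv_hom_id).symm))

end AntipodeFunctor

/-! ### Invertibility of right half-braidings -/

section InverseHalfBraiding

open MonoidalCategory

section Formal

variable {C : Type u} [Category.{v} C] [MonoidalCategory C] {X U D V W I : C}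

/-- A substitute for the inverse of the half-braiding at `V`. The object `D` plays the part of a
dual of `V` and `U` that of a space of vectors: `e` contracts `D ⊗ V` to an object `W` at which
the half-braiding has an inverse `w`, and `m` recovers a vector of `V`. The object `D` is braided
past `X` and contracted with `V`, the result is carried back past `X` by `w`, and `m` is
applied. -/
def contractionBraid (τ : RightHalfBraiding X) (e : D ⊗ V ⟶ W) (m : U ⊗ W ⟶ V)
    (w : X ⊗ W ⟶ W ⊗ X) : (U ⊗ D) ⊗ (X ⊗ V) ⟶ V ⊗ X :=
  (α_ U D (X ⊗ V)).hom ≫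
    U ◁ ((α_ D X V).inv ≫ τ.t D ▷ V ≫ (α_ X D V).hom ≫ X ◁ e ≫ w) ≫ (α_ U W X).inv ≫ m ▷ X

/-- The composition of `contractionBraid` with the half-braiding at `V` is the half-braiding at an
object `I` that acts on `V`, if contraction and recovery factor through this action. -/
theorem contractionBraid_comp (τ : RightHalfBraiding X) {e : D ⊗ V ⟶ W} {m : U ⊗ W ⟶ V}
    {w : X ⊗ W ⟶ W ⊗ X} (hw : w ≫ τ.t W = 𝟙 _) {p : U ⊗ D ⟶ I} {ev : I ⊗ V ⟶ V}
    (h : (α_ U D V).hom ≫ U ◁ e ≫ m = p ▷ V ≫ ev) :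
    contractionBraid τ e m w ≫ τ.t V =
      p ▷ (X ⊗ V) ≫ (α_ I X V).inv ≫ τ.t I ▷ V ≫ (α_ X I V).hom ≫ X ◁ ev := by
  have h1 : m ▷ X ≫ τ.t V = (α_ U W X).hom ≫ U ◁ τ.t W ≫ (α_ U X W).inv ≫ τ.t U ▷ W ≫
      (α_ X U W).hom ≫ X ◁ m := by
    rw [τ.natural, τ.hexagon']; simp
  calc
    _ = (α_ U D (X ⊗ V)).hom ≫ U ◁ ((α_ D X V).inv ≫ τ.t D ▷ V ≫ (α_ X D V).hom ≫ X ◁ e) ≫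
        U ◁ (w ≫ τ.t W) ≫ (α_ U X W).inv ≫ τ.t U ▷ W ≫ (α_ X U W).hom ≫ X ◁ m := by
      rw [contractionBraid]
      simp only [Category.assoc, h1, whiskerLeft_comp, Iso.inv_hom_id_assoc]
    _ = 𝟙 _ ⊗≫ U ◁ (τ.t D ▷ V) ⊗≫ ((U ⊗ X) ◁ e ≫ τ.t U ▷ W) ⊗≫ X ◁ m := by
      rw [hw]; monoidal
    _ = 𝟙 _ ⊗≫ U ◁ (τ.t D ▷ V) ⊗≫ τ.t U ▷ (D ⊗ V) ⊗≫ X ◁ U ◁ e ⊗≫ X ◁ m := by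
      rw [whisker_exchange]; monoidal
    _ = (α_ (U ⊗ D) X V).inv ≫ τ.t (U ⊗ D) ▷ V ≫ (α_ X (U ⊗ D) V).hom ≫
        X ◁ ((α_ U D V).hom ≫ U ◁ e ≫ m) := by
      rw [τ.hexagon']; monoidal
    _ = (α_ (U ⊗ D) X V).inv ≫ (τ.t (U ⊗ D) ≫ X ◁ p) ▷ V ≫ (α_ X I V).hom ≫ X ◁ ev := by
      rw [h]; monoidal
    _ = _ := by
      rw [← τ.natural]; monoidal

/-- If `b` is a unit of the action of `I` on `V`, the half-braiding at `I` disappears after `b`. -/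
theorem whiskerRight_comp_halfBraiding (τ : RightHalfBraiding X) {b : 𝟙_ C ⟶ I} {ev : I ⊗ V ⟶ V}
    (h : b ▷ V ≫ ev = (λ_ V).hom) :
    b ▷ (X ⊗ V) ≫ (α_ I X V).inv ≫ τ.t I ▷ V ≫ (α_ X I V).hom ≫ X ◁ ev = (λ_ (X ⊗ V)).hom := by
  calc
    _ = 𝟙 _ ⊗≫ (b ▷ X ≫ τ.t I) ▷ V ⊗≫ X ◁ ev := by monoidal
    _ = 𝟙 _ ⊗≫ X ◁ (b ▷ V ≫ ev) := by rw [τ.natural, τ.unit]; monoidal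
    _ = _ := by rw [h]; monoidal

/-- In the composition of the half-braiding at `V` with `contractionBraid`, all half-braidings cancel,
and only contraction and recovery remain. -/
theorem comp_contractionBraid (τ : RightHalfBraiding X) {e : D ⊗ V ⟶ W} (m : U ⊗ W ⟶ V)
    {w : X ⊗ W ⟶ W ⊗ X} (hw : τ.t W ≫ w = 𝟙 _) :
    (U ⊗ D) ◁ τ.t V ≫ contractionBraid τ e m w =
      (α_ U D (V ⊗ X)).hom ≫ U ◁ ((α_ D V X).inv ≫ e ▷ X) ≫ (α_ U W X).inv ≫ m ▷ X := by
  have h1 : (α_ D V X).inv ≫ e ▷ X ≫ τ.t W =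
      D ◁ τ.t V ≫ (α_ D X V).inv ≫ τ.t D ▷ V ≫ (α_ X D V).hom ≫ X ◁ e := by
    rw [τ.natural, τ.hexagon']; simp
  calc
    _ = (α_ U D (V ⊗ X)).hom ≫ U ◁ ((D ◁ τ.t V ≫ (α_ D X V).inv ≫ τ.t D ▷ V ≫ (α_ X D V).hom ≫
        X ◁ e) ≫ w) ≫ (α_ U W X).inv ≫ m ▷ X := by
      rw [contractionBraid]; monoidal
    _ = _ := by
      rw [← h1]; simp only [Category.assoc, hw, Category.comp_id]

end Formal
end InverseHalfBraiding

section InvertibleRightHalfBraiding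

-- Instances on fourfold tensor powers need a larger search.
set_option synthInstance.maxSize 2000
set_option maxSynthPendingDepth 6
set_option synthInstance.maxHeartbeats 400000

open MonoidalCategory
open scoped TensorProduct
open Algebra.TensorProduct (map assoc)

variable {k H : Type u} [Field k] [Ring H] [Algebra k H]

theorem isIso_of_bijective {M N : HMod k H} (f : M ⟶ N) (h : Function.Bijective f.lin) : IsIso f :=
  (HMod.mkIso (LinearEquiv.ofBijective f.lin h) f.map_act).isIso_hom

section Trivial

variable [Q : QuasiBialgebra k H]

local notation "Φinv" => ((Q.reassociator⁻¹ : (H ⊗[k] (H ⊗[k] H))ˣ) : H ⊗[k] (H ⊗[k] H))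

/-- The vector space `V` with the trivial action `h • v = ε(h) v`. -/
abbrev trivialize (V : HMod k H) : HMod k H where
  carrier := V
  act := (Algebra.ofId k (Module.End k V)).comp Q.counit

theorem tensorAct_trivialize_right (X V : HMod k H) (z : H ⊗[k] H) (t : X ⊗[k] V) :
    tensorAct X.act (trivialize V).act z t =
      TensorProduct.map (X.act (Algebra.TensorProduct.rid k k H (map (.id k H) Q.counit z)))
        LinearMap.id t := by
  induction t using TensorProduct.induction_on with
  | zero => simp
  | add x y hx hy => simp only [map_add, hx, hy]
  | tmul x v =>
    induction z using TensorProduct.induction_on with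
    | zero => simp
    | add x y hx hy => simp only [map_add, LinearMap.add_apply, TensorProduct.map_tmul,
        TensorProduct.add_tmul, hx, hy]
    | tmul a b =>
      simp [Algebra.ofId_apply, Module.algebraMap_end_apply, TensorProduct.smul_tmul]

theorem tensorAct_trivialize_left (X V : HMod k H) (z : H ⊗[k] H) (t : V ⊗[k] X) :
    tensorAct (trivialize V).act X.act z t =
      TensorProduct.map LinearMap.id
        (X.act (Algebra.TensorProduct.lid k H (map Q.counit (.id k H) z))) t := by
  induction t using TensorProduct.induction_on with
  | zero => simp
  | add x y hx hy => simp only [map_add, hx, hy]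
  | tmul x v =>
    induction z using TensorProduct.induction_on with
    | zero => simp
    | add x y hx hy => simp only [map_add, LinearMap.add_apply, TensorProduct.map_tmul,
        TensorProduct.tmul_add, hx, hy]
    | tmul a b =>
      simp [Algebra.ofId_apply, Module.algebraMap_end_apply, TensorProduct.smul_tmul]

/-- The flip of the tensor factors is a morphism if one of them is trivial. -/
def trivialSwap (X V : HMod k H) : X ⊗ trivialize V ≅ trivialize V ⊗ X :=
  HMod.mkIso (M := X ⊗ trivialize V) (N := trivialize V ⊗ X) (TensorProduct.comm k X V)
    fun h (t : X ⊗[k] V) => by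
      have h1 := tensorAct_trivialize_right X V (Q.comul h) t
      have h2 := tensorAct_trivialize_left X V (Q.comul h) (TensorProduct.comm k X V t)
      rw [Q.counit_right] at h1
      rw [Q.counit_left] at h2
      exact (congrArg _ h1).trans ((TensorProduct.map_comm _ _ _).symm.trans h2.symm)

/-- The associator is the usual one if the middle factor is trivial, since
`(id ⊗ ε ⊗ id)(Φ) = 1 ⊗ 1`. -/
theorem assoc_inv_trivialize (M V X : HMod k H) (t : M ⊗[k] (V ⊗[k] X)) :
    (α_ M (trivialize V) X).inv.lin t = (TensorProduct.assoc k M V X).symm t := by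
  have h1 : ∀ (z : H ⊗[k] (H ⊗[k] H)),
      tensorAct M.act (tensorAct (trivialize V).act X.act) z t =
        TensorProduct.leftComm k V M X (tensorAct (trivialize V).act (tensorAct M.act X.act)
          ((1 : H) ⊗ₜ[k] map (.id k H)
            ((Algebra.TensorProduct.lid k H).toAlgHom.comp (map Q.counit (.id k H))) z)
          (TensorProduct.leftComm k M V X t)) := by
    intro z
    induction z using tensor₃_induction with
    | zero => simp
    | add x y hx hy => simp only [TensorProduct.tmul_add, map_add, LinearMap.add_apply, hx, hy]
    | tmul a b c =>
      induction t using TensorProduct.induction_on with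
      | zero => simp
      | add x y hx hy => simp only [map_add, hx, hy]
      | tmul m s =>
        induction s using TensorProduct.induction_on with
        | zero => simp
        | add x y hx hy => simp only [map_add, TensorProduct.tmul_add, hx, hy]
        | tmul v x =>
          simp [Algebra.ofId_apply, Module.algebraMap_end_apply, TensorProduct.smul_tmul]
  refine congrArg (TensorProduct.assoc k M V X).symm ((h1 Φinv).trans ?_)
  rw [counit_reassociator_inv, ← Algebra.TensorProduct.one_def, map_one]
  exact (TensorProduct.leftComm k M V X).symm_apply_apply t

/-- At a trivial module, every half-braiding is the flip: by naturality in the morphisms `k ⟶ V` that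
are given by the vectors of `V`. -/
theorem halfBraiding_trivialize {X : HMod k H} (τ : RightHalfBraiding X) (V : HMod k H) :
    τ.t (trivialize V) = (trivialSwap X V).inv :=
  HMod.tensor_ext fun (v : V) x => by
    let f : 𝟙_ (HMod k H) ⟶ trivialize V := ⟨LinearMap.toSpanSingleton k V v, fun h (r : k) => by
      change (Q.counit h * r) • v = (Q.counit h • (1 : Module.End k V)) (r • v)
      rw [mul_smul]; rfl⟩
    have h := congrArg (fun f => HMod.Hom.lin f ((1 : k) ⊗ₜ[k] x : k ⊗[k] X)) (τ.natural f)
    rw [τ.unit] at h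
    have e1 : (f ▷ X).lin ((1 : k) ⊗ₜ[k] x : k ⊗[k] X) = (v ⊗ₜ[k] x : V ⊗[k] X) :=
      congrArg (· ⊗ₜ[k] x) (one_smul k v)
    refine (congrArg (τ.t (trivialize V)).lin e1).symm.trans (h.trans ?_)
    change TensorProduct.map LinearMap.id (LinearMap.toSpanSingleton k V v)
      ((TensorProduct.rid k X).symm (TensorProduct.lid k X ((1 : k) ⊗ₜ[k] x))) = x ⊗ₜ v
    simp

end Trivial

variable [Q : QuasiHopfAlgebra k H]

local notation "Φ" => (Q.reassociator : H ⊗[k] (H ⊗[k] H))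
local notation "Φinv" => ((Q.reassociator⁻¹ : (H ⊗[k] (H ⊗[k] H))ˣ) : H ⊗[k] (H ⊗[k] H))

variable (k H) in
/-- The algebra `H` with the left action `h • d = d S(h)`. -/
abbrev antipodeRegular : HMod k H where
  carrier := H
  act := .ofLinearMap ((LinearMap.mul k H).flip ∘ₗ Q.antipode.toLinearMap)
    (by ext; simp [Q.antipode_one]) (by intro a b; ext; simp [Q.antipode_mul, mul_assoc])

/-- The contraction `d ⊗ v ↦ d α • v`, with values in the trivial module on `V`. -/
def contraction (V : HMod k H) : antipodeRegular k H ⊗ V ⟶ trivialize V where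
  lin := TensorProduct.lift (M := H) (N := V) (V.act.toLinearMap ∘ₗ LinearMap.mulRight k Q.alpha)
  map_act h (t : H ⊗[k] V) := by
    have : ∀ z : H ⊗[k] H, TensorProduct.lift (V.act.toLinearMap ∘ₗ LinearMap.mulRight k Q.alpha)
        (tensorAct (antipodeRegular k H).act V.act z t) =
        TensorProduct.lift V.act.toLinearMap
          (TensorProduct.map (LinearMap.mulRight k (alphaMap k H z)) LinearMap.id t) := by
      intro z
      induction t using TensorProduct.induction_on with
      | zero => simp
      | add x y hx hy => simp only [map_add, hx, hy]
      | tmul d v =>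
        induction z using TensorProduct.induction_on with
        | zero => simp
        | add x y hx hy =>
          simp only [map_add, LinearMap.add_apply, hx, hy]
          simp [mul_add]
        | tmul a b => simp [mul_assoc]
    refine (this (Q.comul h)).trans ?_
    change _ = (Q.counit h • (1 : Module.End k V))
      (TensorProduct.lift (V.act.toLinearMap ∘ₗ LinearMap.mulRight k Q.alpha) t)
    rw [alphaMap_comul]
    clear this
    induction t using TensorProduct.induction_on with
    | zero => simp
    | add x y hx hy => rw [map_add, map_add, map_add, map_add, hx, hy]
    | tmul d v => simp

/-- The map `u ⊗ v ↦ u • v`, where `V` carries the trivial action. -/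
def actMap (V : HMod k H) : HMod.regular k H ⊗ trivialize V ⟶ V where
  lin := TensorProduct.lift (M := H) (N := V) V.act.toLinearMap
  map_act h (t : H ⊗[k] V) := by
    refine (congrArg (TensorProduct.lift V.act.toLinearMap)
      (tensorAct_trivialize_right (HMod.regular k H) V (Q.comul h) t)).trans ?_
    rw [Q.counit_right]
    change TensorProduct.lift V.act.toLinearMap
      (TensorProduct.map (Algebra.lmul k H h) LinearMap.id t) =
        V.act h (TensorProduct.lift V.act.toLinearMap t)
    induction t using TensorProduct.induction_on with
    | zero => simp
    | add x y hx hy => simp only [map_add, hx, hy]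
    | tmul d v => simp

/-- The map `u ⊗ d ↦ (v ↦ u d • v)`. -/
def mulToHom (V : HMod k H) : HMod.regular k H ⊗ antipodeRegular k H ⟶ ihom V V where
  lin := V.act.toLinearMap ∘ₗ LinearMap.mul' k H
  map_act h (t : H ⊗[k] H) := by
    have : ∀ z : H ⊗[k] H, V.act (LinearMap.mul' k H (tensorAct (Algebra.lmul k H)
        (antipodeRegular k H).act z t)) = homAct V V z (V.act (LinearMap.mul' k H t)) := by
      intro z
      induction t using TensorProduct.induction_on with
      | zero => simp
      | add x y hx hy => simp only [map_add, hx, hy]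
      | tmul u d =>
        induction z using TensorProduct.induction_on with
        | zero => simp
        | add x y hx hy => simp only [map_add, LinearMap.add_apply, hx, hy]
        | tmul a b => ext v; simp
    exact this (Q.comul h)

/-- The map `r ↦ (v ↦ r β • v)`. -/
def betaHom (V : HMod k H) : 𝟙_ (HMod k H) ⟶ ihom V V where
  lin := LinearMap.toSpanSingleton k (Module.End k V) (V.act Q.beta)
  map_act h (r : k) := by
    have : ∀ z : H ⊗[k] H, homAct V V z (V.act Q.beta) = V.act (betaMap k H z) := by
      intro z
      induction z using TensorProduct.induction_on with
      | zero => simp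
      | add x y hx hy => simp only [map_add, LinearMap.add_apply, hx, hy]
      | tmul a b => ext v; simp
    change (Q.counit h * r) • V.act Q.beta = homAct V V (Q.comul h) (r • V.act Q.beta)
    rw [map_smul, this, betaMap_comul, map_smul, smul_smul, mul_comm]

/-- Contraction and action factor through the evaluation of endomorphisms. -/
theorem contraction_actMap (V : HMod k H) :
    (α_ (HMod.regular k H) (antipodeRegular k H) V).hom ≫
      HMod.regular k H ◁ contraction V ≫ actMap V = mulToHom V ▷ V ≫ ihomEv V V :=
  HMod.Hom.ext (TensorProduct.ext_threefold (M := H) (N := H) (P := V) fun u d v => by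
    have : ∀ z : H ⊗[k] (H ⊗[k] H), TensorProduct.lift V.act.toLinearMap
        (TensorProduct.map LinearMap.id
          (TensorProduct.lift (V.act.toLinearMap ∘ₗ LinearMap.mulRight k Q.alpha))
          (tensorAct (Algebra.lmul k H) (tensorAct (antipodeRegular k H).act V.act) z
            (u ⊗ₜ (d ⊗ₜ v)))) =
        evalAt V V (TensorProduct.map LinearMap.id (alphaMap k H) z) (V.act (u * d) ⊗ₜ v) := by
      intro z
      induction z using tensor₃_induction with
      | zero => simp
      | add x y hx hy => simp only [map_add, LinearMap.add_apply, evalAt_add, hx, hy]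
      | tmul a b c => simp
    exact this Φ)

/-- The endomorphism `β` evaluates to the identity, by `X¹ β S(X²) α X³ = 1`. -/
theorem betaHom_ev (V : HMod k H) : betaHom V ▷ V ≫ ihomEv V V = (λ_ V).hom :=
  HMod.tensor_ext fun (r : k) v => by
    have : ∀ z : H ⊗[k] (H ⊗[k] H),
        evalAt V V (TensorProduct.map LinearMap.id (alphaMap k H) z) ((r • V.act Q.beta) ⊗ₜ v) =
          r • V.act (betaAlphaMap k H z) v := by
      intro z
      induction z using tensor₃_induction with
      | zero => simp
      | add x y hx hy => simp only [map_add, LinearMap.add_apply, evalAt_add, hx, hy, smul_add]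
      | tmul a b c => simp
    refine (this Φ).trans ?_
    rw [betaAlphaMap_reassociator, map_one]
    rfl

theorem actMap_contraction_aux (V X : HMod k H) (y : H ⊗[k] (H ⊗[k] H))
    (z : H ⊗[k] (H ⊗[k] (H ⊗[k] H))) (t : V ⊗[k] X) :
    TensorProduct.map (TensorProduct.lift V.act.toLinearMap) LinearMap.id
      ((TensorProduct.assoc k H V X).symm (TensorProduct.map LinearMap.id
        (TensorProduct.map (TensorProduct.lift (V.act.toLinearMap ∘ₗ LinearMap.mulRight k Q.alpha))
            LinearMap.id ∘ₗ (TensorProduct.assoc k H V X).symm.toLinearMap ∘ₗ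
          tensorAct (antipodeRegular k H).act (tensorAct V.act X.act) y)
        (tensorAct (Algebra.lmul k H) (tensorAct (antipodeRegular k H).act
          (tensorAct V.act X.act)) z (Q.beta ⊗ₜ[k] ((1 : H) ⊗ₜ[k] t))))) =
      tensorAct V.act X.act (betaAlphaMapL k H (oneTmul k H y * z)) t := by
  rw [oneTmul]
  induction t using TensorProduct.induction_on with
  | zero => simp
  | add x y hx hy => simp only [TensorProduct.tmul_add, map_add, hx, hy]
  | tmul v x =>
    induction z using tensor₄_induction with
    | zero => simp
    | add x y hx hy => simp only [mul_add, map_add, LinearMap.add_apply, hx, hy]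
    | tmul a b c d =>
      induction y using tensor₃_induction with
      | zero => simp
      | add x y hx hy =>
        simp only [TensorProduct.tmul_add, add_mul, map_add, LinearMap.add_apply, ← hx, ← hy]
        simp [TensorProduct.tmul_add]
      | tmul e f g => simp [Q.antipode_mul, mul_assoc]

/-- At `u ⊗ d = β ⊗ 1`, contraction and action reproduce the vector, by
`X¹ β S(y¹ X²) α y² X³₁ ⊗ y³ X³₂ = 1 ⊗ 1`. -/
theorem actMap_contraction (V X : HMod k H) (t : V ⊗[k] X) :
    ((α_ (HMod.regular k H) (antipodeRegular k H) (V ⊗ X)).hom ≫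
      HMod.regular k H ◁ ((α_ (antipodeRegular k H) V X).inv ≫ contraction V ▷ X) ≫
        (α_ (HMod.regular k H) (trivialize V) X).inv ≫ actMap V ▷ X).lin
      ((Q.beta ⊗ₜ[k] (1 : H)) ⊗ₜ[k] t : (H ⊗[k] H) ⊗[k] (V ⊗[k] X)) = t := by
  have h1 := tensorAct_comp (ρ := Algebra.lmul k H)
    (σ := tensorAct (antipodeRegular k H).act (tensorAct V.act X.act)) (.id k H)
    (map (.id k H) Q.comul) Φ
  have h2 : tensorAct (antipodeRegular k H).act ((tensorAct V.act X.act).comp Q.comul) =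
      (tensorAct (antipodeRegular k H).act (tensorAct V.act X.act)).comp
        (map (.id k H) Q.comul) :=
    AlgHom.ext fun t => by
      have := tensorAct_comp (ρ := (antipodeRegular k H).act) (σ := tensorAct V.act X.act)
        (.id k H) Q.comul t
      rwa [AlgHom.comp_id] at this
  rw [AlgHom.comp_id, ← h2] at h1
  have h3 := actMap_contraction_aux V X Φinv (map (.id k H) (map (.id k H) Q.comul) Φ) t
  rw [betaAlphaMapL_oneTmul_mul, map_one, ← h1] at h3
  refine Eq.trans ?_ h3
  exact congrArg (TensorProduct.map (TensorProduct.lift V.act.toLinearMap) LinearMap.id)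
    (assoc_inv_trivialize (HMod.regular k H) V X _)

/-- Over a quasi-Hopf algebra, right half-braidings are invertible. The inverse is
`contractionBraid`, evaluated at `β ⊗ 1` in `H ⊗ H`. -/
theorem RightHalfBraiding.isIso_t {X : HMod k H} (τ : RightHalfBraiding X) (V : HMod k H) :
    IsIso (τ.t V) := by
  have h1 := contractionBraid_comp τ (e := contraction V) (m := actMap V)
    (w := (trivialSwap X V).hom) (by rw [halfBraiding_trivialize, Iso.hom_inv_id])
    (contraction_actMap V)
  have h2 := whiskerRight_comp_halfBraiding τ (betaHom_ev V)
  have h3 := comp_contractionBraid τ (e := contraction V) (actMap V)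
    (w := (trivialSwap X V).hom) (by rw [halfBraiding_trivialize, Iso.inv_hom_id])
  refine isIso_of_bijective _ (Function.bijective_iff_has_inverse.mpr
    ⟨fun z => (contractionBraid τ (contraction V) (actMap V) (trivialSwap X V).hom).lin
      ((Q.beta ⊗ₜ[k] (1 : H)) ⊗ₜ[k] z : (H ⊗[k] H) ⊗[k] (X ⊗[k] V)),
      fun (z : V ⊗[k] X) => ?_, fun (z : X ⊗[k] V) => ?_⟩)
  · have h4 := congrArg (fun f => HMod.Hom.lin f
      ((Q.beta ⊗ₜ[k] (1 : H)) ⊗ₜ[k] z : (H ⊗[k] H) ⊗[k] (V ⊗[k] X))) h3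
    exact h4.trans (actMap_contraction V X z)
  · have h4 := congrArg (fun f => HMod.Hom.lin f
      ((Q.beta ⊗ₜ[k] (1 : H)) ⊗ₜ[k] z : (H ⊗[k] H) ⊗[k] (X ⊗[k] V))) h1
    have h5 := congrArg (fun f => HMod.Hom.lin f
      ((1 : k) ⊗ₜ[k] z : k ⊗[k] (X ⊗[k] V))) h2
    refine h4.trans (Eq.trans ?_ (h5.trans (one_smul k z)))
    have h6 : V.act (Q.beta * 1) = (1 : k) • V.act Q.beta := by rw [mul_one, one_smul]
    exact congrArg ((α_ (ihom V V) X V).inv ≫ τ.t (ihom V V) ▷ V ≫ (α_ X (ihom V V) V).hom ≫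
      X ◁ ihomEv V V).lin (congrArg (fun F : V →ₗ[k] V => (F ⊗ₜ[k] z :
        (V →ₗ[k] V) ⊗[k] (X ⊗[k] V))) h6)

end InvertibleRightHalfBraiding

/-! ### Transport of half-braidings along a monoidal equivalence -/

open MonoidalCategory

section Transport

variable {C D : Type u} [Category.{v} C] [MonoidalCategory C] [Category.{v} D] [MonoidalCategory D]

open Functor.LaxMonoidal Functor.OplaxMonoidal

namespace LeftHalfBraiding

section Map

variable (F : C ⥤ D) [F.Monoidal] {X Y : C} (σ : LeftHalfBraiding X) (τ : LeftHalfBraiding Y)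

/-- The image of a half-braiding under a monoidal functor, at the objects in the image of the
functor. -/
def mapS (U : C) : F.obj X ⊗ F.obj U ⟶ F.obj U ⊗ F.obj X := μ F X U ≫ F.map (σ.s U) ≫ δ F U X

theorem mapS_natural {U V : C} (f : U ⟶ V) :
    F.obj X ◁ F.map f ≫ mapS F σ V = mapS F σ U ≫ F.map f ▷ F.obj X := by
  simp only [mapS, Category.assoc, δ_natural_left, μ_natural_right_assoc, ← F.map_comp_assoc,
    σ.natural]

theorem mapS_hexagon (U V : C) :
    (α_ (F.obj X) (F.obj U) (F.obj V)).hom ≫ F.obj X ◁ μ F U V ≫ mapS F σ (U ⊗ V) ≫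
        δ F U V ▷ F.obj X ≫ (α_ (F.obj U) (F.obj V) (F.obj X)).hom =
      mapS F σ U ▷ F.obj V ≫ (α_ (F.obj U) (F.obj X) (F.obj V)).hom ≫
        F.obj U ◁ mapS F σ V := by
  rw [mapS, hexagon']
  simp only [mapS, Functor.map_comp, Functor.Monoidal.map_associator,
    Functor.Monoidal.map_associator_inv, Functor.Monoidal.map_whiskerLeft,
    Functor.Monoidal.map_whiskerRight, Category.assoc, comp_whiskerRight, whiskerLeft_comp,
    Functor.Monoidal.μ_δ_assoc, Functor.Monoidal.whiskerLeft_μ_δ_assoc,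
    Functor.Monoidal.whiskerRight_μ_δ_assoc, Category.comp_id, Iso.inv_hom_id,
    Iso.hom_inv_id_assoc, Functor.Monoidal.μ_δ]

end Map

section EssSurj

variable {B : Type u} [Category.{v} B] (F : B ⥤ D) [F.EssSurj]

/-- Whether a morphism is compatible with half-braidings can be tested on the image of an
essentially surjective functor. -/
theorem isHom_of_obj {X' Y' : D} {σ' : LeftHalfBraiding X'} {τ' : LeftHalfBraiding Y'}
    {f : X' ⟶ Y'} (h : ∀ V : B, f ▷ F.obj V ≫ τ'.s (F.obj V) = σ'.s (F.obj V) ≫ F.obj V ◁ f) :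
    IsHom σ' τ' f := fun W => by
  have e := F.objObjPreimageIso W
  rw [← cancel_epi (X' ◁ e.hom), whisker_exchange_assoc, τ'.natural, reassoc_of% h,
    reassoc_of% σ'.natural e.hom, ← whisker_exchange]

end EssSurj

section Transport

variable (F : C ⥤ D) [F.Monoidal] [F.Full] [F.EssSurj] {X Y : C} (σ : LeftHalfBraiding X)
  (τ : LeftHalfBraiding Y)

/-- The half-braiding of `F X` at an arbitrary object `W`, which is replaced by an isomorphic object
in the image of `F`. -/
def transportS (W : D) : F.obj X ⊗ W ⟶ W ⊗ F.obj X :=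
  F.obj X ◁ (F.objObjPreimageIso W).inv ≫ mapS F σ (F.objPreimage W) ≫
    (F.objObjPreimageIso W).hom ▷ F.obj X

/-- The half-braiding `transportS` does not depend on the choice of an object in the image of `F`. -/
theorem whiskerLeft_transportS {V : C} {W : D} (g : F.obj V ⟶ W) :
    F.obj X ◁ g ≫ transportS F σ W = mapS F σ V ≫ g ▷ F.obj X := by
  obtain ⟨g', hg⟩ := F.map_surjective (g ≫ (F.objObjPreimageIso W).inv)
  have e : g = F.map g' ≫ (F.objObjPreimageIso W).hom := by rw [hg]; simp
  rw [transportS, ← whiskerLeft_comp_assoc, ← hg, reassoc_of% mapS_natural F σ g',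
    ← comp_whiskerRight, ← e]

/-- Transport of a half-braiding along a monoidal equivalence. -/
def transport : LeftHalfBraiding (F.obj X) where
  s := transportS F σ
  natural {W W'} f := by
    rw [← cancel_epi (F.obj X ◁ (F.objObjPreimageIso W).hom), ← whiskerLeft_comp_assoc,
      whiskerLeft_transportS, reassoc_of% whiskerLeft_transportS F σ, comp_whiskerRight]
  hexagon U V := by
    obtain ⟨A, ⟨i⟩⟩ : ∃ A, Nonempty (F.obj A ≅ U) := ⟨_, ⟨F.objObjPreimageIso U⟩⟩
    obtain ⟨B, ⟨j⟩⟩ : ∃ B, Nonempty (F.obj B ≅ V) := ⟨_, ⟨F.objObjPreimageIso V⟩⟩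
    have h1 := whiskerLeft_transportS F σ (δ F A B ≫ (i.hom ⊗ₘ j.hom))
    have h2 : F.obj X ◁ (i.hom ⊗ₘ j.hom) ≫ transportS F σ (U ⊗ V) = F.obj X ◁ μ F A B ≫
        mapS F σ (A ⊗ B) ≫ δ F A B ▷ F.obj X ≫ (i.hom ⊗ₘ j.hom) ▷ F.obj X := by
      rw [← comp_whiskerRight, ← h1]
      simp
    have hi := whiskerLeft_transportS F σ i.hom
    have hj := whiskerLeft_transportS F σ j.hom
    rw [← cancel_epi ((F.obj X ◁ i.hom) ▷ F.obj B ≫ (F.obj X ⊗ U) ◁ j.hom)]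
    calc
      _ = (α_ _ _ _).hom ≫ (F.obj X ◁ (i.hom ⊗ₘ j.hom) ≫ transportS F σ (U ⊗ V)) ≫
          (α_ U V (F.obj X)).hom := by rw [MonoidalCategory.tensorHom_def]; simp
      _ = ((α_ (F.obj X) (F.obj A) (F.obj B)).hom ≫ F.obj X ◁ μ F A B ≫ mapS F σ (A ⊗ B) ≫
          δ F A B ▷ F.obj X ≫ (α_ (F.obj A) (F.obj B) (F.obj X)).hom) ≫
            i.hom ▷ (F.obj B ⊗ F.obj X) ≫ U ◁ j.hom ▷ F.obj X := by
        rw [h2, MonoidalCategory.tensorHom_def]; simp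
      _ = 𝟙 _ ⊗≫ mapS F σ A ▷ F.obj B ⊗≫ (F.obj A ◁ mapS F σ B ≫ i.hom ▷ (F.obj B ⊗ F.obj X)) ≫
          U ◁ j.hom ▷ F.obj X := by
        rw [mapS_hexagon]; monoidal
      _ = 𝟙 _ ⊗≫ (mapS F σ A ≫ i.hom ▷ F.obj X) ▷ F.obj B ⊗≫
          U ◁ (mapS F σ B ≫ j.hom ▷ F.obj X) := by
        rw [whisker_exchange]; monoidal
      _ = 𝟙 _ ⊗≫ F.obj X ◁ i.hom ▷ F.obj B ⊗≫ (transportS F σ U ▷ F.obj B ≫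
          (U ⊗ F.obj X) ◁ j.hom) ⊗≫ U ◁ transportS F σ V := by
        rw [← hi, ← hj]; monoidal
      _ = _ := by
        rw [← whisker_exchange]; monoidal
  unit := by
    have h1 := whiskerLeft_transportS F σ (η F)
    rw [← cancel_epi (F.obj X ◁ η F), h1, mapS, σ.unit]
    simp [Functor.OplaxMonoidal.left_unitality]

theorem whiskerLeft_transport_s {V : C} {W : D} (g : F.obj V ⟶ W) :
    F.obj X ◁ g ≫ (transport F σ).s W = mapS F σ V ≫ g ▷ F.obj X :=
  whiskerLeft_transportS F σ g

theorem transport_s_obj (V : C) : (transport F σ).s (F.obj V) = mapS F σ V := by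
  simpa using whiskerLeft_transport_s F σ (𝟙 (F.obj V))

theorem isHom_transport {f : X ⟶ Y} (hf : IsHom σ τ f) :
    IsHom (transport F σ) (transport F τ) (F.map f) :=
  isHom_of_obj F fun V => by
    rw [transport_s_obj, transport_s_obj, mapS, mapS, μ_natural_left_assoc, ← F.map_comp_assoc,
      hf V]
    simp

theorem isHom_of_transport [F.Faithful] {f : X ⟶ Y}
    (hf : IsHom (transport F σ) (transport F τ) (F.map f)) : IsHom σ τ f := fun V => by
  have h := hf (F.obj V)
  rw [transport_s_obj, transport_s_obj, mapS, mapS] at h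
  apply F.map_injective
  rw [← cancel_epi (μ F X V), ← cancel_mono (δ F V Y)]
  simpa [μ_natural_left_assoc] using h

theorem isHom_transport_μ : IsHom ((transport F σ).tensor (transport F τ))
    (transport F (σ.tensor τ)) (μ F X Y) :=
  isHom_of_obj F fun V => by
    simp only [tensor, transport_s_obj, mapS]
    simp only [Functor.map_comp, Functor.Monoidal.map_associator,
      Functor.Monoidal.map_associator_inv, Functor.Monoidal.map_whiskerLeft,
      Functor.Monoidal.map_whiskerRight, Category.assoc, comp_whiskerRight, whiskerLeft_comp,
      Functor.Monoidal.μ_δ_assoc, Functor.Monoidal.whiskerRight_μ_δ_assoc, Category.comp_id,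
      Functor.Monoidal.μ_δ]

theorem isHom_transport_ε : IsHom (tensorUnit D) (transport F (tensorUnit C)) (ε F) :=
  isHom_of_obj F fun V => by
    simp only [tensorUnit, transport_s_obj, mapS]
    simp

theorem isHom_inv {X' Y' : C} {σ' : LeftHalfBraiding X'} {τ' : LeftHalfBraiding Y'} (e : X' ≅ Y')
    (h : IsHom σ' τ' e.hom) : IsHom τ' σ' e.inv := fun U => by
  rw [← cancel_epi (e.hom ▷ U), ← cancel_mono (U ◁ e.hom)]
  simp [h U]

/-- A half-braiding is determined by its transport, at the objects in the image of `F`. -/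
theorem transport_injective [F.Faithful] :
    Function.Injective (transport F : LeftHalfBraiding X → LeftHalfBraiding (F.obj X)) :=
  fun σ τ h => ext' fun V => by
    have := congrArg (fun ρ : LeftHalfBraiding (F.obj X) => ρ.s (F.obj V)) h
    simpa only [transport_s_obj, mapS, cancel_epi, cancel_mono, F.map_injective.eq_iff] using this

/-- Every half-braiding of `F X` is a transport, since it lifts along the full functor `F` at the
objects in the image of `F`. -/
theorem transport_surjective [F.Faithful] :
    Function.Surjective (transport F : LeftHalfBraiding X → LeftHalfBraiding (F.obj X)) := by
  intro ρ
  choose s hs using fun V => F.map_surjective (δ F X V ≫ ρ.s (F.obj V) ≫ μ F V X)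
  refine ⟨⟨s, fun {U V} f => F.map_injective ?_, fun U V => F.map_injective ?_,
    F.map_injective ?_⟩, ext' fun W => ?_⟩
  · simp only [F.map_comp, hs, Category.assoc, ← δ_natural_right_assoc, ← μ_natural_left,
      reassoc_of% ρ.natural (F.map f)]
  · have h := ρ.natural (δ F U V)
    rw [← cancel_mono (μ F U V ▷ F.obj X), Category.assoc, Category.assoc,
      Functor.Monoidal.whiskerRight_δ_μ, Category.comp_id, hexagon'] at h
    simp only [F.map_comp, hs, ← h, Functor.Monoidal.map_associator,
      Functor.Monoidal.map_whiskerLeft, Functor.Monoidal.map_whiskerRight, Category.assoc,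
      comp_whiskerRight, whiskerLeft_comp, Functor.Monoidal.μ_δ_assoc,
      Functor.Monoidal.whiskerLeft_μ_δ_assoc, Functor.Monoidal.whiskerRight_μ_δ_assoc,
      Iso.inv_hom_id_assoc, Iso.hom_inv_id_assoc]
  · rw [hs]
    have h := ρ.natural (η F)
    rw [← cancel_mono (ε F ▷ F.obj X), Category.assoc, Category.assoc,
      Functor.Monoidal.whiskerRight_η_ε, Category.comp_id, ρ.unit] at h
    rw [← h]
    simp
  · rw [← cancel_epi (F.obj X ◁ (F.objObjPreimageIso W).hom), whiskerLeft_transport_s]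
    refine Eq.trans ?_ (ρ.natural (F.objObjPreimageIso W).hom).symm
    simp [mapS, hs]

theorem isIso_of_transport [F.Faithful] (h : ∀ W, IsIso ((transport F σ).s W)) (V : C) :
    IsIso (σ.s V) := by
  have h1 := h (F.obj V)
  rw [transport_s_obj, mapS] at h1
  have h2 : IsIso (F.map (σ.s V)) := by
    have : F.map (σ.s V) = δ F X V ≫ (μ F X V ≫ F.map (σ.s V) ≫ δ F V X) ≫ μ F V X := by simp
    rw [this]
    infer_instance
  exact isIso_of_reflects_iso _ F

end Transport

end LeftHalfBraiding
end Transport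

/-! ### The opposite of a quasi-Hopf algebra -/

section OppositeQuasiHopf

open scoped TensorProduct

variable {k H : Type u} [Field k] [Ring H] [Algebra k H] [Q : QuasiHopfAlgebra k H]

theorem antipode_symm_mul (a b : H) :
    Q.antipode.symm (a * b) = Q.antipode.symm b * Q.antipode.symm a :=
  Q.antipode.injective (by simp [Q.antipode_mul])

theorem antipode_symm_one : Q.antipode.symm 1 = 1 :=
  Q.antipode.injective (by simp [Q.antipode_one])

variable (k H) in
/-- The opposite of a quasi-Hopf algebra, with the antipode `S⁻¹` and the elements `S⁻¹(β)` and
`S⁻¹(α)`. -/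
instance opQuasiHopfAlgebra : QuasiHopfAlgebra k Hᵐᵒᵖ where
  toQuasiBialgebra := opQuasiBialgebra k H
  antipode := (MulOpposite.opLinearEquiv k).symm.trans
    (Q.antipode.symm.trans (MulOpposite.opLinearEquiv k))
  antipode_one := by simp [antipode_symm_one]
  antipode_mul g h := by simp [antipode_symm_mul]
  alpha := .op (Q.antipode.symm Q.beta)
  beta := .op (Q.antipode.symm Q.alpha)
  antipode_alpha h := by
    have : ∀ z : H ⊗[k] H, LinearMap.mul' k Hᵐᵒᵖ (TensorProduct.map (LinearMap.mulRight k
        (.op (Q.antipode.symm Q.beta)) ∘ₗ ((MulOpposite.opLinearEquiv k).symm.trans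
          (Q.antipode.symm.trans (MulOpposite.opLinearEquiv k))).toLinearMap) LinearMap.id
          (o₂ (MulOpposite.opLinearEquiv k : H ≃ₗ[k] Hᵐᵒᵖ) z)) =
        .op (Q.antipode.symm (betaMap k H z)) := by
      intro z
      induction z using TensorProduct.induction_on with
      | zero => simp
      | add x y hx hy => simp only [map_add, hx, hy, MulOpposite.op_add]
      | tmul a b => simp [antipode_symm_mul, ← MulOpposite.op_mul, mul_assoc]
    refine (this (Q.comul h.unop)).trans ?_
    rw [betaMap_comul, map_smul]; rfl
  antipode_beta h := by
    have : ∀ z : H ⊗[k] H, LinearMap.mul' k Hᵐᵒᵖ (TensorProduct.map (LinearMap.mulRight k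
        (.op (Q.antipode.symm Q.alpha))) ((MulOpposite.opLinearEquiv k).symm.trans
          (Q.antipode.symm.trans (MulOpposite.opLinearEquiv k))).toLinearMap
          (o₂ (MulOpposite.opLinearEquiv k : H ≃ₗ[k] Hᵐᵒᵖ) z)) =
        .op (Q.antipode.symm (alphaMap k H z)) := by
      intro z
      induction z using TensorProduct.induction_on with
      | zero => simp
      | add x y hx hy => simp only [map_add, hx, hy, MulOpposite.op_add]
      | tmul a b => simp [antipode_symm_mul, ← MulOpposite.op_mul, mul_assoc]
    refine (this (Q.comul h.unop)).trans ?_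
    rw [alphaMap_comul, map_smul]; rfl
  antipode_reassociator := by
    have : ∀ z : H ⊗[k] (H ⊗[k] H), LinearMap.mul' k Hᵐᵒᵖ (TensorProduct.map (LinearMap.mulRight k
        (.op (Q.antipode.symm Q.alpha))) (LinearMap.mul' k Hᵐᵒᵖ ∘ₗ TensorProduct.map
        (LinearMap.mulRight k (.op (Q.antipode.symm Q.beta)) ∘ₗ
          ((MulOpposite.opLinearEquiv k).symm.trans
          (Q.antipode.symm.trans (MulOpposite.opLinearEquiv k))).toLinearMap) LinearMap.id)
          (o₃ (MulOpposite.opLinearEquiv k : H ≃ₗ[k] Hᵐᵒᵖ) z)) =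
        .op (Q.antipode.symm (alphaBetaMap k H z)) := by
      intro z
      induction z using tensor₃_induction with
      | zero => simp
      | add x y hx hy => simp only [map_add, hx, hy, MulOpposite.op_add]
      | tmul a b c => simp [alphaBetaMap_tmul, antipode_symm_mul, ← MulOpposite.op_mul, mul_assoc]
    refine (this ((Q.reassociator⁻¹ : (H ⊗[k] (H ⊗[k] H))ˣ) : H ⊗[k] (H ⊗[k] H))).trans ?_
    rw [alphaBetaMap_reassociator_inv, antipode_symm_one]; rfl
  antipode_reassociator_inv := by
    have : ∀ z : H ⊗[k] (H ⊗[k] H), LinearMap.mul' k Hᵐᵒᵖ (TensorProduct.map (LinearMap.mulRight k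
        (.op (Q.antipode.symm Q.beta)) ∘ₗ ((MulOpposite.opLinearEquiv k).symm.trans
          (Q.antipode.symm.trans (MulOpposite.opLinearEquiv k))).toLinearMap)
        (LinearMap.mul' k Hᵐᵒᵖ ∘ₗ TensorProduct.map
          (LinearMap.mulRight k (.op (Q.antipode.symm Q.alpha)))
          ((MulOpposite.opLinearEquiv k).symm.trans
          (Q.antipode.symm.trans (MulOpposite.opLinearEquiv k))).toLinearMap)
          (o₃ (MulOpposite.opLinearEquiv k : H ≃ₗ[k] Hᵐᵒᵖ) z)) =
        .op (Q.antipode.symm (betaAlphaMap k H z)) := by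
      intro z
      induction z using tensor₃_induction with
      | zero => simp
      | add x y hx hy => simp only [map_add, hx, hy, MulOpposite.op_add]
      | tmul a b c => simp [antipode_symm_mul, ← MulOpposite.op_mul, mul_assoc]
    refine (this (Q.reassociator : H ⊗[k] (H ⊗[k] H))).trans ?_
    rw [betaAlphaMap_reassociator, antipode_symm_one]; rfl

end OppositeQuasiHopf

open MonoidalCategory

/-! ### Half-braidings in the monoidal opposite, and inverse half-braidings -/

section Mop

variable {C : Type u} [Category.{v} C] [MonoidalCategory C]

/-- A left half-braiding in the monoidal opposite is a right half-braiding. -/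
def LeftHalfBraiding.unmop {X : Cᴹᵒᵖ} (σ : LeftHalfBraiding X) : RightHalfBraiding X.unmop where
  t U := (σ.s (.mop U)).unmop
  natural f := congrArg Quiver.Hom.unmop (σ.natural f.mop)
  hexagon U V := congrArg Quiver.Hom.unmop (σ.hexagon (.mop V) (.mop U))
  unit := congrArg Quiver.Hom.unmop σ.unit

/-- A right half-braiding is a left half-braiding in the monoidal opposite. -/
def RightHalfBraiding.mop {X : C} (τ : RightHalfBraiding X) :
    LeftHalfBraiding (MonoidalOpposite.mop X) where
  s U := (τ.t U.unmop).mop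
  natural f := congrArg Quiver.Hom.mop (τ.natural f.unmop)
  hexagon U V := congrArg Quiver.Hom.mop (τ.hexagon V.unmop U.unmop)
  unit := congrArg Quiver.Hom.mop τ.unit

theorem LeftHalfBraiding.IsHom.unmop {X Y : Cᴹᵒᵖ} {σ : LeftHalfBraiding X} {τ : LeftHalfBraiding Y}
    {f : X ⟶ Y} (h : LeftHalfBraiding.IsHom σ τ f) :
    RightHalfBraiding.IsHom σ.unmop τ.unmop f.unmop := fun U =>
  congrArg Quiver.Hom.unmop (h (.mop U))

theorem LeftHalfBraiding.IsHom.of_unmop {X Y : Cᴹᵒᵖ} {σ : LeftHalfBraiding X}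
    {τ : LeftHalfBraiding Y} {f : X ⟶ Y} (h : RightHalfBraiding.IsHom σ.unmop τ.unmop f.unmop) :
    LeftHalfBraiding.IsHom σ τ f := fun U =>
  congrArg Quiver.Hom.mop (h U.unmop)

theorem LeftHalfBraiding.unmop_injective {X : Cᴹᵒᵖ} :
    Function.Injective (LeftHalfBraiding.unmop : LeftHalfBraiding X → _) := fun σ τ h =>
  LeftHalfBraiding.ext' fun U =>
    congrArg (fun ρ : RightHalfBraiding X.unmop => (ρ.t U.unmop).mop) h

end Mop

section Invert

variable {C : Type u} [Category.{v} C] [MonoidalCategory C] {X Y : C}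

/-- The inverse of an invertible left half-braiding. -/
def LeftHalfBraiding.inverse (σ : LeftHalfBraiding X) (h : ∀ U, IsIso (σ.s U)) :
    RightHalfBraiding X where
  t U := inv (σ.s U)
  natural {U V} f := by
    rw [IsIso.comp_inv_eq, Category.assoc, σ.natural, IsIso.inv_hom_id_assoc]
  hexagon U V := by
    simp only [σ.hexagon', IsIso.inv_comp, IsIso.Iso.inv_inv, IsIso.Iso.inv_hom,
      Category.assoc, Iso.inv_hom_id_assoc, Iso.hom_inv_id, Category.comp_id]
    simp
  unit := by simp [σ.unit]

/-- The inverse of an invertible right half-braiding. -/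
def RightHalfBraiding.inverse (τ : RightHalfBraiding X) (h : ∀ U, IsIso (τ.t U)) :
    LeftHalfBraiding X where
  s U := inv (τ.t U)
  natural {U V} f := by
    rw [IsIso.comp_inv_eq, Category.assoc, τ.natural, IsIso.inv_hom_id_assoc]
  hexagon U V := by
    simp [τ.hexagon']
  unit := by simp [τ.unit]

theorem RightHalfBraiding.isHom_of_inverse {σ : LeftHalfBraiding X} {τ : LeftHalfBraiding Y}
    (hσ : ∀ U, IsIso (σ.s U)) (hτ : ∀ U, IsIso (τ.s U)) (f : X ⟶ Y) :
    RightHalfBraiding.IsHom (σ.inverse hσ) (τ.inverse hτ) f ↔ LeftHalfBraiding.IsHom σ τ f := by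
  refine forall_congr' fun U => ?_
  change U ◁ f ≫ inv (τ.s U) = inv (σ.s U) ≫ f ▷ U ↔ _
  rw [IsIso.comp_inv_eq, Category.assoc, IsIso.eq_inv_comp, eq_comm]

theorem LeftHalfBraiding.inverse_congr {σ τ : LeftHalfBraiding X} (h : σ = τ)
    (hσ : ∀ U, IsIso (σ.s U)) (hτ : ∀ U, IsIso (τ.s U)) : σ.inverse hσ = τ.inverse hτ := by
  subst h; rfl

theorem LeftHalfBraiding.inverse_injective {σ τ : LeftHalfBraiding X}
    {hσ : ∀ U, IsIso (σ.s U)} {hτ : ∀ U, IsIso (τ.s U)} (h : σ.inverse hσ = τ.inverse hτ) : σ = τ :=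
  LeftHalfBraiding.ext' fun U =>
    IsIso.inv_eq_inv.1 (congrArg (fun ρ : RightHalfBraiding X => ρ.t U) h)

theorem RightHalfBraiding.inverse_inverse (τ : RightHalfBraiding X) (h : ∀ U, IsIso (τ.t U))
    (h' : ∀ U, IsIso ((τ.inverse h).s U)) : (τ.inverse h).inverse h' = τ :=
  RightHalfBraiding.ext' fun U => IsIso.inv_inv (f := τ.t U)

theorem RightHalfBraiding.isHom_id {σ τ : RightHalfBraiding X} (h : σ = τ) :
    RightHalfBraiding.IsHom σ τ (𝟙 X) := fun U => by
  subst h; simp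

theorem LeftHalfBraiding.inverse_tensor {σ : LeftHalfBraiding X} {τ : LeftHalfBraiding Y}
    (hσ : ∀ U, IsIso (σ.s U)) (hτ : ∀ U, IsIso (τ.s U)) (h : ∀ U, IsIso ((σ.tensor τ).s U)) :
    (σ.tensor τ).inverse h = (σ.inverse hσ).tensor (τ.inverse hτ) :=
  RightHalfBraiding.ext' fun U => by
    simp [LeftHalfBraiding.inverse, LeftHalfBraiding.tensor, RightHalfBraiding.tensor]

theorem LeftHalfBraiding.inverse_tensorUnit (h : ∀ U, IsIso ((LeftHalfBraiding.tensorUnit C).s U)) :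
    (LeftHalfBraiding.tensorUnit C).inverse h = RightHalfBraiding.tensorUnit C :=
  RightHalfBraiding.ext' fun U => by
    simp [LeftHalfBraiding.inverse, LeftHalfBraiding.tensorUnit, RightHalfBraiding.tensorUnit]

end Invert

/-! ### Invertibility of left half-braidings -/

section Invertible

variable {k H : Type u} [Field k] [Ring H] [Algebra k H] [Q : QuasiHopfAlgebra k H]

/-- The left module with the action `h • w = w • S⁻¹(h)`, which is strictly inverse to `toOp`. -/
abbrev fromOp (W : HMod k Hᵐᵒᵖ) : HMod k H where
  carrier := W
  act := .ofLinearMap (W.act.toLinearMap ∘ₗ (MulOpposite.opLinearEquiv k).toLinearMap ∘ₗ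
      Q.antipode.symm.toLinearMap)
    (by simp [antipode_symm_one]) (by intro a b; simp [antipode_symm_mul])

theorem toOp_fromOp (W : HMod k Hᵐᵒᵖ) : toOp (fromOp W) = W := by
  have : opAct (fromOp W) = W.act := AlgHom.ext fun h => by simp [opAct]
  exact congrArg (fun a => ({ carrier := W, act := a } : HMod k Hᵐᵒᵖ)) this

theorem fromOp_toOp (V : HMod k H) : fromOp (toOp V) = V := by
  have : (fromOp (toOp V)).act = V.act := AlgHom.ext fun h => by simp [opAct]
  exact congrArg (fun a => ({ carrier := V, act := a } : HMod k H)) this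

theorem toOp_injective : Function.Injective (toOp : HMod k H → HMod k Hᵐᵒᵖ) :=
  Function.LeftInverse.injective fromOp_toOp

theorem toOp_surjective : Function.Surjective (toOp : HMod k H → HMod k Hᵐᵒᵖ) :=
  Function.RightInverse.surjective toOp_fromOp

instance : (antipodeFunctor k H).Monoidal := (antipodeFunctorCore k H).toMonoidal

instance : (antipodeFunctor k H).Faithful where
  map_injective h := HMod.Hom.ext (congrArg (fun f => HMod.Hom.lin f.unmop) h)

instance : (antipodeFunctor k H).Full where
  map_surjective {X Y} f := ⟨⟨f.unmop.lin, fun h v => by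
    have h1 : f.unmop.lin (X.act (Q.antipode (Q.antipode.symm h)) v) =
        Y.act (Q.antipode (Q.antipode.symm h)) (f.unmop.lin v) :=
      f.unmop.map_act (.op (Q.antipode.symm h)) v
    rwa [LinearEquiv.apply_symm_apply] at h1⟩, rfl⟩

instance : (antipodeFunctor k H).EssSurj where
  mem_essImage W := by
    obtain ⟨V, hV⟩ := toOp_surjective W.unmop
    exact ⟨V, ⟨eqToIso (congrArg MonoidalOpposite.mop hV)⟩⟩

/-- Over a quasi-Hopf algebra, left half-braidings are invertible: the antipode functor transports
them to right half-braidings over the opposite algebra. -/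
theorem LeftHalfBraiding.isIso_s {X : HMod k H} (σ : LeftHalfBraiding X) (V : HMod k H) :
    IsIso (σ.s V) := by
  refine σ.isIso_of_transport (antipodeFunctor k H) (fun W => ?_) V
  have := (σ.transport (antipodeFunctor k H)).unmop.isIso_t W.unmop
  exact inferInstanceAs (IsIso (((σ.transport (antipodeFunctor k H)).unmop.t W.unmop).mop))

end Invertible

/-! ### The functors between categories of Yetter-Drinfeld modules -/

open MonoidalCategory

theorem RightHalfBraiding.isHom_inv {C : Type u} [Category.{v} C] [MonoidalCategory C] {X Y : C}
    {σ : RightHalfBraiding X} {τ : RightHalfBraiding Y} (e : X ≅ Y) (h : IsHom σ τ e.hom) :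
    IsHom τ σ e.inv := fun U => by
  rw [← cancel_epi (U ◁ e.hom), ← cancel_mono (e.hom ▷ U)]
  simp [h U]

section YetterDrinfeld

variable {k H : Type u} [Field k] [Ring H] [Algebra k H]

section QuasiBialgebra

variable [QuasiBialgebra k H]

namespace LeftYD

theorem ofHalfBraiding_self (M : LeftYD k H) : ofHalfBraiding M.toMod M.halfBraiding = M := by
  have h : (ofHalfBraiding M.toMod M.halfBraiding).coact = M.coact :=
    LinearMap.ext fun m => leftSwap_regular_one M.coact m
  cases M
  exact LeftYD.mk.injEq .. |>.mpr ⟨rfl, heq_of_eq h⟩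

theorem isIso_of_isIso_hom {M N : LeftYD k H} (f : M ⟶ N) [IsIso f.hom] : IsIso f :=
  ⟨homOfIsHom (inv f.hom) (LeftHalfBraiding.isHom_inv (asIso f.hom) (isHom_hom f)),
    LeftYD.hom_ext (IsIso.hom_inv_id f.hom), LeftYD.hom_ext (IsIso.inv_hom_id f.hom)⟩

end LeftYD

namespace LeftRightYD

theorem ofHalfBraiding_self (M : LeftRightYD k H) : ofHalfBraiding M.toMod M.halfBraiding = M := by
  have h : (ofHalfBraiding M.toMod M.halfBraiding).coact = M.coact :=
    LinearMap.ext fun m => rightSwap_regular_one M.coact m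
  cases M
  exact LeftRightYD.mk.injEq .. |>.mpr ⟨rfl, heq_of_eq h⟩

theorem isIso_of_isIso_hom {M N : LeftRightYD k H} (f : M ⟶ N) [IsIso f.hom] : IsIso f :=
  ⟨homOfIsHom (inv f.hom) (RightHalfBraiding.isHom_inv (asIso f.hom) (isHom_hom f)),
    LeftRightYD.hom_ext (IsIso.hom_inv_id f.hom), LeftRightYD.hom_ext (IsIso.inv_hom_id f.hom)⟩

/-- A morphism of the weak right center, as a morphism of Yetter-Drinfeld modules. -/
def ofHalfBraidingHom {M N : HMod k H} {σ : RightHalfBraiding M} {τ : RightHalfBraiding N}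
    (f : M ⟶ N) (h : RightHalfBraiding.IsHom σ τ f) : ofHalfBraiding M σ ⟶ ofHalfBraiding N τ :=
  homOfIsHom (M := ofHalfBraiding M σ) (N := ofHalfBraiding N τ) f (by
    rw [ofHalfBraiding_halfBraiding, ofHalfBraiding_halfBraiding]; exact h)

/-- An isomorphism of the weak right center, as an isomorphism of Yetter-Drinfeld modules. -/
def ofHalfBraidingIso {M N : HMod k H} {σ : RightHalfBraiding M} {τ : RightHalfBraiding N}
    (e : M ≅ N) (h : RightHalfBraiding.IsHom σ τ e.hom) :
    ofHalfBraiding M σ ≅ ofHalfBraiding N τ where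
  hom := ofHalfBraidingHom e.hom h
  inv := ofHalfBraidingHom e.inv (RightHalfBraiding.isHom_inv e h)
  hom_inv_id := LeftRightYD.hom_ext e.hom_inv_id
  inv_hom_id := LeftRightYD.hom_ext e.inv_hom_id

theorem ofHalfBraiding_inj {M N : HMod k H} {σ : RightHalfBraiding M} {τ : RightHalfBraiding N}
    (h : ofHalfBraiding M σ = ofHalfBraiding N τ) : M = N ∧ HEq σ τ := by
  have h1 : M = N := congrArg LeftRightYD.toMod h
  subst h1
  exact ⟨rfl, (heq_of_eq (ofHalfBraiding_halfBraiding M σ).symm).trans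
    ((congr_arg_heq LeftRightYD.halfBraiding h).trans
      (heq_of_eq (ofHalfBraiding_halfBraiding M τ)))⟩

end LeftRightYD

end QuasiBialgebra

variable [Q : QuasiHopfAlgebra k H]

instance : IsBraided (LeftYD k H) where
  isIso_braid M N := by
    have : IsIso (PrebraidedCategory.braid M N).hom := M.halfBraiding.isIso_s N.toMod
    exact LeftYD.isIso_of_isIso_hom _

instance : IsBraided (LeftRightYD k H) where
  isIso_braid M N := by
    have : IsIso (PrebraidedCategory.braid M N).hom := N.halfBraiding.isIso_t M.toMod
    exact LeftRightYD.isIso_of_isIso_hom _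

theorem rightYD_isBraided : IsBraided (RightYD k H) := inferInstance

theorem rightLeftYD_isBraided : IsBraided (RightLeftYD k H) := inferInstance

namespace LeftYD

/-- The left-right Yetter-Drinfeld module with the inverse half-braiding. -/
def inverseObj (M : LeftYD k H) : LeftRightYD k H :=
  .ofHalfBraiding M.toMod (M.halfBraiding.inverse M.halfBraiding.isIso_s)

theorem inverseObj_halfBraiding (M : LeftYD k H) : (inverseObj M).halfBraiding =
    M.halfBraiding.inverse M.halfBraiding.isIso_s :=
  LeftRightYD.ofHalfBraiding_halfBraiding _ _

variable (k H) in
/-- The passage to the inverse half-braidings, as a functor. -/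
def inverseFunctor : LeftYD k H ⥤ InverseBraided (LeftRightYD k H) where
  obj := inverseObj
  map {M N} f := LeftRightYD.ofHalfBraidingHom f.hom
    ((RightHalfBraiding.isHom_of_inverse _ _ _).2 (isHom_hom f))

variable (k H) in
/-- The monoidal structure of the passage to inverse half-braidings. Its constraints are the identity
maps of the underlying modules. -/
def inverseFunctorCore : (inverseFunctor k H).CoreMonoidal where
  εIso := LeftRightYD.ofHalfBraidingIso (Iso.refl (𝟙_ (HMod k H))) (by
    exact RightHalfBraiding.isHom_id ((LeftHalfBraiding.inverse_tensorUnit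
      (LeftHalfBraiding.isIso_s _)).symm.trans (LeftHalfBraiding.inverse_congr
        LeftYD.unit_halfBraiding.symm _ _)))
  μIso M N := LeftRightYD.ofHalfBraidingIso (Iso.refl (M.toMod ⊗ N.toMod)) (by
    change RightHalfBraiding.IsHom ((inverseObj M).halfBraiding.tensor (inverseObj N).halfBraiding)
      ((LeftYD.tensor M N).halfBraiding.inverse _) (𝟙 (M.toMod ⊗ N.toMod))
    rw [inverseObj_halfBraiding, inverseObj_halfBraiding]
    exact RightHalfBraiding.isHom_id ((LeftHalfBraiding.inverse_tensor _ _
      (LeftHalfBraiding.isIso_s _)).symm.trans (LeftHalfBraiding.inverse_congr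
        (LeftYD.tensor_halfBraiding M N).symm _ _)))
  μIso_hom_natural_left {M N} f P := LeftRightYD.hom_ext (by
    change f.hom ▷ P.toMod ≫ 𝟙 _ = 𝟙 _ ≫ f.hom ▷ P.toMod
    simp)
  μIso_hom_natural_right {M N} P f := LeftRightYD.hom_ext (by
    change P.toMod ◁ f.hom ≫ 𝟙 _ = 𝟙 _ ≫ P.toMod ◁ f.hom
    simp)
  associativity M N P := LeftRightYD.hom_ext (by
    change (𝟙 (M.toMod ⊗ N.toMod)) ▷ P.toMod ≫ 𝟙 _ ≫ (α_ M.toMod N.toMod P.toMod).hom =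
      (α_ M.toMod N.toMod P.toMod).hom ≫ M.toMod ◁ 𝟙 (N.toMod ⊗ P.toMod) ≫ 𝟙 _
    simp)
  left_unitality M := LeftRightYD.hom_ext (by
    change (λ_ M.toMod).hom = (𝟙 (𝟙_ (HMod k H))) ▷ M.toMod ≫ 𝟙 _ ≫ (λ_ M.toMod).hom
    simp)
  right_unitality M := LeftRightYD.hom_ext (by
    change (ρ_ M.toMod).hom = M.toMod ◁ (𝟙 (𝟙_ (HMod k H))) ≫ 𝟙 _ ≫ (ρ_ M.toMod).hom
    simp)

instance : (inverseFunctor k H).Monoidal := (inverseFunctorCore k H).toMonoidal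

instance : (inverseFunctor k H).Braided where
  braided M N := by
    have h1 := IsIso.hom_inv_id (PrebraidedCategory.braid (inverseObj N) (inverseObj M))
    have h2 := congrArg LeftRightYD.Hom.hom h1
    have h3 : (PrebraidedCategory.braid (inverseObj N) (inverseObj M)).hom =
        (M.halfBraiding.inverse M.halfBraiding.isIso_s).t N.toMod := by
      rw [← inverseObj_halfBraiding]; rfl
    rw [LeftRightYD.comp_hom, h3] at h2
    have := M.halfBraiding.isIso_s N.toMod
    have h4 := (IsIso.inv_comp_eq (M.halfBraiding.s N.toMod)).1 h2
    refine LeftRightYD.hom_ext ?_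
    change 𝟙 (M.toMod ⊗ N.toMod) ≫ M.halfBraiding.s N.toMod =
      (inv (PrebraidedCategory.braid (inverseObj N) (inverseObj M))).hom ≫ 𝟙 _
    rw [h4, Category.id_comp]
    exact ((Category.comp_id _).trans (Category.comp_id _)).symm

instance : (inverseFunctor k H).Faithful where
  map_injective h := LeftYD.hom_ext (congrArg LeftRightYD.Hom.hom h)

instance : (inverseFunctor k H).Full where
  map_surjective {M N} f := ⟨homOfIsHom f.hom (by
    have h : RightHalfBraiding.IsHom (inverseObj M).halfBraiding (inverseObj N).halfBraiding
      f.hom := LeftRightYD.isHom_hom f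
    rw [inverseObj_halfBraiding, inverseObj_halfBraiding] at h
    exact (RightHalfBraiding.isHom_of_inverse _ _ _).1 h), rfl⟩

theorem inverseObj_bijective : Function.Bijective (inverseObj : LeftYD k H → LeftRightYD k H) := by
  constructor
  · intro M N h
    obtain ⟨h1, h2⟩ := LeftRightYD.ofHalfBraiding_inj h
    rw [← ofHalfBraiding_self M, ← ofHalfBraiding_self N]
    obtain ⟨X, σ, rfl⟩ : ∃ X σ, M = ofHalfBraiding X σ := ⟨_, _, (ofHalfBraiding_self M).symm⟩
    obtain ⟨Y, τ, rfl⟩ : ∃ X σ, N = ofHalfBraiding X σ := ⟨_, _, (ofHalfBraiding_self N).symm⟩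
    change X = Y at h1
    subst h1
    have h3 := LeftHalfBraiding.inverse_injective (eq_of_heq h2)
    exact congrArg (ofHalfBraiding X) h3
  · intro N
    refine ⟨ofHalfBraiding N.toMod (N.halfBraiding.inverse N.halfBraiding.isIso_t), ?_⟩
    refine Eq.trans ?_ (LeftRightYD.ofHalfBraiding_self N)
    exact congrArg (LeftRightYD.ofHalfBraiding N.toMod) ((LeftHalfBraiding.inverse_congr
      (ofHalfBraiding_halfBraiding _ _) _ (LeftHalfBraiding.isIso_s _)).trans
        (RightHalfBraiding.inverse_inverse _ _ _))

variable (k H) in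
/-- The right Yetter-Drinfeld module on `toOp M`, whose half-braiding is the transport of that of `M`
along the antipode functor. This is a left half-braiding in the monoidal opposite, hence a right
half-braiding over `Hᵐᵒᵖ`. -/
def antipodeObj (M : LeftYD k H) : RightYD k H :=
  .ofHalfBraiding (toOp M.toMod) (M.halfBraiding.transport (antipodeFunctor k H)).unmop

theorem antipodeObj_halfBraiding (M : LeftYD k H) : (antipodeObj k H M).halfBraiding =
    (M.halfBraiding.transport (antipodeFunctor k H)).unmop :=
  LeftRightYD.ofHalfBraiding_halfBraiding _ _

variable (k H) in
/-- The antipode functor on Yetter-Drinfeld modules. It reverses tensor products. -/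
def ydAntipodeFunctor : LeftYD k H ⥤ (RightYD k H)ᴹᵒᵖ where
  obj M := .mop (antipodeObj k H M)
  map {M N} f := (LeftRightYD.ofHalfBraidingHom (toOpMap f.hom)
    (LeftHalfBraiding.isHom_transport (antipodeFunctor k H) _ _ (isHom_hom f)).unmop).mop

variable (k H) in
/-- The monoidal structure of the antipode functor on modules lifts to Yetter-Drinfeld modules. -/
def ydAntipodeFunctorCore : (ydAntipodeFunctor k H).CoreMonoidal where
  εIso := (LeftRightYD.ofHalfBraidingIso (toOpUnit k H).symm (by
    change RightHalfBraiding.IsHom _ (LeftHalfBraiding.transport (antipodeFunctor k H)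
      (LeftYD.unit k H).halfBraiding).unmop _
    rw [LeftYD.unit_halfBraiding]
    exact (LeftHalfBraiding.isHom_transport_ε (antipodeFunctor k H)).unmop)).mop
  μIso M N := (LeftRightYD.ofHalfBraidingIso (toOpTensor M.toMod N.toMod).symm (by
    change RightHalfBraiding.IsHom ((antipodeObj k H N).halfBraiding.tensor
      (antipodeObj k H M).halfBraiding) (LeftHalfBraiding.transport (antipodeFunctor k H)
        (LeftYD.tensor M N).halfBraiding).unmop _
    rw [antipodeObj_halfBraiding, antipodeObj_halfBraiding, LeftYD.tensor_halfBraiding]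
    exact (LeftHalfBraiding.isHom_transport_μ (antipodeFunctor k H) _ _).unmop)).mop
  μIso_hom_natural_left {M N} f P := MonoidalOpposite.hom_ext (LeftRightYD.hom_ext
    (congrArg Quiver.Hom.unmop ((antipodeFunctorCore k H).μIso_hom_natural_left f.hom P.toMod)))
  μIso_hom_natural_right {M N} P f := MonoidalOpposite.hom_ext (LeftRightYD.hom_ext
    (congrArg Quiver.Hom.unmop ((antipodeFunctorCore k H).μIso_hom_natural_right P.toMod f.hom)))
  associativity M N P := MonoidalOpposite.hom_ext (LeftRightYD.hom_ext
    (congrArg Quiver.Hom.unmop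
      ((antipodeFunctorCore k H).associativity M.toMod N.toMod P.toMod)))
  left_unitality M := MonoidalOpposite.hom_ext (LeftRightYD.hom_ext
    (congrArg Quiver.Hom.unmop ((antipodeFunctorCore k H).left_unitality M.toMod)))
  right_unitality M := MonoidalOpposite.hom_ext (LeftRightYD.hom_ext
    (congrArg Quiver.Hom.unmop ((antipodeFunctorCore k H).right_unitality M.toMod)))

instance : (ydAntipodeFunctor k H).Monoidal := (ydAntipodeFunctorCore k H).toMonoidal

instance : (ydAntipodeFunctor k H).Braided where
  braided M N := MonoidalOpposite.hom_ext (LeftRightYD.hom_ext (by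
    have h1 : (antipodeObj k H M).halfBraiding.t (toOp N.toMod) =
        (LeftHalfBraiding.mapS (antipodeFunctor k H) M.halfBraiding N.toMod).unmop := by
      rw [antipodeObj_halfBraiding, ← LeftHalfBraiding.transport_s_obj]; rfl
    change _ = (antipodeObj k H M).halfBraiding.t (toOp N.toMod) ≫ _
    rw [h1]
    refine congrArg Quiver.Hom.unmop (?_ : Functor.LaxMonoidal.μ (antipodeFunctor k H) M.toMod
      N.toMod ≫ (antipodeFunctor k H).map (M.halfBraiding.s N.toMod) =
        LeftHalfBraiding.mapS (antipodeFunctor k H) M.halfBraiding N.toMod ≫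
          Functor.LaxMonoidal.μ (antipodeFunctor k H) N.toMod M.toMod)
    simp [LeftHalfBraiding.mapS]))

instance : (ydAntipodeFunctor k H).Faithful where
  map_injective h := LeftYD.hom_ext ((antipodeFunctor k H).map_injective
    (congrArg (fun f => f.unmop.hom.mop) h))

instance : (ydAntipodeFunctor k H).Full where
  map_surjective {M N} f := by
    obtain ⟨g, hg⟩ := (antipodeFunctor k H).map_surjective f.unmop.hom.mop
    have h : RightHalfBraiding.IsHom (antipodeObj k H M).halfBraiding
      (antipodeObj k H N).halfBraiding f.unmop.hom := LeftRightYD.isHom_hom f.unmop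
    rw [antipodeObj_halfBraiding, antipodeObj_halfBraiding] at h
    have h1 : LeftHalfBraiding.IsHom (M.halfBraiding.transport (antipodeFunctor k H))
      (N.halfBraiding.transport (antipodeFunctor k H)) f.unmop.hom.mop :=
        LeftHalfBraiding.IsHom.of_unmop h
    rw [← hg] at h1
    exact ⟨homOfIsHom g (LeftHalfBraiding.isHom_of_transport _ _ _ h1),
      MonoidalOpposite.hom_ext (LeftRightYD.hom_ext (congrArg Quiver.Hom.unmop hg))⟩

theorem antipodeObj_bijective : Function.Bijective (antipodeObj k H) := by
  constructor
  · intro M N h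
    obtain ⟨h1, h2⟩ := LeftRightYD.ofHalfBraiding_inj h
    obtain ⟨X, σ, rfl⟩ : ∃ X σ, M = ofHalfBraiding X σ := ⟨_, _, (ofHalfBraiding_self M).symm⟩
    obtain ⟨Y, τ, rfl⟩ : ∃ X σ, N = ofHalfBraiding X σ := ⟨_, _, (ofHalfBraiding_self N).symm⟩
    have h1' : X = Y := toOp_injective h1
    subst h1'
    have h3 := LeftHalfBraiding.transport_injective _
      (LeftHalfBraiding.unmop_injective (eq_of_heq h2))
    rw [ofHalfBraiding_halfBraiding, ofHalfBraiding_halfBraiding] at h3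
    rw [h3]
  · intro N
    rw [← LeftRightYD.ofHalfBraiding_self N]
    generalize N.halfBraiding = τ
    revert τ
    obtain ⟨X, hX⟩ := toOp_surjective N.toMod
    rw [← hX]
    intro τ
    obtain ⟨σ, hσ⟩ := LeftHalfBraiding.transport_surjective (antipodeFunctor k H) (X := X) τ.mop
    refine ⟨ofHalfBraiding X σ, ?_⟩
    refine congrArg (LeftRightYD.ofHalfBraiding (toOp X)) ?_
    exact congrArg LeftHalfBraiding.unmop ((congrArg (LeftHalfBraiding.transport _)
      (ofHalfBraiding_halfBraiding X σ)).trans hσ)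

end LeftYD

end YetterDrinfeld

/-! ### Isomorphisms of braided monoidal categories -/

open MonoidalCategory

theorem map_inv_eq_of_map_hom_eq {C D : Type u} [Category.{v} C] [Category.{v} D]
    (F : C ⥤ D) {X Y : C} {A B : D} {u : A ⟶ F.obj X}
    {w : B ⟶ F.obj Y} {b : B ≅ A} {c : X ≅ Y} (h : u ≫ F.map c.hom = b.inv ≫ w) :
    w ≫ F.map c.inv = b.hom ≫ u := by
  rw [← cancel_mono (F.map c.hom), Category.assoc, Category.assoc, h, ← F.map_comp]
  simp

namespace BraidedMonoidalIso

open Functor.LaxMonoidal Functor.OplaxMonoidal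

variable {C D E : Type u} [Category.{v} C] [MonoidalCategory C] [BraidedCategory C]
  [Category.{v} D] [MonoidalCategory D] [BraidedCategory D]
  [Category.{v} E] [MonoidalCategory E] [BraidedCategory E]

/-- A fully faithful braided functor that is bijective on objects has a strict inverse. -/
def ofBijective (F : C ⥤ D) [F.Full] [F.Faithful] [F.Braided] (h : Function.Bijective F.obj) :
    BraidedMonoidalIso C D :=
  let g := (Equiv.ofBijective F.obj h).symm
  have hg : ∀ Y, F.obj (g Y) = Y := (Equiv.ofBijective F.obj h).apply_symm_apply
  have hg' : ∀ X, g (F.obj X) = X := (Equiv.ofBijective F.obj h).symm_apply_apply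
  { functor := F
    inverse :=
      { obj := g
        map {X Y} f := F.preimage (eqToHom (hg X) ≫ f ≫ eqToHom (hg Y).symm)
        map_id X := F.map_injective (by simp)
        map_comp f f' := F.map_injective (by simp) }
    functor_comp_inverse := CategoryTheory.Functor.ext hg' fun X Y f =>
      F.map_injective (by simp [eqToHom_map])
    inverse_comp_functor := CategoryTheory.Functor.ext hg fun X Y f => by simp
    braided := inferInstance }

/-- The equivalence of categories that underlies an isomorphism. -/
def toEquivalence (e : BraidedMonoidalIso C D) : C ≌ D :=
  .mk e.functor e.inverse (eqToIso e.functor_comp_inverse.symm) (eqToIso e.inverse_comp_functor)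

/-- The inverse isomorphism. Its monoidal structure is the one of an adjoint of a strong monoidal
equivalence. -/
def symm (e : BraidedMonoidalIso C D) : BraidedMonoidalIso D C where
  functor := e.inverse
  inverse := e.functor
  functor_comp_inverse := e.inverse_comp_functor
  inverse_comp_functor := e.functor_comp_inverse
  braided := by
    letI : e.toEquivalence.functor.Braided := e.braided
    letI := e.toEquivalence.inverseMonoidal
    refine @Functor.Braided.mk _ _ _ _ _ _ _ _ e.toEquivalence.inverse _ fun X Y => ?_
    apply e.toEquivalence.functor.map_injective
    rw [← cancel_mono (e.toEquivalence.toAdjunction.counit.app (Y ⊗ X))]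
    have h (X Y : D) : e.toEquivalence.functor.map (μ e.toEquivalence.inverse X Y) ≫
        e.toEquivalence.counit.app (X ⊗ Y) = δ e.toEquivalence.functor _ _ ≫
          (e.toEquivalence.counit.app X ⊗ₘ e.toEquivalence.counit.app Y) := by
      letI := e.toEquivalence.toAdjunction.rightAdjointLaxMonoidal
      exact e.toEquivalence.toAdjunction.map_μ_comp_counit_app_tensor X Y
    simp [h, reassoc_of% h]

/-- The composition of isomorphisms. -/
def trans (e : BraidedMonoidalIso C D) (f : BraidedMonoidalIso D E) : BraidedMonoidalIso C E where
  functor := e.functor ⋙ f.functor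
  inverse := f.inverse ⋙ e.inverse
  functor_comp_inverse := by
    rw [Functor.assoc, ← Functor.assoc f.functor, f.functor_comp_inverse, Functor.id_comp,
      e.functor_comp_inverse]
  inverse_comp_functor := by
    rw [Functor.assoc, ← Functor.assoc e.inverse, e.inverse_comp_functor, Functor.id_comp,
      f.inverse_comp_functor]
  braided := by
    have := e.braided
    have := f.braided
    infer_instance

section Mop

variable (F : C ⥤ D)

/-- The functor between the monoidal opposites. -/
def mopMap : Cᴹᵒᵖ ⥤ Dᴹᵒᵖ where
  obj X := .mop (F.obj X.unmop)
  map f := (F.map f.unmop).mop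
  map_id X := MonoidalOpposite.hom_ext (F.map_id X.unmop)
  map_comp f g := MonoidalOpposite.hom_ext (F.map_comp f.unmop g.unmop)

/-- The monoidal structure of the functor between the monoidal opposites. -/
def mopMapCore [F.Monoidal] : (mopMap F).CoreMonoidal where
  εIso := (Functor.Monoidal.εIso F).mop
  μIso X Y := (Functor.Monoidal.μIso F Y.unmop X.unmop).mop
  μIso_hom_natural_left f X' := MonoidalOpposite.hom_ext (μ_natural_right F X'.unmop f.unmop)
  μIso_hom_natural_right X' f := MonoidalOpposite.hom_ext (μ_natural_left F f.unmop X'.unmop)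
  associativity X Y Z := MonoidalOpposite.hom_ext
    (Functor.LaxMonoidal.associativity_inv F Z.unmop Y.unmop X.unmop)
  left_unitality X := MonoidalOpposite.hom_ext (right_unitality F X.unmop)
  right_unitality X := MonoidalOpposite.hom_ext (left_unitality F X.unmop)

end Mop

/-- An isomorphism from `C` to `D` with the inverse braiding is also one between the monoidal
opposites. -/
def mopInverse (e : BraidedMonoidalIso C (InverseBraided D)) :
    BraidedMonoidalIso Cᴹᵒᵖ (InverseBraided Dᴹᵒᵖ) where
  functor := mopMap e.functor
  inverse := mopMap e.inverse
  functor_comp_inverse := congrArg mopMap e.functor_comp_inverse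
  inverse_comp_functor := congrArg mopMap e.inverse_comp_functor
  braided := by
    have := e.braided
    letI := (mopMapCore e.functor).toMonoidal
    refine @Functor.Braided.mk _ _ _ _ _ _ _ _ (mopMap e.functor) _ fun X Y => ?_
    exact MonoidalOpposite.hom_ext (Functor.LaxBraided.braided (F := e.functor) Y.unmop X.unmop)

/-- An isomorphism from `C` to `D` with the inverse braiding is also one from `C` with the inverse
braiding to `D`. -/
def inverseBraided (e : BraidedMonoidalIso C (InverseBraided D)) :
    BraidedMonoidalIso (InverseBraided C) D where
  functor := (show InverseBraided C ⥤ D from e.functor)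
  inverse := (show D ⥤ InverseBraided C from e.inverse)
  functor_comp_inverse := e.functor_comp_inverse
  inverse_comp_functor := e.inverse_comp_functor
  braided := by
    letI := e.braided
    letI h : (show InverseBraided C ⥤ D from e.functor).Monoidal := e.braided.toMonoidal
    refine @Functor.Braided.mk _ _ _ _ _ _ _ _ _ h fun X Y => ?_
    have h1 := Functor.LaxBraided.braided (F := e.functor) Y X
    exact map_inv_eq_of_map_hom_eq (D := D) e.functor
      (c := @BraidedCategory.braiding C _ _ _ Y X)
      (b := @BraidedCategory.braiding D _ _ _ (e.functor.obj X) (e.functor.obj Y)) h1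

end BraidedMonoidalIso

end QuasiHopfYD

end

theorem theorem2p7 (k H : Type u) [Field k] [Ring H] [Algebra k H]
    [QuasiHopfYD.QuasiHopfAlgebra k H] :
    ∃ (_ : QuasiHopfYD.IsBraided (QuasiHopfYD.LeftYD k H))
      (_ : QuasiHopfYD.IsBraided (QuasiHopfYD.LeftRightYD k H))
      (_ : QuasiHopfYD.IsBraided (QuasiHopfYD.RightYD k H))
      (_ : QuasiHopfYD.IsBraided (QuasiHopfYD.RightLeftYD k H)),
      Nonempty (QuasiHopfYD.BraidedMonoidalIso (QuasiHopfYD.LeftYD k H)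
        (QuasiHopfYD.InverseBraided (QuasiHopfYD.LeftRightYD k H))) ∧
      Nonempty (QuasiHopfYD.BraidedMonoidalIso
        (QuasiHopfYD.InverseBraided (QuasiHopfYD.LeftRightYD k H))
        (QuasiHopfYD.RightYD k H)ᴹᵒᵖ) ∧
      Nonempty (QuasiHopfYD.BraidedMonoidalIso (QuasiHopfYD.RightYD k H)ᴹᵒᵖ
        (QuasiHopfYD.InverseBraided (QuasiHopfYD.RightLeftYD k H)ᴹᵒᵖ)) := by
  open QuasiHopfYD in
  refine ⟨inferInstance, inferInstance, rightYD_isBraided, rightLeftYD_isBraided, ?_⟩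
  -- `e`: inverse half-braidings; `f`: transport along the antipode functor; `g`: inverse
  -- half-braidings over the opposite algebra.
  let e : BraidedMonoidalIso (LeftYD k H) (InverseBraided (LeftRightYD k H)) :=
    .ofBijective (LeftYD.inverseFunctor k H) LeftYD.inverseObj_bijective
  let f : BraidedMonoidalIso (LeftYD k H) (RightYD k H)ᴹᵒᵖ :=
    .ofBijective (LeftYD.ydAntipodeFunctor k H)
      ⟨fun X Y h => LeftYD.antipodeObj_bijective.1 (congrArg MonoidalOpposite.unmop h), fun Y =>
        let ⟨M, h⟩ := LeftYD.antipodeObj_bijective.2 Y.unmop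
        ⟨M, congrArg MonoidalOpposite.mop h⟩⟩
  let g : BraidedMonoidalIso (RightLeftYD k H) (InverseBraided (RightYD k H)) :=
    .ofBijective (LeftYD.inverseFunctor k Hᵐᵒᵖ) LeftYD.inverseObj_bijective
  exact ⟨⟨e⟩, ⟨e.symm.trans f⟩, ⟨g.inverseBraided.symm.mopInverse⟩⟩
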